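/- Let $k \ge 2$ and let $m_1,\dots,m_k \ge 2$ be integers with $\prod_{i=1}^k m_i \ge 6$. Let $G=(V,E)$ be the $m_1\times\cdots\times m_k$ grid graph: $V$ is the set of all $(v_1,\dots,v_k)$ with $0\le v_i<m_i$, and two vertices are adjacent iff they differ in exactly one coordinate, and there by one. A configuration of $n\le |V|$ robots (the fully occupied case $n=|V|$ is included) is an injective map $X:\{1,\dots,n\}\to V$. A valid move takes a configuration $X$ to a configuration $Y$ such that each robot stays or moves to an adjacent vertex, that is, $Y(i)=X(i)$ or $\{X(i),Y(i)\}\in E$ for all $i$, and no two robots swap: there are no $i\ne j$ with $X(i)=Y(j)$ and $X(j)=Y(i)$. The makespan of a sequence $(X_0,\dots,X_\tau)$ of configurations in which each $(X_t,X_{t+1})$ is a valid move is $\tau$. **Theorem.** There is an algorithm with the following property. Given $k$, $m_1,\dots,m_k$ as above, an initial configuration $X_I$ of $n$ robots on the grid, a group $A\subseteq\{1,\dots,n\}$ of robots that are regarded as indistinguishable, and a set $T\subseteq V$ of goal vertices with $|T|=|A|$, it computes a sequence $(X_I=X_0,X_1,\dots,X_\tau)$ of valid moves of all $n$ robots with $X_\tau(A)=T$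 (the final positions of the robots outside $A$ are not prescribed) and makespan $$\tau = O\Big(\sum_{i=1}^k m_i\Big),$$ in running time $$O\Big(\Big(\prod_{i=1}^k m_i\Big)\Big(\sum_{i=1}^k m_i\Big)\Big).$$ The constants in both bounds are absolute; in particular they do not depend on $k$. Running time is counted on a word RAM with words of $O(\log |V|)$ bits and unit cost for each arithmetic operation, comparison, memory access and assignment, and the output is the explicit list of the positions $X_t(i)$ for all $0 \le t\le\tau$ and $1 \le i\le n$. -/

import Mathlib

namespace GridRobots

/-! ### Grids -/

/-- The vertices of the `m 0 × … × m (k-1)` grid. -/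
abbrev GridVertex {k : ℕ} (m : Fin k → ℕ) : Type := (i : Fin k) → Fin (m i)

/-- The `m 0 × … × m (k-1)` grid graph: two vertices are adjacent when they differ in exactly
one coordinate, and there by one. -/
def gridGraph {k : ℕ} (m : Fin k → ℕ) : SimpleGraph (GridVertex m) where
  Adj u v := ∃ i, (SimpleGraph.pathGraph (m i)).Adj (u i) (v i) ∧ ∀ j, j ≠ i → u j = v j
  symm := ⟨fun _ _ ⟨i, h, h'⟩ => ⟨i, h.symm, fun j hj => (h' j hj).symm⟩⟩
  loopless := ⟨fun _ ⟨_, h, _⟩ => h.ne rfl⟩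

/-! ### Synchronous collision-free motion -/

/-- A valid synchronous move from the configuration `X` to the configuration `Y` of the robots
`R`: each robot stays or moves to an adjacent vertex, robots occupy distinct vertices before and
after the move, and no two robots swap their locations. -/
structure IsMove {V R : Type} (G : SimpleGraph V) (X Y : R → V) : Prop where
  injective_source : Function.Injective X
  injective_target : Function.Injective Y
  stay_or_adj : ∀ i, Y i = X i ∨ G.Adj (X i) (Y i)
  no_swap : ∀ i j, i ≠ j → X i = Y j → X j ≠ Y i

/-- The configurations `X 0, …, X τ` form a sequence of `τ` valid moves (so its makespan is `τ`)
that starts at the configuration `XI` and at whose end the robots of the group `A`, regarded as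
indistinguishable, occupy exactly the set of vertices `T`. -/
structure IsReconfiguration {V R : Type} [DecidableEq V] (G : SimpleGraph V) (XI : R → V)
    (A : Finset R) (T : Finset V) (τ : ℕ) (X : ℕ → R → V) : Prop where
  start : X 0 = XI
  move : ∀ t < τ, IsMove G (X t) (X (t + 1))
  goal : A.image (X τ) = T

/-! ### A word RAM

Programs of a random access machine in structured form. The machine has registers and arrays that
can be addressed indirectly; a program names finitely many of each. Each arithmetic operation,
comparison, memory access and assignment costs one step. All numbers that occur in a run are
smaller than a word bound `W`; a run that leaves this range is stuck. -/

/-- The arithmetic operations and comparisons of the machine. -/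
inductive Op : Type
  | add | sub | mul | div | mod | lt | eq

/-- Truncated subtraction, division rounded down, and comparisons with value `0` or `1`. -/
def Op.eval : Op → ℕ → ℕ → ℕ
  | .add, a, b => a + b
  | .sub, a, b => a - b
  | .mul, a, b => a * b
  | .div, a, b => a / b
  | .mod, a, b => a % b
  | .lt, a, b => if a < b then 1 else 0
  | .eq, a, b => if a = b then 1 else 0

/-- Expressions: constants, registers, array entries `a[e]`, operations. -/
inductive Expr : Type
  | const (c : ℕ)
  | reg (x : ℕ)
  | load (a : ℕ) (e : Expr)
  | op (o : Op) (e₁ e₂ : Expr)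

/-- The contents of the registers and of the arrays. -/
structure State : Type where
  reg : ℕ → ℕ
  arr : ℕ → ℕ → ℕ

/-- The state after `x := v`. -/
def State.setReg (s : State) (x v : ℕ) : State :=
  { s with reg := Function.update s.reg x v }

/-- The state after `a[i] := v`. -/
def State.setArr (s : State) (a i v : ℕ) : State :=
  { s with arr := Function.update s.arr a (Function.update (s.arr a) i v) }

/-- The value of an expression. -/
def Expr.val (s : State) : Expr → ℕ
  | .const c => c
  | .reg x => s.reg x
  | .load a e => s.arr a (e.val s)
  | .op o e₁ e₂ => o.eval (e₁.val s) (e₂.val s)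

/-- All values that occur in the evaluation of an expression are smaller than `W`. -/
def Expr.Fits (W : ℕ) (s : State) : Expr → Prop
  | .const c => c < W
  | .reg x => s.reg x < W
  | .load a e => e.Fits W s ∧ s.arr a (e.val s) < W
  | .op o e₁ e₂ => e₁.Fits W s ∧ e₂.Fits W s ∧ o.eval (e₁.val s) (e₂.val s) < W

/-- The number of steps that the evaluation of an expression takes. -/
def Expr.cost : Expr → ℕ
  | .const _ => 1
  | .reg _ => 1
  | .load _ e => e.cost + 1
  | .op _ e₁ e₂ => e₁.cost + e₂.cost + 1

/-- Programs. -/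
inductive Program : Type
  | skip
  | assign (x : ℕ) (e : Expr)
  | store (a : ℕ) (i e : Expr)
  | seq (p q : Program)
  | cond (e : Expr) (p q : Program)
  | loop (e : Expr) (p : Program)

/-- `Exec W p s s' t`: with word bound `W`, the program `p` started in the state `s` halts
in the state `s'` after `t` steps. The condition of `cond` and of `loop` (a while loop) holds when
its value is not `0`. -/
inductive Exec (W : ℕ) : Program → State → State → ℕ → Prop
  | skip (s : State) : Exec W .skip s s 1
  | assign (s : State) (x : ℕ) (e : Expr) (he : e.Fits W s) :
      Exec W (.assign x e) s (s.setReg x (e.val s)) (e.cost + 1)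
  | store (s : State) (a : ℕ) (i e : Expr) (hi : i.Fits W s) (he : e.Fits W s) :
      Exec W (.store a i e) s (s.setArr a (i.val s) (e.val s)) (i.cost + e.cost + 1)
  | seq {s s' s'' : State} {p q : Program} {t t' : ℕ} (hp : Exec W p s s' t)
      (hq : Exec W q s' s'' t') : Exec W (.seq p q) s s'' (t + t')
  | cond_true {s s' : State} {e : Expr} {p q : Program} {t : ℕ} (he : e.Fits W s)
      (h : e.val s ≠ 0) (hp : Exec W p s s' t) : Exec W (.cond e p q) s s' (e.cost + 1 + t)
  | cond_false {s s' : State} {e : Expr} {p q : Program} {t : ℕ} (he : e.Fits W s)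
      (h : e.val s = 0) (hq : Exec W q s s' t) : Exec W (.cond e p q) s s' (e.cost + 1 + t)
  | loop_true {s s' s'' : State} {e : Expr} {p : Program} {t t' : ℕ} (he : e.Fits W s)
      (h : e.val s ≠ 0) (hp : Exec W p s s' t) (hl : Exec W (.loop e p) s' s'' t') :
      Exec W (.loop e p) s s'' (e.cost + 1 + t + t')
  | loop_false {s : State} {e : Expr} {p : Program} (he : e.Fits W s) (h : e.val s = 0) :
      Exec W (.loop e p) s s (e.cost + 1)

/-! ### Input and output -/

/-- The number of a grid vertex in mixed radix notation, `∑ i, v i * ∏ j < i, m j`. It is a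
bijection onto the numbers below `∏ i, m i`. -/
def vertexIndex {k : ℕ} {m : Fin k → ℕ} (v : GridVertex m) : ℕ :=
  (finPiFinEquiv v : ℕ)

/-- The state that holds the input. Register `0` holds the dimension `k` and register `1` the
number `n` of robots. Array `0` holds the side lengths, array `1` the numbers of the initial
vertices of the robots, array `2` the indicator of the group `A` of robots, and array `3` the
indicator of the set `T` of goal vertices. Everything else is `0`. -/
def inputState {k : ℕ} (m : Fin k → ℕ) {n : ℕ} (XI : Fin n → GridVertex m)
    (A : Finset (Fin n)) (T : Finset (GridVertex m)) : State where
  reg x := if x = 0 then k else if x = 1 then n else 0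
  arr a j :=
    match a with
    | 0 => if h : j < k then m ⟨j, h⟩ else 0
    | 1 => if h : j < n then vertexIndex (XI ⟨j, h⟩) else 0
    | 2 => if h : j < n then (if (⟨j, h⟩ : Fin n) ∈ A then 1 else 0) else 0
    | 3 => if h : j < ∏ i, m i then (if finPiFinEquiv.symm ⟨j, h⟩ ∈ T then 1 else 0) else 0
    | _ => 0

/-- The output in the state `s` is the sequence of configurations `X 0, …, X τ`: register `0`
holds `τ`, and the entry `t * n + i` of array `4` holds the number of the vertex `X t i` of
robot `i` at time `t`. -/
def IsOutput {k : ℕ} {m : Fin k → ℕ} {n : ℕ} (s : State) (τ : ℕ)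
    (X : ℕ → Fin n → GridVertex m) : Prop :=
  s.reg 0 = τ ∧ ∀ t ≤ τ, ∀ i : Fin n, s.arr 4 (t * n + i) = vertexIndex (X t i)

end GridRobots

/-! Since the robots of the group are indistinguishable, only the set of vertices they occupy
matters, and a configuration becomes a 0/1 labelling of the grid. Vertices are numbered in mixed
radix, so a coordinate is a digit. For a set `B` of numbers, `pattern B S` replaces the part of each
element below the stride `S` by the rank of the element in `B`, reduced modulo `S`. For `S = 1` this
is `B`; for `S = N = ∏ m i` it is the initial segment of length `|B|`, which depends on the
cardinality alone (`pattern_one`, `pattern_full`). Passing from the stride `M` of coordinate `i` to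
`M * m i` changes only digit `i` of each element, so every line in direction `i` holds equally many
ones before and after (`Rect.height_pattern`). Hence `k` phases, each moving ones only along the
lines of one coordinate, bring the initial set to the initial segment, and `k` further phases in
reverse order lead from there to the goal set.

Inside a phase all lines of length `a = m i` are rearranged at once by swaps of neighbours. Round
`t` uses the edges from row `r` to row `r + 1` with `r` congruent to `t` modulo 4, and swaps a one
with a zero exactly if this moves the number of ones before the cut towards its target. A barrier
argument (`IsRound.barrier`, `OnTrack.eq`) shows that `5 * a` rounds suffice.

A swap of two neighbours is not a legal move, but in a 2 × 3 block it is a composition of at most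
five rotations of 4-cycles and of the 6-cycle, which are legal even without any free vertex
(`Mode.rotations_foldl`, `BlockMap.valid`). To find the blocks, the other coordinates are run
through by a snake, a Hamiltonian path (`Snake.step`). The grid then contains a spanning `a × b`
rectangle whose columns are the lines in direction `i` (`Snake.rect`), and as `a * b ≥ 6` every
column edge lies in a 2 × 3 block. Rows modulo 4 and columns modulo 5 keep the simultaneous blocks
disjoint (`Rect.cell_inj`).

A round takes 5 classes times 5 rotations, that is 25 time steps, so a phase takes `125 * m i` and
both sweeps together take `250 * ∑ m i`, with constants free of `k`. Each round costs `O(N)` machine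
steps, and so does preparing the pattern and the snake of a phase; this gives `O(N * ∑ m i)` in all.
The remaining work is a Hoare logic with step counts (`Run`) and the verification of the program,
from `run_step` over `run_round` and `run_phase` to `run_main`. -/

namespace GridRobots

/-! ### Timed Hoare logic for the word RAM -/

/-- The program `p`, started in `s`, halts within `T` steps in a state that satisfies `Q`. -/
def Run (W : ℕ) (p : Program) (s : State) (T : ℕ) (Q : State → Prop) : Prop :=
  ∃ s' t, Exec W p s s' t ∧ t ≤ T ∧ Q s'

/-- The registers that a program may write. -/
def Program.regs : Program → List ℕ
  | .skip => []
  | .assign x _ => [x]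
  | .store _ _ _ => []
  | .seq p q => p.regs ++ q.regs
  | .cond _ p q => p.regs ++ q.regs
  | .loop _ p => p.regs

/-- The arrays that a program may write. -/
def Program.arrs : Program → List ℕ
  | .skip => []
  | .assign _ _ => []
  | .store a _ _ => [a]
  | .seq p q => p.arrs ++ q.arrs
  | .cond _ p q => p.arrs ++ q.arrs
  | .loop _ p => p.arrs

/-- `s'` agrees with `s` on all registers outside `R` and all arrays outside `B`. -/
structure Agree (R B : List ℕ) (s s' : State) : Prop where
  reg : ∀ x, x ∉ R → s'.reg x = s.reg x
  arr : ∀ a, a ∉ B → s'.arr a = s.arr a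

@[simp] theorem State.setReg_arr (s : State) (x v : ℕ) : (s.setReg x v).arr = s.arr := rfl

@[simp] theorem State.setArr_reg (s : State) (a i v : ℕ) : (s.setArr a i v).reg = s.reg := rfl

theorem State.setReg_reg (s : State) (x v y : ℕ) :
    (s.setReg x v).reg y = if y = x then v else s.reg y := by
  simp [State.setReg, Function.update_apply]

theorem State.setArr_arr (s : State) (a i v b : ℕ) :
    (s.setArr a i v).arr b = if b = a then Function.update (s.arr a) i v else s.arr b := by
  simp only [State.setArr, Function.update_apply]

theorem Agree.refl (R B : List ℕ) (s : State) : Agree R B s s := ⟨fun _ _ => rfl, fun _ _ => rfl⟩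

theorem Agree.trans {R B : List ℕ} {s s' s'' : State} (h : Agree R B s s')
    (h' : Agree R B s' s'') : Agree R B s s'' :=
  ⟨fun x hx => (h'.reg x hx).trans (h.reg x hx), fun a ha => (h'.arr a ha).trans (h.arr a ha)⟩

theorem Agree.mono {R B R' B' : List ℕ} {s s' : State} (h : Agree R B s s') (hR : R ⊆ R')
    (hB : B ⊆ B') : Agree R' B' s s' :=
  ⟨fun x hx => h.reg x fun h' => hx (hR h'), fun a ha => h.arr a fun h' => ha (hB h')⟩

/-- The frame rule: the written registers and arrays are read off the syntax, so invariants only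
mention what a program changes, and the rest follows by `decide` on lists. -/
theorem Exec.agree {W : ℕ} {p : Program} {s s' : State} {t : ℕ} (h : Exec W p s s' t) :
    Agree p.regs p.arrs s s' := by
  induction h with
  | skip => exact .refl _ _ _
  | assign s x e he =>
    refine ⟨fun y hy => ?_, fun a ha => rfl⟩
    rw [State.setReg_reg, if_neg (by simpa [Program.regs] using hy)]
  | store s a i e hi he =>
    refine ⟨fun y hy => rfl, fun b hb => ?_⟩
    rw [State.setArr_arr, if_neg (by simpa [Program.arrs] using hb)]
  | seq _ _ h₁ h₂ =>
    exact (h₁.mono (by simp [Program.regs]) (by simp [Program.arrs])).trans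
      (h₂.mono (by simp [Program.regs]) (by simp [Program.arrs]))
  | cond_true _ _ _ h₁ => exact h₁.mono (by simp [Program.regs]) (by simp [Program.arrs])
  | cond_false _ _ _ h₁ => exact h₁.mono (by simp [Program.regs]) (by simp [Program.arrs])
  | loop_true _ _ _ _ h₁ h₂ => exact h₁.trans h₂
  | loop_false => exact .refl _ _ _

namespace Run

variable {W : ℕ} {p q : Program} {s : State} {T T' : ℕ} {Q Q' : State → Prop}

theorem mono (h : Run W p s T Q) (hT : T ≤ T') (hQ : ∀ s', Q s' → Q' s') : Run W p s T' Q' := by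
  obtain ⟨s', t, h, ht, hq⟩ := h
  exact ⟨s', t, h, ht.trans hT, hQ s' hq⟩

theorem frame (h : Run W p s T Q) : Run W p s T fun s' => Agree p.regs p.arrs s s' ∧ Q s' := by
  obtain ⟨s', t, h, ht, hq⟩ := h
  exact ⟨s', t, h, ht, h.agree, hq⟩

/-- Sequential composition; what the first program does not write is available to the second. -/
theorem seq (hp : Run W p s T Q)
    (hq : ∀ s', Agree p.regs p.arrs s s' → Q s' → Run W q s' T' Q') :
    Run W (.seq p q) s (T + T') Q' := by
  obtain ⟨s', t, h, ht, hs⟩ := hp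
  obtain ⟨s'', t', h', ht', hs'⟩ := hq s' h.agree hs
  exact ⟨s'', t + t', .seq h h', by omega, hs'⟩

end Run

/-- The weakest precondition of a program without loops. -/
def Program.wp (W : ℕ) : Program → State → (State → Prop) → Prop
  | .skip, s, Q => Q s
  | .assign x e, s, Q => e.Fits W s ∧ Q (s.setReg x (e.val s))
  | .store a i e, s, Q => (i.Fits W s ∧ e.Fits W s) ∧ Q (s.setArr a (i.val s) (e.val s))
  | .seq p q, s, Q => p.wp W s fun s' => q.wp W s' Q
  | .cond e p q, s, Q =>
    e.Fits W s ∧ (e.val s ≠ 0 → p.wp W s Q) ∧ (e.val s = 0 → q.wp W s Q)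
  | .loop _ _, _, _ => False

/-- A bound on the number of steps of a program without loops. -/
def Program.cost : Program → ℕ
  | .skip => 1
  | .assign _ e => e.cost + 1
  | .store _ i e => i.cost + e.cost + 1
  | .seq p q => p.cost + q.cost
  | .cond e p q => e.cost + 1 + (p.cost + q.cost)
  | .loop _ _ => 0

/-- The bound adds the costs of both branches of a conditional, so it does not depend on the state.
The value 0 for loops is harmless, because their precondition is `False`. -/
theorem Run.of_wp {W : ℕ} {p : Program} {s : State} {Q : State → Prop} (h : p.wp W s Q) :
    Run W p s p.cost Q := by
  induction p generalizing s Q with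
  | skip => exact ⟨s, 1, .skip s, le_rfl, h⟩
  | assign x e => exact ⟨_, _, .assign s x e h.1, le_rfl, h.2⟩
  | store a i e => exact ⟨_, _, .store s a i e h.1.1 h.1.2, le_rfl, h.2⟩
  | seq p q hp hq => exact Run.seq (hp h) fun s' _ h' => hq h'
  | cond e p q hp hq =>
    obtain ⟨he, h₁, h₂⟩ := h
    by_cases h0 : e.val s = 0
    · obtain ⟨s', t, h, ht, hs⟩ := hq (h₂ h0)
      exact ⟨s', _, .cond_false he h0 h, by simp only [Program.cost]; omega, hs⟩
    · obtain ⟨s', t, h, ht, hs⟩ := hp (h₁ h0)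
      exact ⟨s', _, .cond_true he h0 h, by simp only [Program.cost]; omega, hs⟩
  | loop e p => exact h.elim

theorem Run.cond {W : ℕ} {e : Expr} {p q : Program} {s : State} {T : ℕ} {Q : State → Prop}
    (he : e.Fits W s) (hp : e.val s ≠ 0 → Run W p s T Q) (hq : e.val s = 0 → Run W q s T Q) :
    Run W (.cond e p q) s (e.cost + 1 + T) Q := by
  by_cases h0 : e.val s = 0
  · obtain ⟨s', t, h, ht, hs⟩ := hq h0
    exact ⟨s', _, .cond_false he h0 h, by omega, hs⟩
  · obtain ⟨s', t, h, ht, hs⟩ := hp h0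
    exact ⟨s', _, .cond_true he h0 h, by omega, hs⟩

/-- `for x = 0, …, y - 1 do p`, for registers `x` and `y`. -/
def Program.forLt (x y : ℕ) (p : Program) : Program :=
  .seq (.assign x (.const 0)) (.loop (.op .lt (.reg x) (.reg y))
    (.seq p (.assign x (.op .add (.reg x) (.const 1)))))

/-- Induction on the number `j` of remaining iterations. Agreement with the state `s₀` is carried
along, so the body may use every fact about what it does not write. The 8 is a test plus an
increment, the 4 the last test. -/
theorem Run.loopLt {W x y : ℕ} {p : Program} {s₀ : State} {n : ℕ} {T : ℕ → ℕ}
    {Inv : ℕ → State → Prop} (hW : 1 < W) (hn : s₀.reg y = n) (hnW : n < W) (hyx : y ≠ x)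
    (hx : x ∉ p.regs) (hy : y ∉ p.regs)
    (hs : ∀ i < n, ∀ s, Agree (x :: p.regs) p.arrs s₀ s → s.reg x = i → Inv i s →
      Run W p s (T i) fun s' => Inv (i + 1) (s'.setReg x (i + 1)))
    (j i : ℕ) (hij : i + j = n) (s : State) (hag : Agree (x :: p.regs) p.arrs s₀ s)
    (hxi : s.reg x = i) (hI : Inv i s) :
    Run W (.loop (.op .lt (.reg x) (.reg y)) (.seq p (.assign x (.op .add (.reg x) (.const 1)))))
      s (∑ l ∈ Finset.range j, (T (i + l) + 8) + 4) (Inv n) := by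
  have hyn : s.reg y = n := by
    rw [hag.reg y (by simp [hyx, hy]), hn]
  induction j generalizing i s with
  | zero =>
    obtain rfl : i = n := by omega
    refine ⟨s, _, .loop_false ?_ ?_, ?_, hI⟩
    · simp [Expr.Fits, Expr.val, Op.eval, hyn, hxi]; omega
    · simp [Expr.val, Op.eval, hyn, hxi]
    · simp [Expr.cost]
  | succ j ih =>
    obtain ⟨s', t, hE, ht, hI'⟩ := hs i (by omega) s hag hxi hI
    have hx' : s'.reg x = i := by rw [hE.agree.reg x hx, hxi]
    have hag' : Agree (x :: p.regs) p.arrs s₀ (s'.setReg x (i + 1)) := by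
      refine hag.trans ⟨fun z hz => ?_, fun a ha => ?_⟩
      · simp only [List.mem_cons, not_or] at hz
        rw [State.setReg_reg, if_neg hz.1, hE.agree.reg z hz.2]
      · exact hE.agree.arr a ha
    have hyn' : (s'.setReg x (i + 1)).reg y = n := by
      rw [hag'.reg y (by simp [hyx, hy]), hn]
    obtain ⟨s'', t', hE', ht', hI''⟩ := ih (i + 1) (by omega) (s'.setReg x (i + 1)) hag'
      (by simp [State.setReg_reg]) hI' hyn'
    have hA := Exec.assign (W := W) s' x (.op .add (.reg x) (.const 1))
      (by simp [Expr.Fits, Expr.val, Op.eval, hx']; omega)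
    simp only [Expr.val, Op.eval, hx'] at hA
    refine ⟨s'', _, .loop_true ?_ ?_ (.seq hE hA) hE', ?_, hI''⟩
    · simp [Expr.Fits, Expr.val, Op.eval, hyn, hxi]
      split <;> omega
    · simp [Expr.val, Op.eval, hyn, hxi]; omega
    · rw [Finset.sum_range_succ']
      simp only [Expr.cost, add_zero] at *
      have : ∑ l ∈ Finset.range j, (T (i + 1 + l) + 8) =
          ∑ l ∈ Finset.range j, (T (i + (l + 1)) + 8) :=
        Finset.sum_congr rfl fun l _ => by rw [add_assoc, add_comm 1]
      omega

/-- The rule for `forLt`. -/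
theorem Run.forLt {W x y : ℕ} {p : Program} {s : State} {n : ℕ} {T : ℕ → ℕ}
    (Inv : ℕ → State → Prop) (hW : 1 < W) (hn : s.reg y = n) (hnW : n < W) (hyx : y ≠ x)
    (hx : x ∉ p.regs) (hy : y ∉ p.regs) (h0 : Inv 0 (s.setReg x 0))
    (hs : ∀ i < n, ∀ s', Agree (x :: p.regs) p.arrs s s' → s'.reg x = i → Inv i s' →
      Run W p s' (T i) fun s'' => Inv (i + 1) (s''.setReg x (i + 1))) :
    Run W (.forLt x y p) s (∑ i ∈ Finset.range n, (T i + 8) + 6) (Inv n) := by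
  have hA := Exec.assign (W := W) s x (.const 0) (by simp [Expr.Fits]; omega)
  have hag : Agree (x :: p.regs) p.arrs s (s.setReg x 0) := by
    refine ⟨fun z hz => ?_, fun a ha => rfl⟩
    simp only [List.mem_cons, not_or] at hz
    rw [State.setReg_reg, if_neg hz.1]
  obtain ⟨s', t, hE, ht, hI⟩ := Run.loopLt hW hn hnW hyx hx hy hs n 0 (by omega) _ hag
    (by simp [State.setReg_reg]) h0
  refine ⟨s', _, .seq hA hE, ?_, hI⟩
  simp only [Expr.cost, zero_add] at *
  omega

/-- The rule for `forLt` with a constant bound for the body. -/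
theorem Run.forLt_const {W x y : ℕ} {p : Program} {s : State} {n K : ℕ}
    (Inv : ℕ → State → Prop) (hW : 1 < W) (hn : s.reg y = n) (hnW : n < W) (hyx : y ≠ x)
    (hx : x ∉ p.regs) (hy : y ∉ p.regs) (h0 : Inv 0 (s.setReg x 0))
    (hs : ∀ i < n, ∀ s', Agree (x :: p.regs) p.arrs s s' → s'.reg x = i → Inv i s' →
      Run W p s' K fun s'' => Inv (i + 1) (s''.setReg x (i + 1))) :
    Run W (.forLt x y p) s (n * (K + 8) + 6) (Inv n) := by
  simpa using Run.forLt (T := fun _ => K) Inv hW hn hnW hyx hx hy h0 hs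

end GridRobots

namespace GridRobots

/-! ### Rearranging zeros and ones on a path -/

/-- The number of ones of `p` among the first `j` cells. -/
def height (p : ℕ → ℕ) (j : ℕ) : ℕ := ∑ r ∈ Finset.range j, p r

theorem height_succ (p : ℕ → ℕ) (j : ℕ) : height p (j + 1) = height p j + p j :=
  Finset.sum_range_succ _ _

@[simp] theorem height_zero (p : ℕ → ℕ) : height p 0 = 0 := rfl

/-- On a path with `a` cells that hold the bits `p`, and are to hold the bits `q`, the cells `r`
and `r + 1` swap their contents in round `t`. -/
def Swaps (a t : ℕ) (p q : ℕ → ℕ) (r : ℕ) : Prop :=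
  r % 4 = t % 4 ∧ r + 1 < a ∧
    ((height q (r + 1) < height p (r + 1) ∧ p r = 1 ∧ p (r + 1) = 0) ∨
      (height p (r + 1) < height q (r + 1) ∧ p r = 0 ∧ p (r + 1) = 1))

/-- The bits `p'` arise from `p` by round `t`. -/
structure IsRound (a t : ℕ) (p q p' : ℕ → ℕ) : Prop where
  left : ∀ r, Swaps a t p q r → p' r = p (r + 1)
  right : ∀ r, Swaps a t p q r → p' (r + 1) = p r
  stay : ∀ r < a, ¬ Swaps a t p q r → (∀ r', r = r' + 1 → ¬ Swaps a t p q r') → p' r = p r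

theorem Swaps.not_succ {a t : ℕ} {p q : ℕ → ℕ} {r : ℕ} (h : Swaps a t p q r) :
    ¬ Swaps a t p q (r + 1) := fun h' => by have := h.1; have := h'.1; omega

/-- Only a swap across the cut between `j` and `j + 1` alters the prefix count at that cut; a swap
of `j - 1` and `j` happens inside the prefix. -/
theorem IsRound.height_eq {a t : ℕ} {p q p' : ℕ → ℕ} (h : IsRound a t p q p') (j : ℕ)
    (hj : j < a) :
    (Swaps a t p q j → height p' (j + 1) + p j = height p (j + 1) + p (j + 1)) ∧
      (¬ Swaps a t p q j → height p' (j + 1) = height p (j + 1)) := by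
  induction j with
  | zero =>
    refine ⟨fun hs => ?_, fun hs => ?_⟩
    · simp only [height_succ, height_zero, h.left 0 hs]; omega
    · simp only [height_succ, height_zero, h.stay 0 hj hs (by simp)]
  | succ j ih =>
    obtain ⟨ih₁, ih₂⟩ := ih (by omega)
    rw [height_succ p', height_succ p (j + 1)]
    refine ⟨fun hs => ?_, fun hs => ?_⟩
    · rw [ih₂ fun h' => h'.not_succ hs, h.left _ hs]; omega
    · by_cases hs' : Swaps a t p q j
      · have := ih₁ hs'
        have := h.right _ hs'
        omega
      · rw [ih₂ hs', h.stay _ hj hs]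
        intro r' hr'
        obtain rfl : j = r' := by omega
        exact hs'

theorem IsRound.height_full {a t : ℕ} {p q p' : ℕ → ℕ} (h : IsRound a t p q p') (ha : 0 < a) :
    height p' a = height p a := by
  obtain ⟨j, rfl⟩ : ∃ j, a = j + 1 := ⟨a - 1, by omega⟩
  exact (h.height_eq j (by omega)).2 fun hs => by have := hs.2.1; omega

/-- The barriers that the heights respect after `t` rounds. -/
def Barrier (a t : ℕ) (p q : ℕ → ℕ) : Prop :=
  ∀ j ≤ a, (height p j : ℤ) ≤ max (height q j : ℤ) (((j : ℤ) - 1 - t) / 4 + a) ∧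
    (j : ℤ) - height p j ≤ max ((j : ℤ) - height q j) (((j : ℤ) - 1 - t) / 4 + a)

/-- The barrier at the cut `j` is the floor of `(j - 1 - t) / 4` plus `a`. It drops by one every
fourth round, precisely when the edge across that cut is available. If the prefix count still sits
on the old barrier and above its target, then the bounds at the two neighbouring cuts force a one
before the cut and a zero behind it, so the swap takes place. The second inequality is the same
statement for zeros. -/
theorem IsRound.barrier {a t : ℕ} {p q p' : ℕ → ℕ} (h : IsRound a t p q p')
    (hp : ∀ r, p r ≤ 1) (hq : ∀ r, q r ≤ 1) (heq : height p a = height q a)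
    (hb : Barrier a t p q) : Barrier a (t + 1) p' q := by
  intro j hj
  rcases Nat.eq_zero_or_pos j with rfl | hj0
  · simp
  obtain ⟨r, rfl⟩ : ∃ r, j = r + 1 := ⟨j - 1, by omega⟩
  rcases hj.eq_or_lt with rfl | hj
  · rw [h.height_full (by omega), heq]; simp
  obtain ⟨h₁, h₂⟩ := h.height_eq r (by omega)
  have b := hb (r + 1) hj.le
  by_cases hs : Swaps a t p q r
  · have h₁ := h₁ hs
    obtain ⟨-, -, ⟨h₃, h₄, h₅⟩ | ⟨h₃, h₄, h₅⟩⟩ := hs <;> push_cast at * <;> omega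
  · have h₂ := h₂ hs
    have b₀ := hb r (by omega)
    have b₁ := hb (r + 1 + 1) hj
    have e₀ := height_succ p r
    have e₁ := height_succ p (r + 1)
    have f₀ := height_succ q r
    have f₁ := height_succ q (r + 1)
    have := hp r; have := hp (r + 1); have := hq r; have := hq (r + 1)
    rw [h₂]
    unfold Swaps at hs
    generalize height p r = x0 at *
    generalize height p (r + 1) = x1 at *
    generalize height p (r + 1 + 1) = x2 at *
    generalize height q r = y0 at *
    generalize height q (r + 1) = y1 at *
    generalize height q (r + 1 + 1) = y2 at *
    push_cast at *
    -- If the residues differ, the floor does not change from `t` to `t + 1` and neither does the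
    -- count, so the old bound serves.
    by_cases hm : r % 4 = t % 4
    · obtain ⟨w, hw⟩ : ∃ w : ℤ, (r : ℤ) - t = 4 * w := ⟨((r : ℤ) - t) / 4, by omega⟩
      rw [show ((r : ℤ) + 1 - 1 - t) / 4 = w by omega] at b
      rw [show ((r : ℤ) - 1 - t) / 4 = w - 1 by omega] at b₀
      rw [show ((r : ℤ) + 1 + 1 - 1 - t) / 4 = w by omega] at b₁
      rw [show ((r : ℤ) + 1 - 1 - (t + 1)) / 4 = w - 1 by omega]
      simp only [hm, hj, true_and, not_or, not_and] at hs
      clear hm hw hj hj0 h₂ h₁ heq hb h hp hq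
      simp only [le_max_iff] at *
      obtain ⟨b, b'⟩ := b
      obtain ⟨b₀, b₀'⟩ := b₀
      obtain ⟨b₁, b₁'⟩ := b₁
      -- Below the target only the bound for zeros can fail, above it only the bound for ones; in
      -- both cases failure would make the edge one that swaps, contrary to `hs`.
      rcases lt_trichotomy x1 y1 with hlt | heq | hlt
      · clear b₀ b₁
        refine ⟨Or.inl (by omega), ?_⟩
        by_contra hc
        have : p r = 0 := by omega
        have : p (r + 1) = 1 := by omega
        exact hs.2 hlt ‹_› ‹_›
      · subst heq
        exact ⟨Or.inl le_rfl, Or.inl le_rfl⟩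
      · clear b₀' b₁'
        refine ⟨?_, Or.inl (by omega)⟩
        by_contra hc
        have : p r = 1 := by omega
        have : p (r + 1) = 0 := by omega
        exact hs.1 hlt ‹_› ‹_›
    · have : ((r : ℤ) + 1 - 1 - (t + 1)) / 4 = ((r : ℤ) + 1 - 1 - t) / 4 := by omega
      rw [this]; exact b

theorem height_le {p : ℕ → ℕ} (hp : ∀ r, p r ≤ 1) (j : ℕ) : height p j ≤ j := by
  induction j with
  | zero => simp
  | succ j ih => rw [height_succ]; have := hp j; omega

/-- The bits `p` are on the way to `q` after `t` rounds. -/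
structure OnTrack (a t : ℕ) (p q : ℕ → ℕ) : Prop where
  height_eq : height p a = height q a
  barrier : Barrier a t p q

/-- The offset `a` makes the barriers vacuous at the start. At `j = 0` the floor of `-1 / 4` is
`-1`, which is where `0 < a` is needed. -/
theorem OnTrack.zero {a : ℕ} {p q : ℕ → ℕ} (ha : 0 < a) (hp : ∀ r, p r ≤ 1)
    (heq : height p a = height q a) : OnTrack a 0 p q := by
  refine ⟨heq, fun j hj => ?_⟩
  have := height_le hp j
  push_cast
  exact ⟨le_max_of_le_right (by omega), le_max_of_le_right (by omega)⟩

theorem OnTrack.round {a t : ℕ} {p q p' : ℕ → ℕ} (h : OnTrack a t p q) (ha : 0 < a)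
    (hp : ∀ r, p r ≤ 1) (hq : ∀ r, q r ≤ 1) (hR : IsRound a t p q p') :
    OnTrack a (t + 1) p' q :=
  ⟨(hR.height_full ha).trans h.height_eq, hR.barrier hp hq h.height_eq h.barrier⟩

/-- After `5 * a` rounds the bits are in place. -/
theorem OnTrack.eq {a : ℕ} {p q : ℕ → ℕ} (h : OnTrack a (5 * a) p q)
    (hp : ∀ r, p r ≤ 1) (hq : ∀ r, q r ≤ 1) (r : ℕ) (hr : r < a) : p r = q r := by
  have hh : ∀ j ≤ a, height p j = height q j := by
    intro j hj
    -- For `j ≤ a` the barrier at time `5 * a` is negative, so each maximum is attained by the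
    -- target: one inequality bounds the count from above, the other from below.
    have := h.barrier j hj
    have := height_le hp j
    have := height_le hq j
    push_cast at *
    omega
  have h₁ := hh r hr.le
  have h₂ := hh (r + 1) hr
  rw [height_succ, height_succ] at h₂
  omega

/-! ### Patterns -/

section Pattern
variable (B : ℕ → Prop) [DecidablePred B]

/-- The place of the one at `x` when the low digits, those of the residue modulo `S`, are replaced
by those of its rank. -/
def place (S x : ℕ) : ℕ := x / S * S + Nat.count B x % S

/-- The places of all ones. -/
def pattern (S v : ℕ) : Prop := ∃ x, B x ∧ place B S x = v

variable {B}

/-- Equal places put `x` and `y` into the same block of length `S`. Their ranks then differ by at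
most `y - x < S`, so ranks that agree modulo `S` are equal. -/
theorem place_injOn {S x y : ℕ} (hS : 0 < S) (hx : B x) (hy : B y)
    (h : place B S x = place B S y) : x = y := by
  wlog hxy : x ≤ y generalizing x y
  · exact (this hy hx h.symm (by omega)).symm
  by_contra hne
  have h₁ : x / S = y / S := by
    have := congrArg (· / S) h
    simpa [place, Nat.mul_add_div hS, Nat.add_div_of_dvd_right, Nat.div_eq_of_lt, Nat.mod_lt,
      hS] using this
  have h₂ : Nat.count B x % S = Nat.count B y % S := by
    unfold place at h; rw [h₁] at h; omega
  have h₃ : Nat.count B x < Nat.count B y := Nat.count_strict_mono hx (by omega)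
  have h₄ : Nat.count B y ≤ Nat.count B x + (y - x) := by
    obtain ⟨d, rfl⟩ := Nat.exists_eq_add_of_le hxy
    rw [Nat.count_add, Nat.add_sub_cancel_left]
    exact Nat.add_le_add_left (Nat.count_le _) _
  have h₅ : y - x < S := by
    have := Nat.div_add_mod x S; have := Nat.div_add_mod y S
    have := Nat.mod_lt x hS; have := Nat.mod_lt y hS
    rw [h₁] at *; omega
  have h₆ := (Nat.modEq_iff_dvd' h₃.le).1 h₂
  have := Nat.le_of_dvd (by omega) h₆
  omega

theorem pattern_one (v : ℕ) : pattern B 1 v ↔ B v := by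
  simp [pattern, place, Nat.mod_one]

/-- With `S = N` there is a single block and the place of an element is its rank. This is the common
intermediate form that only depends on the number of ones. -/
theorem pattern_full {N : ℕ} (hB : ∀ x, B x → x < N) (v : ℕ) :
    pattern B N v ↔ v < Nat.count B N := by
  have hp : ∀ x, B x → place B N x = Nat.count B x := fun x hx => by
    have hxN := hB x hx
    have : Nat.count B x < N := (Nat.count_le B).trans_lt hxN
    simp [place, Nat.div_eq_of_lt hxN, Nat.mod_eq_of_lt this]
  constructor
  · rintro ⟨x, hx, rfl⟩
    rw [hp x hx]
    exact Nat.count_strict_mono hx (hB x hx)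
  · intro hv
    obtain ⟨x, hx, hxv⟩ : ∃ x, B x ∧ Nat.count B x = v := by
      clear hB hp
      induction N with
      | zero => simp at hv
      | succ N ih =>
        by_cases hN : v < Nat.count B N
        · exact ih hN
        · rw [Nat.count_succ] at hv
          by_cases hBN : B N
          · exact ⟨N, hBN, by rw [if_pos hBN] at hv; omega⟩
          · rw [if_neg hBN] at hv; omega
    exact ⟨x, hx, (hp x hx).trans hxv⟩

end Pattern

end GridRobots

namespace GridRobots

/-! ### A grid as a rectangle with a snake of columns -/

/-- The numbers below `N`, with the adjacency `adj`, contain a rectangle with `a` rows and `b`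
columns as a spanning subgraph. The number at row `r` and column `g` is `L g + r * M`. -/
structure Rect (adj : ℕ → ℕ → Prop) (N a b M : ℕ) (L : ℕ → ℕ) : Prop where
  two_le_rows : 2 ≤ a
  two_le_cols : 2 ≤ b
  mul_eq : a * b = N
  six_le : 6 ≤ N
  symm : ∀ u v, adj u v → adj v u
  lt : ∀ r < a, ∀ g < b, L g + r * M < N
  inj : ∀ r < a, ∀ g < b, ∀ r' < a, ∀ g' < b, L g + r * M = L g' + r' * M → r = r' ∧ g = g'
  col_mod : ∀ g < b, L g % (M * a) < M
  adj_row : ∀ r, r + 1 < a → ∀ g < b, adj (L g + r * M) (L g + (r + 1) * M)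
  adj_col : ∀ r < a, ∀ g, g + 1 < b → adj (L g + r * M) (L (g + 1) + r * M)

theorem Rect.surj {adj : ℕ → ℕ → Prop} {N a b M : ℕ} {L : ℕ → ℕ} (h : Rect adj N a b M L)
    {v : ℕ} (hv : v < N) : ∃ r < a, ∃ g < b, L g + r * M = v := by
  let f : Fin a × Fin b → Fin N := fun x => ⟨L x.2 + x.1 * M, h.lt _ x.1.2 _ x.2.2⟩
  have hf : Function.Injective f := by
    rintro ⟨r, g⟩ ⟨r', g'⟩ hfe
    have := h.inj _ r.2 _ g.2 _ r'.2 _ g'.2 (congrArg Fin.val hfe)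
    exact Prod.ext (Fin.ext this.1) (Fin.ext this.2)
  have hb : Function.Bijective f :=
    (Fintype.bijective_iff_injective_and_card f).2 ⟨hf, by simp [h.mul_eq]⟩
  obtain ⟨⟨r, g⟩, hrg⟩ := hb.2 ⟨v, hv⟩
  exact ⟨r, r.2, g, g.2, congrArg Fin.val hrg⟩

/-! ### The columns of patterns -/

open Classical in
/-- The indicator function of a predicate. -/
noncomputable def bit (P : ℕ → Prop) (v : ℕ) : ℕ := if P v then 1 else 0

theorem bit_le_one (P : ℕ → Prop) (v : ℕ) : bit P v ≤ 1 := by unfold bit; split <;> omega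

theorem bit_eq_one {P : ℕ → Prop} {v : ℕ} : bit P v = 1 ↔ P v := by simp [bit]

theorem bit_eq_zero {P : ℕ → Prop} {v : ℕ} : bit P v = 0 ↔ ¬ P v := by simp [bit]

theorem bit_congr {P Q : ℕ → Prop} {v w : ℕ} (h : P v ↔ Q w) : bit P v = bit Q w := by
  classical
  unfold bit
  split <;> split <;> simp_all

/-- A column consists of the numbers whose digits below and above the one of weight `M` and base `a`
are prescribed; `col_mod` says that this digit vanishes in `L g`. -/
theorem Rect.mem_col_iff {adj : ℕ → ℕ → Prop} {N a b M : ℕ} {L : ℕ → ℕ} (h : Rect adj N a b M L)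
    {g : ℕ} (hg : g < b) (v : ℕ) :
    (∃ r < a, L g + r * M = v) ↔ v % M = L g % M ∧ v / (M * a) = L g / (M * a) := by
  have hlt := h.col_mod g hg
  have hM : 0 < M := by omega
  have ha : 0 < a := by have := h.two_le_rows; omega
  have hdm := Nat.div_add_mod (L g) (M * a)
  constructor
  · rintro ⟨r, hr, rfl⟩
    refine ⟨by simp, ?_⟩
    have h₁ : L g % (M * a) + r * M < M * a := by nlinarith
    conv_lhs => rw [← hdm]
    rw [add_assoc, Nat.mul_add_div (Nat.mul_pos hM ha), Nat.div_eq_of_lt h₁, add_zero]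
  · rintro ⟨h₁, h₂⟩
    refine ⟨v / M % a, Nat.mod_lt _ ha, ?_⟩
    have e₁ : L g % (M * a) = L g % M := by
      rw [← Nat.mod_eq_of_lt hlt, Nat.mod_mul_right_mod]
    have e₂ := Nat.div_add_mod v M
    have e₃ := Nat.div_add_mod (v / M) a
    rw [Nat.div_div_eq_div_mul, h₂] at e₃
    rw [← hdm, e₁, ← h₁]
    conv_rhs => rw [← e₂, ← e₃]
    ring

/-- Together with `place_div`: the places for `S` and for `S * T` have the same digits below `S`,
taken from the rank, and the same digits from `S * T` on, taken from `x`. -/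
theorem place_mod_dvd {B : ℕ → Prop} [DecidablePred B] (S T x : ℕ) :
    place B S x % S = place B (S * T) x % S := by
  simp only [place]
  rw [Nat.mul_add_mod', Nat.mod_mod, mul_comm S T, ← mul_assoc, Nat.mul_add_mod',
    Nat.mod_mul_left_mod]

theorem place_div {B : ℕ → Prop} [DecidablePred B] {S T : ℕ} (hS : 0 < S) (hT : 0 < T) (x : ℕ) :
    place B S x / (S * T) = place B (S * T) x / (S * T) := by
  simp only [place]
  rw [mul_comm _ (S * T), Nat.mul_add_div (Nat.mul_pos hS hT),
    Nat.div_eq_of_lt (Nat.mod_lt _ (Nat.mul_pos hS hT)), ← Nat.div_div_eq_div_mul,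
    mul_comm _ S, Nat.mul_add_div hS, Nat.div_eq_of_lt (Nat.mod_lt _ hS), ← Nat.div_div_eq_div_mul]
  simp

/-- Counting the elements of `B` instead of their places is legitimate because `place` is injective
on `B`. In this form the counts for two strides can be compared element by element. -/
theorem height_bit_pattern {B : ℕ → Prop} [DecidablePred B] {N a M S : ℕ} {l : ℕ} (hM : 0 < M)
    (hS : 0 < S) (hB : ∀ x, B x → x < N) :
    height (fun r => bit (pattern B S) (l + r * M)) a =
      ((Finset.range N).filter fun x => B x ∧ ∃ r < a, l + r * M = place B S x).card := by
  classical
  have h₁ : height (fun r => bit (pattern B S) (l + r * M)) a =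
      ((Finset.range a).filter fun r => pattern B S (l + r * M)).card := by
    simp only [height, bit, Finset.sum_boole, Nat.cast_id]
  rw [h₁, ← Finset.card_image_of_injOn (f := fun r => l + r * M),
    ← Finset.card_image_of_injOn (s := (Finset.range N).filter _) (f := place B S)]
  · congr 1
    ext v
    simp only [Finset.mem_image, Finset.mem_filter, Finset.mem_range]
    constructor
    · rintro ⟨r, ⟨hr, x, hx, hxr⟩, rfl⟩
      exact ⟨x, ⟨hB x hx, hx, r, hr, hxr.symm⟩, hxr⟩
    · rintro ⟨x, ⟨-, hx, r, hr, hrx⟩, rfl⟩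
      exact ⟨r, ⟨hr, x, hx, hrx.symm⟩, hrx⟩
  · intro x hx y hy h
    simp only [Finset.coe_filter, Set.mem_ofPred_eq] at hx hy
    exact place_injOn hS hx.2.1 hy.2.1 h
  · intro r _ r' _ h
    simpa [hM.ne'] using h

/-- Along each column there are as many ones before as after the digits of one more coordinate are
replaced. -/
theorem Rect.height_pattern {adj : ℕ → ℕ → Prop} {N a b M : ℕ} {L : ℕ → ℕ}
    (h : Rect adj N a b M L) {B : ℕ → Prop} [DecidablePred B] (hB : ∀ x, B x → x < N)
    {g : ℕ} (hg : g < b) :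
    height (fun r => bit (pattern B M) (L g + r * M)) a =
      height (fun r => bit (pattern B (M * a)) (L g + r * M)) a := by
  have hM : 0 < M := by have := h.col_mod g hg; omega
  have ha : 0 < a := by have := h.two_le_rows; omega
  rw [height_bit_pattern hM hM hB, height_bit_pattern hM (Nat.mul_pos hM ha) hB]
  congr 1
  ext x
  simp only [Finset.mem_filter, h.mem_col_iff hg, place_mod_dvd M a x, place_div hM ha x]

/-! ### Valid permutations -/

/-- The map `π` on the numbers below `N` is a valid move of a full configuration. -/
structure Valid (adj : ℕ → ℕ → Prop) (N : ℕ) (π : ℕ → ℕ) : Prop where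
  lt : ∀ v < N, π v < N
  inj : ∀ v < N, ∀ w < N, π v = π w → v = w
  stay_or_adj : ∀ v < N, π v = v ∨ adj v (π v)
  no_swap : ∀ v < N, π (π v) = v → π v = v

/-- The map `π` acts on the blocks `P z`, for the indices `z` with `act z`, as the permutation `σ`
of the positions, and fixes everything else below `N`. -/
structure BlockMap (N : ℕ) (act : ℕ → Prop) (P : ℕ → Fin 6 → ℕ) (σ : Fin 6 → Fin 6)
    (π : ℕ → ℕ) : Prop where
  block : ∀ z, act z → ∀ x, π (P z x) = P z (σ x)
  fixed : ∀ v < N, (∀ z, act z → ∀ x, P z x ≠ v) → π v = v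

theorem BlockMap.comp {N : ℕ} {act : ℕ → Prop} {P : ℕ → Fin 6 → ℕ} {σ σ' : Fin 6 → Fin 6}
    {π π' : ℕ → ℕ} (h : BlockMap N act P σ π) (h' : BlockMap N act P σ' π') :
    BlockMap N act P (σ' ∘ σ) (π' ∘ π) := by
  refine ⟨fun z hz x => ?_, fun v hv hf => ?_⟩
  · simp [h.block z hz, h'.block z hz]
  · simp [h.fixed v hv hf, h'.fixed v hv hf]

/-- The edges of the `2 × 3` grid whose boundary is `0, 1, …, 5`. -/
def edgeSix (x y : Fin 6) : Prop :=
  y = x + 1 ∨ x = y + 1 ∨ (x = 1 ∧ y = 4) ∨ (x = 4 ∧ y = 1)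

instance (x y : Fin 6) : Decidable (edgeSix x y) := by unfold edgeSix; infer_instance

/-- The positions of an edge that is to be swapped in a block: the edge is a short side of the
block, the short edge in the middle, or on a long side. -/
inductive Mode : Type
  | side | mid | twin

/-- An end of the edge that is to be swapped. -/
def Mode.fst : Mode → Fin 6
  | .side => 2
  | .mid => 1
  | .twin => 2

/-- The other end of the edge that is to be swapped. -/
def Mode.snd : Mode → Fin 6
  | .side => 3
  | .mid => 4
  | .twin => 1

/-- The rotations that, one after the other, swap two neighbours in a `2 × 3` grid. -/
def Mode.rotations : Mode → List (Fin 6 → Fin 6)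
  | .side => [![1, 2, 3, 4, 5, 0], ![0, 2, 3, 4, 1, 5], ![1, 4, 2, 3, 5, 0], ![5, 0, 1, 2, 3, 4],
      ![5, 0, 1, 2, 3, 4]]
  | .mid => [id, ![1, 4, 2, 3, 5, 0], ![5, 0, 1, 2, 3, 4], ![0, 2, 3, 4, 1, 5], id]
  | .twin => [id, ![0, 4, 1, 2, 3, 5], ![5, 0, 2, 3, 1, 4], ![1, 2, 3, 4, 5, 0], id]

/-- The rotation of a `2 × 3` grid is injective, moves along edges and does not swap cells. -/
def IsRotation (σ : Fin 6 → Fin 6) : Prop :=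
  (∀ x y, σ x = σ y → x = y) ∧ (∀ x, σ x = x ∨ edgeSix x (σ x)) ∧ ∀ x, σ (σ x) = x → σ x = x

instance (σ : Fin 6 → Fin 6) : Decidable (IsRotation σ) := by unfold IsRotation; infer_instance

theorem Mode.isRotation (m : Mode) : ∀ σ ∈ m.rotations, IsRotation σ := by
  cases m <;> simp only [rotations, List.forall_mem_cons] <;>
    refine ⟨?_, ?_, ?_, ?_, ?_, by simp⟩ <;> decide

/-- A finite check. The identities pad the shorter words, so that all modes take five time steps. -/
theorem Mode.rotations_foldl (m : Mode) (x : Fin 6) :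
    m.rotations.foldl (fun f σ => σ ∘ f) id x = Equiv.swap m.fst m.snd x := by
  revert x; cases m <;> decide

/-- The blocks are pairwise disjoint and each is mapped to itself, so injectivity and the absence of
swaps can be checked inside one block, where they hold for the rotation. -/
theorem BlockMap.valid {adj : ℕ → ℕ → Prop} {N : ℕ} {act : ℕ → Prop} {P : ℕ → Fin 6 → ℕ}
    {σ : Fin 6 → Fin 6} {π : ℕ → ℕ} (h : BlockMap N act P σ π)
    (hlt : ∀ z, act z → ∀ x, P z x < N)
    (hinj : ∀ z z', act z → act z' → ∀ x x', P z x = P z' x' → z = z' ∧ x = x')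
    (hadj : ∀ z, act z → ∀ x y, edgeSix x y → adj (P z x) (P z y))
    (hσ : IsRotation σ) : Valid adj N π := by
  obtain ⟨h₁, h₂, h₃⟩ := hσ
  have hsurj : Function.Surjective σ :=
    Finite.injective_iff_surjective.1 fun x y h => h₁ x y h
  have key : ∀ v < N, π v = v ∨ ∃ z, act z ∧ ∃ x, P z x = v := fun v hv => by
    by_contra! hc
    exact hc.1 (h.fixed v hv hc.2)
  have fix : ∀ v < N, (¬ ∃ z, act z ∧ ∃ x, P z x = v) → π v = v := fun v hv hc => by
    push Not at hc
    exact h.fixed v hv hc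
  have fix' : ∀ v < N, ∀ w < N, (¬ ∃ z, act z ∧ ∃ x, P z x = v) →
      (∃ z, act z ∧ ∃ x, P z x = w) → π v ≠ π w := by
    rintro v hv w hw hc ⟨z, hz, x, rfl⟩ he
    rw [fix v hv hc, h.block z hz] at he
    exact hc ⟨z, hz, _, he.symm⟩
  refine ⟨fun v hv => ?_, fun v hv w hw he => ?_, fun v hv => ?_, fun v hv he => ?_⟩
  · rcases key v hv with h' | ⟨z, hz, x, rfl⟩
    · rwa [h']
    · rw [h.block z hz]; exact hlt z hz _
  · by_cases hc : ∃ z, act z ∧ ∃ x, P z x = v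
    · by_cases hc' : ∃ z, act z ∧ ∃ x, P z x = w
      · obtain ⟨z, hz, x, rfl⟩ := hc
        obtain ⟨z', hz', x', rfl⟩ := hc'
        rw [h.block z hz, h.block z' hz'] at he
        obtain ⟨rfl, hx⟩ := hinj _ _ hz hz' _ _ he
        rw [h₁ _ _ hx]
      · exact absurd he.symm (fix' w hw v hv hc' hc)
    · by_cases hc' : ∃ z, act z ∧ ∃ x, P z x = w
      · exact absurd he (fix' v hv w hw hc hc')
      · rwa [fix v hv hc, fix w hw hc'] at he
  · rcases key v hv with h' | ⟨z, hz, x, rfl⟩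
    · exact .inl h'
    · rw [h.block z hz]
      rcases h₂ x with h' | h'
      · exact .inl (by rw [h'])
      · exact .inr (hadj z hz _ _ h')
  · rcases key v hv with h' | ⟨z, hz, x, rfl⟩
    · exact h'
    · rw [h.block z hz, h.block z hz] at he
      rw [h.block z hz, h₃ x (hinj _ _ hz hz _ _ he).2]

/-! ### Blocks in a rectangle -/

/-- The short coordinate of a cell of the `2 × 3` grid. -/
def short : Fin 6 → ℕ := ![0, 0, 0, 1, 1, 1]

/-- The long coordinate of a cell of the `2 × 3` grid. -/
def long : Fin 6 → ℕ := ![2, 1, 0, 0, 1, 2]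

/-- The row of a cell of the block for the edge from row `r` to row `r + 1`. -/
def cellRow : Mode → ℕ → ℕ → Fin 6 → ℕ
  | .side, _, r, x => r + short x
  | .mid, _, r, x => r + short x
  | .twin, a, r, x => if r + 2 < a then r + long x else r + 1 - long x

/-- The column of a cell of the block for an edge in column `g`. -/
def cellCol : Mode → ℕ → ℕ → Fin 6 → ℕ
  | .side, b, g, x => if g + 2 < b then g + long x else g - long x
  | .mid, _, _, x => long x
  | .twin, _, g, x => if short x = 0 then g else 1 - g

/-- The mode for the edges of class `c` in a rectangle with `b` columns. -/
def modeOf (b c : ℕ) : Mode := if b = 2 then .twin else if b = 3 ∧ c = 1 then .mid else .side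

/-- The cells of the block for the edge with number `z`. -/
def cell (m : Mode) (a b M : ℕ) (L : ℕ → ℕ) (z : ℕ) (x : Fin 6) : ℕ :=
  L (cellCol m b (z / a) x) + cellRow m a (z % a) x * M

/-- The indices of edges that may be treated at the same time. -/
structure InClass (a b t c z : ℕ) : Prop where
  lt : z < a * b
  row_mod : z % a % 4 = t % 4
  row_lt : z % a + 1 < a
  col_mod : z / a % 5 = c

theorem short_le (x : Fin 6) : short x ≤ 1 := by revert x; decide

theorem long_le (x : Fin 6) : long x ≤ 2 := by revert x; decide

theorem short_long_inj {x y : Fin 6} (h : short x = short y) (h' : long x = long y) : x = y := by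
  revert x y; decide

theorem edgeSix_cases {x y : Fin 6} (h : edgeSix x y) :
    (short x = short y ∧ (long x = long y + 1 ∨ long y = long x + 1)) ∨
      (long x = long y ∧ (short x = short y + 1 ∨ short y = short x + 1)) := by
  revert x y; decide

section Blocks

variable {adj : ℕ → ℕ → Prop} {N a b M : ℕ} {L : ℕ → ℕ} {t c z z' : ℕ}

theorem InClass.div_lt (hz : InClass a b t c z) : z / a < b := Nat.div_lt_of_lt_mul hz.lt

/-- Two columns force at least three rows, since `a * b ≥ 6`, and the block extends along the
column. With three or more columns it extends to one side; only the middle one of exactly three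
columns has no room on either side. -/
theorem Rect.modeOf_cases (h : Rect adj N a b M L) (hz : InClass a b t c z) :
    (modeOf b c = .twin ∧ b = 2 ∧ 3 ≤ a) ∨ (modeOf b c = .mid ∧ b = 3 ∧ z / a = 1) ∨
      (modeOf b c = .side ∧ 3 ≤ b ∧ (b = 3 → z / a ≠ 1)) := by
  have h₀ := h.two_le_cols
  have h₁ := h.mul_eq
  have h₂ := h.six_le
  have h₃ := hz.col_mod
  have h₄ := hz.div_lt
  generalize z / a = g at *
  unfold modeOf
  split
  · next hb => exact .inl ⟨rfl, hb, by subst hb; omega⟩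
  · split
    · next hb => exact .inr (.inl ⟨rfl, hb.1, by omega⟩)
    · exact .inr (.inr ⟨rfl, by omega, by omega⟩)

theorem Rect.cellRow_lt (h : Rect adj N a b M L) (hz : InClass a b t c z) (x : Fin 6) :
    cellRow (modeOf b c) a (z % a) x < a := by
  have := hz.row_lt; have := short_le x; have := long_le x
  rcases h.modeOf_cases hz with ⟨hm, hb, ha⟩ | ⟨hm, hb⟩ | ⟨hm, hb⟩ <;> simp only [hm, cellRow]
  · split <;> omega
  · omega
  · omega

theorem Rect.cellCol_lt (h : Rect adj N a b M L) (hz : InClass a b t c z) (x : Fin 6) :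
    cellCol (modeOf b c) b (z / a) x < b := by
  have := hz.div_lt; have := short_le x; have := long_le x
  rcases h.modeOf_cases hz with ⟨hm, hb, ha⟩ | ⟨hm, hb⟩ | ⟨hm, hb⟩ <;> simp only [hm, cellCol] <;>
    generalize z / a = g at *
  · split <;> omega
  · omega
  · split <;> omega

theorem Rect.cell_lt (h : Rect adj N a b M L) (hz : InClass a b t c z) (x : Fin 6) :
    cell (modeOf b c) a b M L z x < N :=
  h.lt _ (h.cellRow_lt hz x) _ (h.cellCol_lt hz x)

/-- A block reaches at most two columns to one side of its edge, and in `twin` mode it covers rows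
`r` to `r + 2` or `r - 1` to `r + 1`. Column distance 5 and row distance 4 therefore separate
blocks, even if they extend towards each other. -/
theorem Rect.cell_inj (h : Rect adj N a b M L)
    (hz : InClass a b t c z) (hz' : InClass a b t c z') (x x' : Fin 6)
    (he : cell (modeOf b c) a b M L z x = cell (modeOf b c) a b M L z' x') : z = z' ∧ x = x' := by
  obtain ⟨h₁, h₂⟩ := h.inj _ (h.cellRow_lt hz x) _ (h.cellCol_lt hz x) _
    (h.cellRow_lt hz' x') _ (h.cellCol_lt hz' x') he
  have hs := short_le x; have hl := long_le x; have hs' := short_le x'; have hl' := long_le x'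
  have r₁ := hz.row_mod; have r₂ := hz'.row_mod; have c₁ := hz.col_mod; have c₂ := hz'.col_mod
  have l₁ := hz.row_lt; have l₂ := hz'.row_lt; have d₁ := hz.div_lt; have d₂ := hz'.div_lt
  have e₁ := Nat.div_add_mod z a; have e₂ := Nat.div_add_mod z' a
  suffices hh : z % a = z' % a ∧ z / a = z' / a ∧ short x = short x' ∧ long x = long x' by
    obtain ⟨i₁, i₂, i₃, i₄⟩ := hh
    refine ⟨?_, short_long_inj i₃ i₄⟩
    rw [← e₁, ← e₂, i₁, i₂]
  clear e₁ e₂ he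
  have hm := h.modeOf_cases hz
  have hm' := h.modeOf_cases hz'
  generalize z % a = r at *
  generalize z' % a = r' at *
  generalize z / a = g at *
  generalize z' / a = g' at *
  rcases hm with ⟨hm, hb, ha⟩ | ⟨hm, hb⟩ | ⟨hm, hb⟩ <;> simp only [hm, cellRow, cellCol] at h₁ h₂
  · obtain rfl : g = g' := by omega
    obtain rfl : r = r' := by split at h₁ <;> split at h₁ <;> omega
    refine ⟨rfl, rfl, ?_, ?_⟩
    · split at h₂ <;> split at h₂ <;> omega
    · split at h₁ <;> omega
  · exact ⟨by omega, by omega, by omega, h₂⟩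
  · obtain rfl : r = r' := by omega
    obtain rfl : g = g' := by split at h₂ <;> split at h₂ <;> omega
    refine ⟨rfl, rfl, by omega, ?_⟩
    split at h₂ <;> omega

theorem Rect.adj_of_row (h : Rect adj N a b M L) {r r' g : ℕ} (hr : r < a) (hr' : r' < a)
    (hg : g < b) (hrr : r = r' + 1 ∨ r' = r + 1) : adj (L g + r * M) (L g + r' * M) := by
  rcases hrr with rfl | rfl
  · exact h.symm _ _ (h.adj_row _ hr _ hg)
  · exact h.adj_row _ hr' _ hg

theorem Rect.adj_of_col (h : Rect adj N a b M L) {r g g' : ℕ} (hr : r < a) (hg : g < b)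
    (hg' : g' < b) (hgg : g = g' + 1 ∨ g' = g + 1) : adj (L g + r * M) (L g' + r * M) := by
  rcases hgg with rfl | rfl
  · exact h.symm _ _ (h.adj_col _ hr _ hg)
  · exact h.adj_col _ hr _ hg'

theorem Rect.cell_adj (h : Rect adj N a b M L)
    (hz : InClass a b t c z) (x y : Fin 6) (he : edgeSix x y) :
    adj (cell (modeOf b c) a b M L z x) (cell (modeOf b c) a b M L z y) := by
  have hr := h.cellRow_lt hz x
  have hr' := h.cellRow_lt hz y
  have hg := h.cellCol_lt hz x
  have hg' := h.cellCol_lt hz y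
  have l₁ := hz.row_lt; have d₁ := hz.div_lt
  have hl := long_le x; have hl' := long_le y; have hs := short_le x; have hs' := short_le y
  suffices hh : (cellRow (modeOf b c) a (z % a) x = cellRow (modeOf b c) a (z % a) y ∧
      (cellCol (modeOf b c) b (z / a) x = cellCol (modeOf b c) b (z / a) y + 1 ∨
        cellCol (modeOf b c) b (z / a) y = cellCol (modeOf b c) b (z / a) x + 1)) ∨
      (cellCol (modeOf b c) b (z / a) x = cellCol (modeOf b c) b (z / a) y ∧
      (cellRow (modeOf b c) a (z % a) x = cellRow (modeOf b c) a (z % a) y + 1 ∨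
        cellRow (modeOf b c) a (z % a) y = cellRow (modeOf b c) a (z % a) x + 1)) by
    unfold cell
    rcases hh with ⟨h₁, h₂⟩ | ⟨h₁, h₂⟩
    · rw [h₁]; exact h.adj_of_col hr' hg hg' h₂
    · rw [h₁]; exact h.adj_of_row hr hr' hg' h₂
  have hc := edgeSix_cases he
  have hm := h.modeOf_cases hz
  clear hr hr' hg hg' he
  generalize z % a = r at *
  generalize z / a = g at *
  rcases hm with ⟨hm, hb, ha⟩ | ⟨hm, hb⟩ | ⟨hm, hb⟩ <;> simp only [hm, cellRow, cellCol]
  · by_cases h₀ : r + 2 < a <;> simp only [h₀, if_true, if_false] <;> split <;> split <;> omega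
  · omega
  · by_cases h₀ : g + 2 < b <;> simp only [h₀, if_true, if_false] <;> omega

/-- In `twin` mode near the last row the block is reflected, which exchanges the two ends of the
edge; a transposition does not see this. -/
theorem Rect.cell_ends (h : Rect adj N a b M L) (hz : InClass a b t c z) :
    (cell (modeOf b c) a b M L z (modeOf b c).fst = L (z / a) + z % a * M ∧
      cell (modeOf b c) a b M L z (modeOf b c).snd = L (z / a) + (z % a + 1) * M) ∨
    (cell (modeOf b c) a b M L z (modeOf b c).snd = L (z / a) + z % a * M ∧
      cell (modeOf b c) a b M L z (modeOf b c).fst = L (z / a) + (z % a + 1) * M) := by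
  have hl := hz.row_lt
  rcases h.modeOf_cases hz with ⟨hm, hb, ha⟩ | ⟨hm, hb, hg⟩ | ⟨hm, hb⟩
  · by_cases hr : z % a + 2 < a
    · left; simp [hm, Mode.fst, Mode.snd, cell, cellRow, cellCol, short, long, if_pos hr]
    · right; simp [hm, Mode.fst, Mode.snd, cell, cellRow, cellCol, short, long, if_neg hr]
  · left; simp [hm, Mode.fst, Mode.snd, cell, cellRow, cellCol, short, long, hg]
  · left; simp [hm, Mode.fst, Mode.snd, cell, cellRow, cellCol, short, long]

end Blocks

end GridRobots

namespace GridRobots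

/-! ### The effect of a round -/

/-- The map `π` swaps the ends of the edges with numbers `z` such that `act z`, and fixes
everything else below `N`. The edge number `z` joins rows `z % a` and `z % a + 1` of column
`z / a`. -/
structure SwapMap (N a M : ℕ) (L : ℕ → ℕ) (act : ℕ → Prop) (π : ℕ → ℕ) : Prop where
  fst : ∀ z, act z → π (L (z / a) + z % a * M) = L (z / a) + (z % a + 1) * M
  snd : ∀ z, act z → π (L (z / a) + (z % a + 1) * M) = L (z / a) + z % a * M
  fixed : ∀ v < N, (∀ z, act z → L (z / a) + z % a * M ≠ v ∧ L (z / a) + (z % a + 1) * M ≠ v) →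
    π v = v

section

variable {adj : ℕ → ℕ → Prop} {N a b M : ℕ} {L : ℕ → ℕ} {t c : ℕ}

theorem BlockMap.swapMap (h : Rect adj N a b M L) {act : ℕ → Prop} {π : ℕ → ℕ}
    {σ : Fin 6 → Fin 6} (hact : ∀ z, act z → InClass a b t c z)
    (hσ : ∀ x, σ x = Equiv.swap (modeOf b c).fst (modeOf b c).snd x)
    (hπ : BlockMap N act (cell (modeOf b c) a b M L) σ π) : SwapMap N a M L act π := by
  have h₁ : ∀ z, act z → π (cell (modeOf b c) a b M L z (modeOf b c).fst) =
      cell (modeOf b c) a b M L z (modeOf b c).snd := fun z hz => by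
    rw [hπ.block z hz, hσ, Equiv.swap_apply_left]
  have h₂ : ∀ z, act z → π (cell (modeOf b c) a b M L z (modeOf b c).snd) =
      cell (modeOf b c) a b M L z (modeOf b c).fst := fun z hz => by
    rw [hπ.block z hz, hσ, Equiv.swap_apply_right]
  refine ⟨fun z hz => ?_, fun z hz => ?_, fun v hv hf => ?_⟩
  · rcases h.cell_ends (hact z hz) with ⟨e₁, e₂⟩ | ⟨e₁, e₂⟩ <;> rw [← e₁, ← e₂]
    exacts [h₁ z hz, h₂ z hz]
  · rcases h.cell_ends (hact z hz) with ⟨e₁, e₂⟩ | ⟨e₁, e₂⟩ <;> rw [← e₁, ← e₂]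
    exacts [h₂ z hz, h₁ z hz]
  · by_cases hc : ∃ z, act z ∧ ∃ x, cell (modeOf b c) a b M L z x = v
    · obtain ⟨z, hz, x, rfl⟩ := hc
      have hz' := hf z hz
      rw [hπ.block z hz, hσ, Equiv.swap_apply_of_ne_of_ne]
      · rintro rfl
        rcases h.cell_ends (hact z hz) with ⟨e₁, e₂⟩ | ⟨e₁, e₂⟩
        exacts [hz'.1 e₁.symm, hz'.2 e₂.symm]
      · rintro rfl
        rcases h.cell_ends (hact z hz) with ⟨e₁, e₂⟩ | ⟨e₁, e₂⟩
        exacts [hz'.2 e₂.symm, hz'.1 e₁.symm]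
    · push Not at hc
      exact hπ.fixed v hv hc

/-- Flags that mark edges in rows of the same residue modulo `4`. -/
def FlagsOK (a b t : ℕ) (act : ℕ → Prop) : Prop :=
  ∀ z, act z → z < a * b ∧ z % a % 4 = t % 4 ∧ z % a + 1 < a

theorem Rect.swapMap_zero : SwapMap N a M L (fun _ => False) id :=
  ⟨fun _ h => h.elim, fun _ h => h.elim, fun _ _ _ => rfl⟩

theorem Rect.ends_ne (h : Rect adj N a b M L) {act : ℕ → Prop} (hact : FlagsOK a b t act)
    {z z' : ℕ} (hz : act z) (hz' : act z') (hne : z ≠ z') {i i' : ℕ} (hi : i ≤ 1) (hi' : i' ≤ 1) :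
    L (z / a) + (z % a + i) * M ≠ L (z' / a) + (z' % a + i') * M := by
  intro he
  obtain ⟨h₁, h₂, h₃⟩ := hact z hz
  obtain ⟨h₁', h₂', h₃'⟩ := hact z' hz'
  obtain ⟨e₁, e₂⟩ := h.inj _ (by omega) _ (Nat.div_lt_of_lt_mul h₁) _ (by omega) _
    (Nat.div_lt_of_lt_mul h₁') he
  apply hne
  rw [← Nat.div_add_mod z a, ← Nat.div_add_mod z' a, e₂]
  omega

/-- Flagged edges have no end in common (`Rect.ends_ne`), so the classes of columns can be treated
one after the other without disturbing each other. -/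
theorem SwapMap.comp (h : Rect adj N a b M L) {act act₁ act₂ : ℕ → Prop} {π₁ π₂ : ℕ → ℕ}
    (hact : FlagsOK a b t act) (h₁ : SwapMap N a M L act₁ π₁) (h₂ : SwapMap N a M L act₂ π₂)
    (hd : ∀ z, ¬ (act₁ z ∧ act₂ z)) (hu : ∀ z, act z ↔ act₁ z ∨ act₂ z) :
    SwapMap N a M L act (π₂ ∘ π₁) := by
  have hlt : ∀ z, act z → ∀ i ≤ 1, L (z / a) + (z % a + i) * M < N := fun z hz i hi => by
    obtain ⟨h₁, h₂, h₃⟩ := hact z hz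
    exact h.lt _ (by omega) _ (Nat.div_lt_of_lt_mul h₁)
  have hne : ∀ z z', act₁ z → act₂ z' → ∀ i ≤ 1, ∀ i' ≤ 1,
      L (z / a) + (z % a + i) * M ≠ L (z' / a) + (z' % a + i') * M := fun z z' hz hz' i hi i' hi' =>
    h.ends_ne hact ((hu z).2 (.inl hz)) ((hu z').2 (.inr hz')) (by rintro rfl; exact hd _ ⟨hz, hz'⟩)
      hi hi'
  have f₁ : ∀ z, act₂ z → ∀ i ≤ 1,
      π₁ (L (z / a) + (z % a + i) * M) = L (z / a) + (z % a + i) * M := fun z hz i hi =>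
    h₁.fixed _ (hlt z ((hu z).2 (.inr hz)) i hi) fun z' hz' =>
      ⟨hne z' z hz' hz 0 (by omega) i hi, hne z' z hz' hz 1 le_rfl i hi⟩
  have f₂ : ∀ z, act₁ z → ∀ i ≤ 1,
      π₂ (L (z / a) + (z % a + i) * M) = L (z / a) + (z % a + i) * M := fun z hz i hi =>
    h₂.fixed _ (hlt z ((hu z).2 (.inl hz)) i hi) fun z' hz' =>
      ⟨(hne z z' hz hz' i hi 0 (by omega)).symm, (hne z z' hz hz' i hi 1 le_rfl).symm⟩
  refine ⟨fun z hz => ?_, fun z hz => ?_, fun v hv hf => ?_⟩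
  · rcases (hu z).1 hz with hz | hz
    · rw [Function.comp, h₁.fst z hz]; exact f₂ z hz 1 le_rfl
    -- `f₁` speaks of row `z % a + 0`, which agrees with `z % a` only after unfolding; hence `erw`.
    · rw [Function.comp]; erw [f₁ z hz 0 (by omega)]; exact h₂.fst z hz
  · rcases (hu z).1 hz with hz | hz
    · rw [Function.comp, h₁.snd z hz]; exact f₂ z hz 0 (by omega)
    · rw [Function.comp, f₁ z hz 1 le_rfl]; exact h₂.snd z hz
  · rw [Function.comp, h₁.fixed v hv fun z hz => hf z ((hu z).2 (.inl hz)),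
      h₂.fixed v hv fun z hz => hf z ((hu z).2 (.inr hz))]

theorem SwapMap.lt_and_invol (h : Rect adj N a b M L) {act : ℕ → Prop} {π : ℕ → ℕ}
    (hact : FlagsOK a b t act) (hπ : SwapMap N a M L act π) {v : ℕ} (hv : v < N) :
    π v < N ∧ π (π v) = v := by
  by_cases hc : ∃ z, act z ∧ (L (z / a) + z % a * M = v ∨ L (z / a) + (z % a + 1) * M = v)
  · obtain ⟨z, hz, hzv⟩ := hc
    obtain ⟨h₁, h₂, h₃⟩ := hact z hz
    have hg : z / a < b := Nat.div_lt_of_lt_mul h₁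
    rcases hzv with rfl | rfl
    · rw [hπ.fst z hz, hπ.snd z hz]; exact ⟨h.lt _ h₃ _ hg, rfl⟩
    · rw [hπ.snd z hz, hπ.fst z hz]; exact ⟨h.lt _ (by omega) _ hg, rfl⟩
  · push Not at hc
    rw [hπ.fixed v hv hc, hπ.fixed v hv hc]
    exact ⟨hv, rfl⟩

/-! ### Swaps in the rectangle as rounds in all columns -/

/-- The bits of the predicate `C` in column `g`. -/
noncomputable def colBits (M : ℕ) (L : ℕ → ℕ) (C : ℕ → Prop) (g r : ℕ) : ℕ := bit C (L g + r * M)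

theorem colBits_le_one (M : ℕ) (L : ℕ → ℕ) (C : ℕ → Prop) (g r : ℕ) : colBits M L C g r ≤ 1 :=
  bit_le_one _ _

/-- The edges that are to be swapped in round `t`. -/
def Flags (a b M : ℕ) (L : ℕ → ℕ) (C Q : ℕ → Prop) (t z : ℕ) : Prop :=
  z < a * b ∧ Swaps a t (colBits M L C (z / a)) (colBits M L Q (z / a)) (z % a)

theorem flagsOK (C Q : ℕ → Prop) : FlagsOK a b t (Flags a b M L C Q t) :=
  fun _ hz => ⟨hz.1, hz.2.1, hz.2.2.1⟩

/-- A swap map is an involution, so the image of `C` is also its preimage and the new bit at `v` is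
the old bit at `π v`. Each column then sees exactly the swaps of its own edges. -/
theorem SwapMap.isRound (h : Rect adj N a b M L) {C C' Q : ℕ → Prop} {π : ℕ → ℕ}
    (hπ : SwapMap N a M L (Flags a b M L C Q t) π) (hC : ∀ v, C v → v < N)
    (hC' : ∀ v, C' v ↔ ∃ w, C w ∧ π w = v) {g : ℕ} (hg : g < b) :
    IsRound a t (colBits M L C g) (colBits M L Q g) (colBits M L C' g) := by
  have ha : 0 < a := by have := h.two_le_rows; omega
  have key : ∀ v < N, (C' v ↔ C (π v)) := fun v hv => by
    obtain ⟨h₁, h₂⟩ := hπ.lt_and_invol h (flagsOK C Q) hv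
    rw [hC']
    constructor
    · rintro ⟨w, hw, rfl⟩
      rwa [(hπ.lt_and_invol h (flagsOK C Q) (hC w hw)).2]
    · exact fun hv' => ⟨_, hv', h₂⟩
  have hz : ∀ r, Swaps a t (colBits M L C g) (colBits M L Q g) r →
      ∃ z, z / a = g ∧ z % a = r ∧ Flags a b M L C Q t z := fun r hr => by
    have hra := hr.2.1
    have e₁ : (a * g + r) / a = g := by
      rw [Nat.mul_add_div ha, Nat.div_eq_of_lt (by omega), add_zero]
    have e₂ : (a * g + r) % a = r := by rw [Nat.mul_add_mod, Nat.mod_eq_of_lt (by omega)]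
    -- Edges are numbered column by column, with `a` numbers per column.
    refine ⟨a * g + r, e₁, e₂, ?_, by rwa [e₁, e₂]⟩
    have := Nat.mul_le_mul_left a (show g + 1 ≤ b from hg)
    rw [mul_add] at this
    omega
  refine ⟨fun r hr => ?_, fun r hr => ?_, fun r hr hs hs' => ?_⟩
  · obtain ⟨z, rfl, rfl, hf⟩ := hz r hr
    apply bit_congr
    rw [key _ (h.lt _ (by have := hr.2.1; omega) _ hg), hπ.fst z hf]
  · obtain ⟨z, rfl, rfl, hf⟩ := hz r hr
    apply bit_congr
    rw [key _ (h.lt _ hr.2.1 _ hg), hπ.snd z hf]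
  · apply bit_congr
    rw [key _ (h.lt _ hr _ hg), hπ.fixed _ (h.lt _ hr _ hg)]
    rintro z ⟨hz, hsz⟩
    have hza := hsz.2.1
    have hzb : z / a < b := Nat.div_lt_of_lt_mul hz
    constructor
    · intro he
      obtain ⟨e₁, rfl⟩ := h.inj _ (by omega) _ hzb _ hr _ hg he
      rw [e₁] at hsz
      exact hs hsz
    · intro he
      obtain ⟨e₁, rfl⟩ := h.inj _ hza _ hzb _ hr _ hg he
      exact hs' _ e₁.symm hsz

/-- All columns are on the way from `C` to `Q` after `t` rounds. -/
def AllOnTrack (a b M t : ℕ) (L : ℕ → ℕ) (C Q : ℕ → Prop) : Prop :=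
  ∀ g < b, OnTrack a t (colBits M L C g) (colBits M L Q g)

theorem AllOnTrack.round (h : Rect adj N a b M L) {C C' Q : ℕ → Prop} {π : ℕ → ℕ}
    (hT : AllOnTrack a b M t L C Q)
    (hπ : SwapMap N a M L (Flags a b M L C Q t) π) (hC : ∀ v, C v → v < N)
    (hC' : ∀ v, C' v ↔ ∃ w, C w ∧ π w = v) : AllOnTrack a b M (t + 1) L C' Q := fun g hg =>
  (hT g hg).round (by have := h.two_le_rows; omega) (colBits_le_one _ _ _ _)
    (colBits_le_one _ _ _ _) (hπ.isRound h hC hC' hg)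

theorem AllOnTrack.iff (h : Rect adj N a b M L) {C Q : ℕ → Prop}
    (hT : AllOnTrack a b M (5 * a) L C Q) {v : ℕ} (hv : v < N) : C v ↔ Q v := by
  obtain ⟨r, hr, g, hg, rfl⟩ := h.surj hv
  have := (hT g hg).eq (colBits_le_one _ _ _ _) (colBits_le_one _ _ _ _) r hr
  unfold colBits at this
  rw [← bit_eq_one (P := C), ← bit_eq_one (P := Q), this]

end

end GridRobots

namespace GridRobots

/-! ### The snake through the coordinates other than one -/

/-- The product of the first `d` side lengths. -/
def stride (m : ℕ → ℕ) (d : ℕ) : ℕ := ∏ j ∈ Finset.range d, m j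

theorem stride_succ (m : ℕ → ℕ) (d : ℕ) : stride m (d + 1) = stride m d * m d :=
  Finset.prod_range_succ _ _

@[simp] theorem stride_zero (m : ℕ → ℕ) : stride m 0 = 1 := rfl

theorem stride_dvd (m : ℕ → ℕ) {d e : ℕ} (h : d ≤ e) : stride m d ∣ stride m e :=
  Finset.prod_dvd_prod_of_subset _ _ _ (by simpa using h)

theorem stride_pos {m : ℕ → ℕ} {k d : ℕ} (hm : ∀ j < k, 2 ≤ m j) (hd : d ≤ k) : 0 < stride m d :=
  Finset.prod_pos fun j hj => by have := hm j (by simp at hj; omega); omega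

/-- The number with mixed radix digits `f`. -/
def number (m : ℕ → ℕ) (k : ℕ) (f : ℕ → ℕ) : ℕ := ∑ j ∈ Finset.range k, f j * stride m j

theorem number_update (m : ℕ → ℕ) {k d : ℕ} (hd : d < k) (f : ℕ → ℕ) (hf : f d = 0) (e : ℕ) :
    number m k (Function.update f d e) = number m k f + e * stride m d := by
  unfold number
  rw [← Finset.add_sum_erase _ _ (Finset.mem_range.2 hd),
    ← Finset.add_sum_erase (a := d) _ (fun j => f j * stride m j) (Finset.mem_range.2 hd)]
  rw [Finset.sum_congr rfl fun j hj => by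
    rw [Function.update_of_ne (Finset.ne_of_mem_erase hj)]]
  simp [hf]
  ring

/-- Two digit sequences differ in one place, by one. -/
def Near (i d : ℕ) (f f' : ℕ → ℕ) : Prop :=
  ∃ j < d, j ≠ i ∧ (f' j = f j + 1 ∨ f j = f' j + 1) ∧ ∀ j', j' ≠ j → f j' = f' j'

theorem Near.symm {i d : ℕ} {f f' : ℕ → ℕ} : Near i d f f' → Near i d f' f
  | ⟨j, hj, hi, h, h'⟩ => ⟨j, hj, hi, h.symm, fun l hl => (h' l hl).symm⟩

/-- The numbers `L z`, `z < size`, with digits `f z`, run in steps between neighbours through all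
numbers below the `d`-th stride whose digit number `i` is zero. -/
structure Snake (m : ℕ → ℕ) (k i d size : ℕ) (L : ℕ → ℕ) (f : ℕ → ℕ → ℕ) : Prop where
  size_eq : size * (if i < d then m i else 1) = stride m d
  zero : ∀ z < size, ∀ j, d ≤ j ∨ j = i → f z j = 0
  digit_lt : ∀ z < size, ∀ j < d, f z j < m j
  val : ∀ z < size, L z = number m k (f z)
  lt : ∀ z < size, L z < stride m d
  mod_lt : ∀ z < size, L z % stride m (i + 1) < stride m i
  inj : ∀ z < size, ∀ z' < size, L z = L z' → z = z'
  near : ∀ z, z + 1 < size → Near i d (f z) (f (z + 1))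

section

variable {m : ℕ → ℕ} {k i d size : ℕ} {L L' : ℕ → ℕ} {f : ℕ → ℕ → ℕ}

theorem snake_zero (hm : ∀ j < k, 2 ≤ m j) (hi : i < k) (hL : L 0 = 0) :
    Snake m k i 0 1 L (fun _ _ => 0) where
  size_eq := by simp
  zero := by simp
  digit_lt := by simp
  val z hz := by simp [number, show z = 0 by omega, hL]
  lt z hz := by simp [show z = 0 by omega, hL]
  mod_lt z hz := by
    have := stride_pos hm hi.le
    simpa [show z = 0 by omega, hL]
  inj := by omega
  near := by omega

theorem Snake.skip (h : Snake m k i i size L f) (hm : ∀ j < k, 2 ≤ m j) (hi : i < k) :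
    Snake m k i (i + 1) size L f where
  size_eq := by simpa [stride_succ] using congrArg (· * m i) h.size_eq
  zero z hz j hj := h.zero z hz j (by omega)
  digit_lt z hz j hj := by
    rcases Nat.lt_succ_iff_lt_or_eq.1 hj with hj | rfl
    · exact h.digit_lt z hz j hj
    · rw [h.zero z hz j (.inr rfl)]; have := hm j hi; omega
  val := h.val
  lt z hz := (h.lt z hz).trans_le (by
    rw [stride_succ]; exact Nat.le_mul_of_pos_right _ (by have := hm i hi; omega))
  mod_lt := h.mod_lt
  inj := h.inj
  near z hz := by
    obtain ⟨j, hj, h'⟩ := h.near z hz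
    exact ⟨j, by omega, h'⟩

/-- The position in the old snake, which is run through back and forth. -/
def fold (size z : ℕ) : ℕ := if z / size % 2 = 0 then z % size else size - 1 - z % size

theorem fold_lt (hs : 0 < size) (z : ℕ) : fold size z < size := by
  have := Nat.mod_lt z hs
  unfold fold; split <;> omega

/-- The old snake is run through once for every value of the new digit `d`, alternately forwards and
backwards, so that each pass starts where the previous one ended. -/
theorem Snake.step (h : Snake m k i d size L f) (hm : ∀ j < k, 2 ≤ m j) (hi : i < k) (hd : d < k)
    (hdi : d ≠ i) (hL : ∀ z < size * m d, L' z = L (fold size z) + z / size * stride m d) :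
    Snake m k i (d + 1) (size * m d) L' fun z => Function.update (f (fold size z)) d (z / size) := by
  have hSd := stride_pos hm hd.le
  have hs : 0 < size := by
    rcases Nat.eq_zero_or_pos size with rfl | h0
    · have := h.size_eq; omega
    · exact h0
  have hfl := fold_lt hs
  have hdiv : ∀ z < size * m d, z / size < m d := fun z hz => Nat.div_lt_of_lt_mul hz
  refine ⟨?_, fun z hz j hj => ?_, fun z hz j hj => ?_, fun z hz => ?_, fun z hz => ?_,
    fun z hz => ?_, fun z hz z' hz' he => ?_, fun z hz => ?_⟩
  · rw [stride_succ, ← h.size_eq]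
    by_cases hid : i < d
    · rw [if_pos hid, if_pos (by omega)]; ring
    · rw [if_neg hid, if_neg (by omega)]; ring
  · rw [Function.update_of_ne (by omega)]
    exact h.zero _ (hfl z) j (by omega)
  · by_cases hjd : j = d
    · subst hjd; simpa using hdiv z hz
    · rw [Function.update_of_ne hjd]
      exact h.digit_lt _ (hfl z) j (by omega)
  · rw [hL z hz, h.val _ (hfl z), number_update m hd _ (h.zero _ (hfl z) d (.inl le_rfl))]
  · rw [hL z hz, stride_succ]
    have h₁ := h.lt _ (hfl z)
    have h₂ := hdiv z hz
    nlinarith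
  · rw [hL z hz]
    by_cases hid : i < d
    · obtain ⟨c, hc⟩ := stride_dvd m (show i + 1 ≤ d from hid)
      rw [hc, mul_comm (stride m (i + 1)), ← mul_assoc, Nat.add_mul_mod_self_right]
      exact h.mod_lt _ (hfl z)
    · have h₁ := h.lt _ (hfl z)
      have h₂ := hdiv z hz
      refine (Nat.mod_le _ _).trans_lt ?_
      have h₃ : stride m (d + 1) ≤ stride m i :=
        Nat.le_of_dvd (stride_pos hm hi.le) (stride_dvd m (by omega))
      rw [stride_succ] at h₃
      nlinarith
  · rw [hL z hz, hL z' hz'] at he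
    have h₁ := h.lt _ (hfl z)
    have h₂ := h.lt _ (hfl z')
    have e₁ : z / size = z' / size := by
      have := congrArg (· / stride m d) he
      simpa [Nat.add_mul_div_right _ _ hSd, Nat.div_eq_of_lt h₁, Nat.div_eq_of_lt h₂] using this
    rw [e₁] at he
    have e₂ := h.inj _ (hfl z) _ (hfl z') (by omega)
    have e₃ := Nat.div_add_mod z size
    have e₄ := Nat.div_add_mod z' size
    have := Nat.mod_lt z hs
    have := Nat.mod_lt z' hs
    have e₅ : z % size = z' % size := by
      unfold fold at e₂; rw [e₁] at e₂; split at e₂ <;> omega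
    rw [← e₃, ← e₄, e₁, e₅]
  · have e₃ := Nat.div_add_mod z size
    have hmod := Nat.mod_lt z hs
    -- Within a pass the step is one of the old snake, possibly reversed. At the end of a pass
    -- `fold` keeps its value and only digit `d` grows by one.
    by_cases hc : z % size + 1 < size
    · have e₁ : (z + 1) / size = z / size := by
        rw [← e₃, add_assoc, Nat.mul_add_div hs, Nat.div_eq_of_lt hc, Nat.mul_add_div hs,
          Nat.div_eq_of_lt hmod]
      have e₂ : (z + 1) % size = z % size + 1 := by
        conv_lhs => rw [← e₃, add_assoc, Nat.mul_add_mod, Nat.mod_eq_of_lt hc]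
      have hN : Near i d (f (fold size z)) (f (fold size (z + 1))) := by
        unfold fold
        rw [e₁, e₂]
        split
        · exact h.near _ hc
        · have := (h.near (size - 1 - (z % size + 1)) (by omega)).symm
          rwa [show size - 1 - (z % size + 1) + 1 = size - 1 - z % size by omega] at this
      obtain ⟨j, hj, hji, hd₁, hd₂⟩ := hN
      refine ⟨j, by omega, hji, ?_, fun j' hj' => ?_⟩
      · simpa [Function.update_of_ne (show j ≠ d by omega)] using hd₁
      · by_cases hjd : j' = d
        · subst hjd; simp [e₁]
        · simpa [Function.update_of_ne hjd] using hd₂ j' hj'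
    · have hc' : z % size = size - 1 := by omega
      have e₀ : z + 1 = size * (z / size + 1) := by rw [mul_add]; omega
      have e₁ : (z + 1) / size = z / size + 1 := by rw [e₀, Nat.mul_div_cancel_left _ hs]
      have e₂ : (z + 1) % size = 0 := by rw [e₀, Nat.mul_mod_right]
      have e₄ : fold size (z + 1) = fold size z := by
        unfold fold
        rw [e₁, e₂, hc']
        split <;> split <;> omega
      refine ⟨d, by omega, hdi, .inl (by simp [e₁]), fun j' hj' => ?_⟩
      simp [Function.update_of_ne hj', e₄]

end

/-! ### The numbers of grid vertices -/

section

variable {k : ℕ} {m : Fin k → ℕ}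

/-- The side lengths as a sequence. -/
def side (m : Fin k → ℕ) (j : ℕ) : ℕ := if h : j < k then m ⟨j, h⟩ else 0

theorem side_coe (m : Fin k → ℕ) (j : Fin k) : side m j = m j := by simp [side]

theorem stride_side (m : Fin k → ℕ) : stride (side m) k = ∏ i, m i := by
  rw [stride, Finset.prod_range]
  exact Finset.prod_congr rfl fun j _ => side_coe m j

theorem vertexIndex_eq (v : GridVertex m) :
    vertexIndex v = ∑ i : Fin k, (v i : ℕ) * stride (side m) i := by
  rw [vertexIndex, finPiFinEquiv_apply]
  refine Finset.sum_congr rfl fun i _ => ?_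
  rw [stride, Finset.prod_range]
  congr 1
  exact Finset.prod_congr rfl fun j _ => (side_coe m (Fin.castLE i.is_lt.le j)).symm

theorem vertexIndex_lt (v : GridVertex m) : vertexIndex v < ∏ i, m i := (finPiFinEquiv v).2

theorem vertexIndex_injective : Function.Injective (vertexIndex (m := m)) := fun _ _ h =>
  finPiFinEquiv.injective (Fin.ext h)

/-- Adjacency in the grid, in terms of vertex numbers. -/
def numAdj (m : Fin k → ℕ) (x y : ℕ) : Prop :=
  ∃ u v : GridVertex m, vertexIndex u = x ∧ vertexIndex v = y ∧ (gridGraph m).Adj u v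

theorem numAdj_number {f f' : ℕ → ℕ} {i : ℕ} (hf : ∀ j < k, f j < side m j)
    (hf' : ∀ j < k, f' j < side m j) (h : Near i k f f') :
    numAdj m (number (side m) k f) (number (side m) k f') := by
  obtain ⟨j, hj, -, h₁, h₂⟩ := h
  refine ⟨fun l => ⟨f l, by simpa [side_coe] using hf l l.2⟩,
    fun l => ⟨f' l, by simpa [side_coe] using hf' l l.2⟩, ?_, ?_, ⟨j, hj⟩, ?_, fun l hl => ?_⟩
  · rw [vertexIndex_eq, number, Finset.sum_range]
  · rw [vertexIndex_eq, number, Finset.sum_range]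
  · rw [SimpleGraph.pathGraph_adj]
    simp
    omega
  · exact Fin.ext (h₂ l fun h => hl (Fin.ext h))

/-- The columns are the lines in direction `i`, the rows are copies of the snake at a fixed value of
digit `i`. -/
theorem Snake.rect {i size : ℕ} {L : ℕ → ℕ} {f : ℕ → ℕ → ℕ}
    (h : Snake (side m) k i k size L f) (hk : 2 ≤ k) (hm : ∀ j, 2 ≤ m j) (h6 : 6 ≤ ∏ j, m j)
    (hi : i < k) : Rect (numAdj m) (∏ j, m j) (side m i) size (stride (side m) i) L := by
  have hm' : ∀ j < k, 2 ≤ side m j := fun j hj => by simpa [side, hj] using hm ⟨j, hj⟩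
  have hS := stride_pos hm' hi.le
  have hmi := hm' i hi
  have hsz : size * side m i = ∏ j, m j := by
    have := h.size_eq
    rwa [if_pos hi, stride_side] at this
  have hdig : ∀ r < side m i, ∀ g < size, ∀ j < k, Function.update (f g) i r j < side m j := by
    intro r hr g hg j hj
    by_cases hji : j = i
    · subst hji; simpa using hr
    · rw [Function.update_of_ne hji]; exact h.digit_lt g hg j hj
  have hnum : ∀ r, ∀ g < size, L g + r * stride (side m) i =
      number (side m) k (Function.update (f g) i r) := fun r g hg => by
    rw [number_update _ hi _ (h.zero g hg i (.inr rfl)), h.val g hg]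
  have hmod : ∀ g < size, L g % (stride (side m) i * side m i) < stride (side m) i :=
    fun g hg => by have := h.mod_lt g hg; rwa [stride_succ] at this
  refine ⟨hmi, ?_, by rw [mul_comm, hsz], h6, ?_, fun r hr g hg => ?_, ?_, hmod, ?_, ?_⟩
  · by_contra hc
    have hs1 : size = 1 := by
      rcases Nat.eq_zero_or_pos size with rfl | _
      · omega
      · omega
    obtain ⟨j, hj, hji⟩ : ∃ j < k, j ≠ i := by
      by_cases h0 : i = 0
      · exact ⟨1, by omega, by omega⟩
      · exact ⟨0, by omega, by omega⟩
    have h₁ : side m i * side m j ∣ stride (side m) k := by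
      rw [stride, ← Finset.prod_pair hji.symm]
      refine Finset.prod_dvd_prod_of_subset _ _ _ ?_
      intro l hl
      simp only [Finset.mem_insert, Finset.mem_singleton] at hl
      rcases hl with rfl | rfl <;> simpa
    have h₂ := Nat.le_of_dvd (stride_pos hm' le_rfl) h₁
    rw [stride_side, ← hsz, hs1] at h₂
    have := hm' j hj
    nlinarith
  · rintro u v ⟨x, y, hx, hy, ha⟩
    exact ⟨y, x, hy, hx, ha.symm⟩
  · have hd := hdig r hr g hg
    have e : number (side m) k (Function.update (f g) i r) = vertexIndex (m := m) fun l =>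
        ⟨Function.update (f g) i r l, by simpa [side_coe] using hd l l.2⟩ := by
      rw [vertexIndex_eq, number, Finset.sum_range]
    rw [hnum r g hg, e]
    exact vertexIndex_lt _
  · intro r hr g hg r' hr' g' hg' he
    -- The row is recovered as digit `i`, because this digit of `L g` is zero.
    have key : ∀ r < side m i, ∀ g < size,
        (L g + r * stride (side m) i) / stride (side m) i % side m i = r := fun r hr g hg => by
      rw [Nat.add_mul_div_right _ _ hS, Nat.add_mod]
      have : L g / stride (side m) i % side m i = 0 := by
        rw [← Nat.mod_mul_right_div_self]
        exact Nat.div_eq_of_lt (hmod g hg)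
      rw [this]
      simp [Nat.mod_eq_of_lt hr]
    have e := key r hr g hg
    rw [he, key r' hr' g' hg'] at e
    subst e
    exact ⟨rfl, h.inj g hg g' hg' (by omega)⟩
  · intro r hr g hg
    rw [hnum r g hg, hnum (r + 1) g hg]
    refine numAdj_number (i := k) (hdig r (by omega) g hg) (hdig (r + 1) hr g hg)
      ⟨i, hi, by omega, .inl (by simp), fun j' hj' => ?_⟩
    simp [Function.update_of_ne hj']
  · intro r hr g hg
    rw [hnum r g (by omega), hnum r (g + 1) hg]
    obtain ⟨j, hj, hji, h₁, h₂⟩ := h.near g hg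
    refine numAdj_number (i := i) (hdig r hr g (by omega)) (hdig r hr (g + 1) hg)
      ⟨j, hj, hji, ?_, fun j' hj' => ?_⟩
    · simpa [Function.update_of_ne hji] using h₁
    · by_cases hc : j' = i
      · subst hc; simp
      · simpa [Function.update_of_ne hc] using h₂ j' hj'

end

end GridRobots

namespace GridRobots

/-! ### Notation for expressions -/

instance : Add Expr := ⟨.op .add⟩
instance : Sub Expr := ⟨.op .sub⟩
instance : Mul Expr := ⟨.op .mul⟩
instance : Div Expr := ⟨.op .div⟩
instance : Mod Expr := ⟨.op .mod⟩

/-- The comparison `e < f`. -/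
def Expr.lt (e f : Expr) : Expr := .op .lt e f

/-- The comparison `e = f`. -/
def Expr.eq (e f : Expr) : Expr := .op .eq e f

namespace Expr

variable (s : State) (W : ℕ) (e f : Expr) (c x a : ℕ)

@[simp] theorem val_const : (const c).val s = c := rfl
@[simp] theorem val_reg : (reg x).val s = s.reg x := rfl
@[simp] theorem val_load : (load a e).val s = s.arr a (e.val s) := rfl
@[simp] theorem val_add : (e + f).val s = e.val s + f.val s := rfl
@[simp] theorem val_sub : (e - f).val s = e.val s - f.val s := rfl
@[simp] theorem val_mul : (e * f).val s = e.val s * f.val s := rfl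
@[simp] theorem val_div : (e / f).val s = e.val s / f.val s := rfl
@[simp] theorem val_mod : (e % f).val s = e.val s % f.val s := rfl
@[simp] theorem val_lt : (e.lt f).val s = if e.val s < f.val s then 1 else 0 := rfl
@[simp] theorem val_eq : (e.eq f).val s = if e.val s = f.val s then 1 else 0 := rfl

@[simp] theorem fits_const : (const c).Fits W s ↔ c < W := Iff.rfl
@[simp] theorem fits_reg : (reg x).Fits W s ↔ s.reg x < W := Iff.rfl
@[simp] theorem fits_load : (load a e).Fits W s ↔ e.Fits W s ∧ s.arr a (e.val s) < W := Iff.rfl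
@[simp] theorem fits_add : (e + f).Fits W s ↔ e.Fits W s ∧ f.Fits W s ∧ e.val s + f.val s < W :=
  Iff.rfl
@[simp] theorem fits_sub : (e - f).Fits W s ↔ e.Fits W s ∧ f.Fits W s ∧ e.val s - f.val s < W :=
  Iff.rfl
@[simp] theorem fits_mul : (e * f).Fits W s ↔ e.Fits W s ∧ f.Fits W s ∧ e.val s * f.val s < W :=
  Iff.rfl
@[simp] theorem fits_div : (e / f).Fits W s ↔ e.Fits W s ∧ f.Fits W s ∧ e.val s / f.val s < W :=
  Iff.rfl
@[simp] theorem fits_mod : (e % f).Fits W s ↔ e.Fits W s ∧ f.Fits W s ∧ e.val s % f.val s < W :=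
  Iff.rfl
@[simp] theorem fits_lt : (e.lt f).Fits W s ↔
    e.Fits W s ∧ f.Fits W s ∧ (if e.val s < f.val s then 1 else 0) < W := Iff.rfl
@[simp] theorem fits_eq : (e.eq f).Fits W s ↔
    e.Fits W s ∧ f.Fits W s ∧ (if e.val s = f.val s then 1 else 0) < W := Iff.rfl

@[simp] theorem cost_const : (const c).cost = 1 := rfl
@[simp] theorem cost_reg : (reg x).cost = 1 := rfl
@[simp] theorem cost_load : (load a e).cost = e.cost + 1 := rfl
@[simp] theorem cost_add : (e + f).cost = e.cost + f.cost + 1 := rfl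
@[simp] theorem cost_sub : (e - f).cost = e.cost + f.cost + 1 := rfl
@[simp] theorem cost_mul : (e * f).cost = e.cost + f.cost + 1 := rfl
@[simp] theorem cost_div : (e / f).cost = e.cost + f.cost + 1 := rfl
@[simp] theorem cost_mod : (e % f).cost = e.cost + f.cost + 1 := rfl
@[simp] theorem cost_lt : (e.lt f).cost = e.cost + f.cost + 1 := rfl
@[simp] theorem cost_eq : (e.eq f).cost = e.cost + f.cost + 1 := rfl

end Expr

/-! ### The program

Registers: `0` the dimension, `1` the number `n` of robots, `2` the number `N` of vertices, `3` the
time, `4` the stride `M`, `5` the number `a` of rows, `6` the number `b` of columns, `7` the stride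
that belongs to the target pattern, `8` the coordinate that is worked on, `9` and `10` loop
counters, `11` the column, `12` the row, `13` and `14` heights, `15` a vertex, `16` a rank, `17` the
round, `18` the number of rounds, `19` the class of columns, `20` the number of these classes,
`22` to `26` the construction of the snake.

Arrays: `4` the output, `5` the initial vertices of the group, `6` the target pattern, `7` the
snake, `8` the present vertices of the group, `9` flags of edges, `10` a permutation. -/

open GridRobots.Expr GridRobots.Program

/-- The row of a cell, see `cellRow`. -/
def rowExpr : Mode → Fin 6 → Expr
  | .side, x => reg 12 + const (short x)
  | .mid, x => reg 12 + const (short x)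
  | .twin, x => (reg 12 + const 1 + const (2 * long x) * (reg 12 + const 2).lt (reg 5)) -
      (const (long x) + (reg 12 + const 2).lt (reg 5))

/-- The column of a cell, see `cellCol`. -/
def colExpr : Mode → Fin 6 → Expr
  | .side, x => (reg 11 + const (2 * long x) * (reg 11 + const 2).lt (reg 6)) - const (long x)
  | .mid, x => const (long x)
  | .twin, x => if short x = 0 then reg 11 else const 1 - reg 11

/-- The number of a cell, see `cell`. -/
def cellExpr (m : Mode) (x : Fin 6) : Expr := load 7 (colExpr m x) + rowExpr m x * reg 4

/-- Write the permutation `σ` of the present block. -/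
def writeBlock (m : Mode) (σ : Fin 6 → Fin 6) (l : List (Fin 6)) : Program :=
  l.foldr (fun x p => .seq (.store 10 (cellExpr m x) (cellExpr m (σ x))) p) .skip

/-- Write the permutation `σ` of the block with number `z`, if it is to move. -/
def markBody (m : Mode) (σ : Fin 6 → Fin 6) : Program :=
  .cond (load 9 (reg 10) * (reg 10 / reg 5 % const 5).eq (reg 19))
    (.seq (.seq (.assign 11 (reg 10 / reg 5)) (.assign 12 (reg 10 % reg 5)))
      (writeBlock m σ (List.finRange 6))) .skip

/-- Write the next configuration. -/
def moveBody : Program :=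
  .store 4 ((reg 3 + const 1) * reg 1 + reg 10) (load 10 (load 4 (reg 3 * reg 1 + reg 10)))

/-- One time step: all blocks of a class that are to move turn by `σ`. -/
def stepProg (m : Mode) (σ : Fin 6 → Fin 6) : Program :=
  .seq (.forLt 10 2 (.store 10 (reg 10) (reg 10))) (.seq (.forLt 10 2 (markBody m σ))
    (.seq (.forLt 10 1 moveBody) (.assign 3 (reg 3 + const 1))))

/-- The time steps that swap the ends of all flagged edges of a class. -/
def classProg (m : Mode) (l : List (Fin 6 → Fin 6)) : Program :=
  l.foldr (fun σ p => .seq (stepProg m σ) p) .skip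

/-- Swap the ends of all flagged edges. -/
def swapProg : Program :=
  .forLt 19 20 (.cond ((reg 6).eq (const 2)) (classProg .twin Mode.twin.rotations)
    (.cond ((reg 6).eq (const 3) * (reg 19).eq (const 1)) (classProg .mid Mode.mid.rotations)
      (classProg .side Mode.side.rotations)))

/-- Mark the present vertices of the group. -/
def colourProg : Program :=
  .seq (.forLt 10 2 (.store 8 (reg 10) (const 0))) (.forLt 10 1
    (.cond (load 2 (reg 10)) (.store 8 (load 4 (reg 3 * reg 1 + reg 10)) (const 1)) .skip))

/-- Decide about one edge. -/
def flagBody : Program :=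
  .seq (.seq (.assign 11 (reg 10 / reg 5)) (.seq (.assign 12 (reg 10 % reg 5))
    (.assign 15 (load 7 (reg 11) + reg 12 * reg 4))))
  (.seq (.cond (reg 12) .skip (.seq (.assign 13 (const 0)) (.assign 14 (const 0))))
  (.seq (.seq (.assign 13 (reg 13 + load 8 (reg 15))) (.assign 14 (reg 14 + load 6 (reg 15))))
    (.cond ((reg 12 % const 4).eq (reg 17 % const 4) * (reg 12 + const 1).lt (reg 5))
      (.store 9 (reg 10)
        ((reg 14).lt (reg 13) * (load 8 (reg 15) * (const 1 - load 8 (reg 15 + reg 4))) +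
          (reg 13).lt (reg 14) * ((const 1 - load 8 (reg 15)) * load 8 (reg 15 + reg 4))))
      (.store 9 (reg 10) (const 0)))))

/-- One round. -/
def roundProg : Program :=
  .seq colourProg (.seq (.forLt 10 2 flagBody) swapProg)

/-- Compute the target pattern from the set in the array `c`. -/
def patternProg (c : ℕ) : Program :=
  .seq (.forLt 10 2 (.store 6 (reg 10) (const 0))) (.seq (.assign 16 (const 0)) (.forLt 10 2
    (.cond (load c (reg 10)) (.seq (.store 6 (reg 10 / reg 7 * reg 7 + reg 16 % reg 7) (const 1))
      (.assign 16 (reg 16 + const 1))) .skip)))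

/-- Extend the snake by one entry, see `fold`. -/
def snakeBody : Program :=
  .store 7 (reg 10) (load 7 ((const 1 - reg 10 / reg 23 % const 2) * (reg 10 % reg 23) +
    (reg 10 / reg 23 % const 2) * (reg 23 - const 1 - reg 10 % reg 23)) + reg 10 / reg 23 * reg 24)

/-- Extend the snake by one coordinate. -/
def snakeStep : Program :=
  .seq (.cond ((reg 22).eq (reg 8)) .skip (.seq (.assign 26 (reg 23 * load 0 (reg 22)))
      (.seq (.forLt 10 26 snakeBody) (.assign 23 (reg 26)))))
    (.assign 24 (reg 24 * load 0 (reg 22)))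

/-- Compute the snake. -/
def snakeProg : Program :=
  .seq (.seq (.store 7 (const 0) (const 0)) (.seq (.assign 23 (const 1)) (.assign 24 (const 1))))
    (.forLt 22 0 snakeStep)

/-- One phase. -/
def phaseProg (c : ℕ) : Program :=
  .seq (.seq (.assign 6 (reg 2 / reg 5)) (.seq (.assign 18 (const 5 * reg 5))
    (.assign 20 (const 5)))) (.seq (patternProg c) (.seq snakeProg (.forLt 17 18 roundProg)))

/-- Compute the number of vertices. -/
def sizeProg : Program :=
  .seq (.assign 2 (const 1)) (.forLt 22 0 (.assign 2 (reg 2 * load 0 (reg 22))))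

/-- Copy the initial configuration and mark the initial vertices of the group. -/
def initProg : Program :=
  .forLt 10 1 (.seq (.store 4 (reg 10) (load 1 (reg 10)))
    (.cond (load 2 (reg 10)) (.store 5 (load 1 (reg 10)) (const 1)) .skip))

/-- The phases that make the target pattern of the initial vertices coarser. -/
def forwardProg : Program :=
  .forLt 8 0 (.seq (.seq (.assign 5 (load 0 (reg 8))) (.assign 7 (reg 4 * reg 5)))
    (.seq (phaseProg 5) (.assign 4 (reg 7))))

/-- The phases that make the target pattern of the goal vertices finer. -/
def backwardProg : Program :=
  .forLt 9 0 (.seq (.seq (.assign 8 (reg 0 - const 1 - reg 9)) (.seq (.assign 5 (load 0 (reg 8)))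
    (.seq (.assign 4 (reg 4 / reg 5)) (.assign 7 (reg 4))))) (phaseProg 3))

/-- The whole program. -/
def mainProg : Program :=
  .seq (.seq sizeProg (.seq initProg (.assign 4 (const 1))))
    (.seq forwardProg (.seq backwardProg (.assign 0 (reg 3))))

theorem stepProg_regs (m : Mode) (σ : Fin 6 → Fin 6) :
    (stepProg m σ).regs = (stepProg .side id).regs := rfl

theorem stepProg_arrs (m : Mode) (σ : Fin 6 → Fin 6) :
    (stepProg m σ).arrs = (stepProg .side id).arrs := rfl

theorem markBody_regs (m : Mode) (σ : Fin 6 → Fin 6) :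
    (markBody m σ).regs = (markBody .side id).regs := rfl

theorem markBody_arrs (m : Mode) (σ : Fin 6 → Fin 6) :
    (markBody m σ).arrs = (markBody .side id).arrs := rfl

theorem phaseProg_regs (c : ℕ) : (phaseProg c).regs = (phaseProg 0).regs := rfl

theorem phaseProg_arrs (c : ℕ) : (phaseProg c).arrs = (phaseProg 0).arrs := rfl

end GridRobots

namespace GridRobots
open GridRobots.Expr GridRobots.Program

/-! ### Correctness of a time step -/

/-- The configurations in the output array up to the present time form a sequence of valid moves
of `n` robots that starts at `X`. -/
structure Hist (adj : ℕ → ℕ → Prop) (N n : ℕ) (X : ℕ → ℕ) (s : State) : Prop where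
  start_lt : ∀ i < n, X i < N
  start : ∀ i < n, s.arr 4 i = X i
  move : ∀ τ < s.reg 3, ∃ π, Valid adj N π ∧
    ∀ i < n, s.arr 4 ((τ + 1) * n + i) = π (s.arr 4 (τ * n + i))

theorem Hist.lt {adj : ℕ → ℕ → Prop} {N n : ℕ} {X : ℕ → ℕ} {s : State} (h : Hist adj N n X s)
    {τ : ℕ} (hτ : τ ≤ s.reg 3) {i : ℕ} (hi : i < n) : s.arr 4 (τ * n + i) < N := by
  induction τ with
  | zero => rw [zero_mul, zero_add, h.start i hi]; exact h.start_lt i hi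
  | succ τ ih =>
    obtain ⟨π, hπ, hm⟩ := h.move τ hτ
    rw [hm i hi]
    exact hπ.lt _ (ih (by omega))

/-- Only the time and the output array matter. -/
theorem Hist.congr {adj : ℕ → ℕ → Prop} {N n : ℕ} {X : ℕ → ℕ} {s s' : State}
    (h : Hist adj N n X s) (h₁ : s'.reg 3 = s.reg 3) (h₂ : s'.arr 4 = s.arr 4) :
    Hist adj N n X s' :=
  ⟨h.start_lt, by rw [h₂]; exact h.start, by rw [h₁, h₂]; exact h.move⟩

/-- The present vertex of a robot. -/
def cur (n : ℕ) (s : State) (i : ℕ) : ℕ := s.arr 4 (s.reg 3 * n + i)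

theorem Hist.cur_lt {adj : ℕ → ℕ → Prop} {N n : ℕ} {X : ℕ → ℕ} {s : State}
    (h : Hist adj N n X s) {i : ℕ} (hi : i < n) : cur n s i < N := h.lt le_rfl hi

/-- The new configuration occupies addresses from `(s.reg 3 + 1) * n` on, beyond all earlier ones,
so the recorded history survives. -/
theorem Hist.snoc {adj : ℕ → ℕ → Prop} {N n : ℕ} {X : ℕ → ℕ} {s s' : State} {π : ℕ → ℕ}
    (h : Hist adj N n X s) (hπ : Valid adj N π) (hr : s'.reg 3 = s.reg 3 + 1)
    (hold : ∀ v < (s.reg 3 + 1) * n, s'.arr 4 v = s.arr 4 v)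
    (hnew : ∀ i < n, s'.arr 4 ((s.reg 3 + 1) * n + i) = π (cur n s i)) : Hist adj N n X s' := by
  have hlt : ∀ τ ≤ s.reg 3, ∀ i < n, τ * n + i < (s.reg 3 + 1) * n := fun τ hτ i hi => by
    have := Nat.mul_le_mul_right n hτ
    rw [add_mul, one_mul]; omega
  refine ⟨h.start_lt, fun i hi => ?_, fun τ hτ => ?_⟩
  · rw [hold i (by simpa using hlt 0 (by omega) i hi), h.start i hi]
  · rw [hr] at hτ
    rcases Nat.lt_succ_iff_lt_or_eq.1 hτ with hτ | rfl
    · obtain ⟨π', hπ', hm⟩ := h.move τ hτ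
      refine ⟨π', hπ', fun i hi => ?_⟩
      rw [hold _ (hlt (τ + 1) hτ i hi), hold _ (hlt τ hτ.le i hi), hm i hi]
    · refine ⟨π, hπ, fun i hi => ?_⟩
      rw [hnew i hi, hold _ (hlt _ le_rfl i hi), cur]

/-- The case distinctions of `cellRow` and `cellCol` are encoded by multiplying with the 0/1 value
of a comparison; the sums are formed first, so truncated subtraction gives the intended value. -/
theorem val_cellExpr {m : Mode} {s : State} {a b M z : ℕ} (h4 : s.reg 4 = M) (h5 : s.reg 5 = a)
    (h6 : s.reg 6 = b) (h11 : s.reg 11 = z / a) (h12 : s.reg 12 = z % a) (x : Fin 6) :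
    (cellExpr m x).val s = cell m a b M (s.arr 7) z x := by
  have hr : (rowExpr m x).val s = cellRow m a (z % a) x := by
    have := long_le x
    cases m <;> simp only [rowExpr, cellRow, h5, h12, val_add, val_sub, val_mul, val_const, val_reg,
      val_lt]
    split <;> omega
  have hc : (colExpr m x).val s = cellCol m b (z / a) x := by
    cases m <;> simp only [colExpr, cellCol, val_const]
    · simp only [h6, h11, val_add, val_sub, val_mul, val_const, val_reg, val_lt]
      split <;> omega
    · split <;> simp [h11]
  simp only [cellExpr, cell, val_add, val_load, val_mul, val_reg, hr, hc, h4]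

theorem cellExpr_cost (m : Mode) (x : Fin 6) : (cellExpr m x).cost ≤ 30 := by
  revert x; cases m <;> decide

theorem writeBlock_cost (m : Mode) (σ : Fin 6 → Fin 6) :
    (writeBlock m σ (List.finRange 6)).cost ≤ 367 := by
  have h : ∀ l : List (Fin 6), (writeBlock m σ l).cost ≤ l.length * 61 + 1 := fun l => by
    induction l with
    | nil => simp [writeBlock, Program.cost]
    | cons x l ih =>
      have := cellExpr_cost m x
      have := cellExpr_cost m (σ x)
      simp only [writeBlock, List.foldr, Program.cost, List.length] at *
      omega
  exact (h _).trans (by simp)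

section

variable {adj : ℕ → ℕ → Prop} {W N n a b M c t : ℕ} {X : ℕ → ℕ} {s : State}

theorem fits_cellExpr (h : Rect adj N a b M (s.arr 7)) (hW : 300 * N * N ≤ W) {z : ℕ}
    (hz : InClass a b t c z) (hL : ∀ g < b, s.arr 7 g < N) (hM : M ≤ N)
    (h4 : s.reg 4 = M) (h5 : s.reg 5 = a)
    (h6 : s.reg 6 = b) (h11 : s.reg 11 = z / a) (h12 : s.reg 12 = z % a) (x : Fin 6) :
    (cellExpr (modeOf b c) x).Fits W s := by
  have hcell := h.cell_lt hz x
  have hrow := h.cellRow_lt hz x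
  have hcol := h.cellCol_lt hz x
  have h₁ := h.mul_eq
  have h₂ := h.two_le_rows
  have h₃ := h.two_le_cols
  have h₄ := h.six_le
  have haN : a ≤ N := by nlinarith
  have hbN : b ≤ N := by nlinarith
  have hNW : 300 * N ≤ W := by nlinarith
  have hl := long_le x
  have hs := short_le x
  have hzr := hz.row_lt
  have hzc := hz.div_lt
  have hr : (rowExpr (modeOf b c) x).Fits W s ∧
      (rowExpr (modeOf b c) x).val s = cellRow (modeOf b c) a (z % a) x := by
    clear hcell hcol
    generalize modeOf b c = m at *
    cases m <;> simp only [cellRow] at hrow ⊢ <;> simp only [rowExpr, h5, h12, val_add, val_sub,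
      val_mul, val_const, val_reg, val_lt, fits_add, fits_sub, fits_mul, fits_const, fits_reg,
      fits_lt, and_true] <;> (try split) <;> omega
  have hc : (colExpr (modeOf b c) x).Fits W s ∧
      (colExpr (modeOf b c) x).val s = cellCol (modeOf b c) b (z / a) x := by
    clear hcell hrow hr
    generalize z / a = g at *
    generalize modeOf b c = m at *
    cases m <;> simp only [cellCol] at hcol ⊢ <;> simp only [colExpr, fits_const, val_const, and_true]
    · simp only [h6, h11, val_add, val_sub, val_mul, val_const, val_reg,
        val_lt, fits_add, fits_sub, fits_mul, fits_const, fits_reg, fits_lt]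
      split <;> omega
    · omega
    · split <;> simp [h11] <;> omega
  have := hL _ hcol
  unfold cell at hcell
  simp only [cellExpr, fits_add, fits_load, fits_mul, fits_reg, val_load, val_mul, val_reg, hr.2,
    hc.2, h4]
  exact ⟨⟨hc.1, by omega⟩, ⟨hr.1, by omega, by omega⟩, by omega⟩

/-- The cell expressions must keep their values while array 10 is being written; `hE` asks for this
in all states that differ from `s` in that array only. -/
theorem run_writeBlock {m : Mode} {σ : Fin 6 → Fin 6} {P : Fin 6 → ℕ} (hP : Function.Injective P)
    (l : List (Fin 6)) (hl : l.Nodup)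
    (hE : ∀ s', Agree [] [10] s s' → ∀ x, (cellExpr m x).val s' = P x ∧ (cellExpr m x).Fits W s') :
    Run W (writeBlock m σ l) s (writeBlock m σ l).cost fun s' =>
      (∀ x ∈ l, s'.arr 10 (P x) = P (σ x)) ∧
      ∀ v, (∀ x ∈ l, P x ≠ v) → s'.arr 10 v = s.arr 10 v := by
  induction l generalizing s with
  | nil => exact ⟨s, 1, .skip s, le_rfl, by simp, fun _ _ => rfl⟩
  | cons x l ih =>
    obtain ⟨hx, hl⟩ := List.nodup_cons.1 hl
    have e₁ := hE s (.refl _ _ _) x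
    have e₂ := hE s (.refl _ _ _) (σ x)
    refine Run.seq (Q := fun s' => s'.arr 10 = Function.update (s.arr 10) (P x) (P (σ x)))
      (T := _) (T' := _) ?_ fun s' hs' hQ => ?_
    · refine Run.of_wp ⟨⟨e₁.2, e₂.2⟩, ?_⟩
      simp only [State.setArr_arr, if_true, e₁.1, e₂.1]
    · refine (ih hl fun s'' hs'' => hE s'' (Agree.trans (hs'.mono ?_ ?_) hs'')).mono le_rfl
        fun s'' h => ⟨?_, fun v hv => ?_⟩
      · simp [Program.regs]
      · simp [Program.arrs]
      · intro y hy
        rcases List.mem_cons.1 hy with rfl | hy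
        · rw [h.2 _ fun y' hy' he => hx (by rwa [← hP he]), hQ, Function.update_self]
        · exact h.1 y hy
      · rw [h.2 v fun y hy => hv y (List.mem_cons_of_mem _ hy), hQ,
          Function.update_of_ne (hv x List.mem_cons_self).symm]

/-- The edges of a class whose ends are to be swapped. -/
def Act (s : State) (N a c z : ℕ) : Prop := z < N ∧ s.arr 9 z = 1 ∧ z / a % 5 = c

/-- What a round expects to find in the registers and arrays. -/
structure Ready (W N n a b M : ℕ) (adj : ℕ → ℕ → Prop) (X : ℕ → ℕ) (s : State) : Prop where
  rect : Rect adj N a b M (s.arr 7)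
  hist : Hist adj N n X s
  word : 300 * N * N ≤ W
  robots : n ≤ N
  reg1 : s.reg 1 = n
  reg2 : s.reg 2 = N
  reg4 : s.reg 4 = M
  reg5 : s.reg 5 = a
  reg6 : s.reg 6 = b

theorem Ready.bounds (h : Ready W N n a b M adj X s) : a ≤ N ∧ b ≤ N ∧ 300 * N ≤ W ∧ 6 ≤ N ∧
    2 ≤ a ∧ 2 ≤ b ∧ 1800 ≤ W ∧ M ≤ N ∧ ∀ g < b, s.arr 7 g < N := by
  have h₁ := h.rect.mul_eq
  have h₂ := h.rect.two_le_rows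
  have h₃ := h.rect.two_le_cols
  have h₄ := h.rect.six_le
  have h₅ := h.word
  have h₆ : 300 * N ≤ W := by nlinarith
  have h₇ := h.rect.lt 1 (by omega) 0 (by omega)
  refine ⟨by nlinarith, by nlinarith, h₆, h₄, h₂, h₃, by omega, by omega, fun g hg => ?_⟩
  simpa using h.rect.lt 0 (by omega) g hg

theorem Ready.congr {s' : State} (h : Ready W N n a b M adj X s) (hh : Hist adj N n X s')
    (hr : ∀ x ∈ [1, 2, 4, 5, 6], s'.reg x = s.reg x) (ha : s'.arr 7 = s.arr 7) :
    Ready W N n a b M adj X s' := by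
  simp only [List.forall_mem_cons] at hr
  obtain ⟨r1, r2, r4, r5, r6, -⟩ := hr
  exact ⟨ha ▸ h.rect, hh, h.word, h.robots, r1.trans h.reg1, r2.trans h.reg2, r4.trans h.reg4,
    r5.trans h.reg5, r6.trans h.reg6⟩

/-- Starting from the identity in array 10, the blocks are entered one by one; as they are disjoint,
no entry is overwritten later. -/
theorem run_mark {s₀ : State} {σ : Fin 6 → Fin 6} (h : Ready W N n a b M adj X s₀)
    (hF : FlagsOK a b t fun z => z < N ∧ s₀.arr 9 z = 1) (hF' : ∀ z < N, s₀.arr 9 z ≤ 1)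
    (h19 : s₀.reg 19 = c) (hc : c < 5)
    (h10 : ∀ v < N, s₀.arr 10 v = v) :
    Run W (.forLt 10 2 (markBody (modeOf b c) σ)) s₀ (N * (400 + 8) + 6) fun s' =>
      BlockMap N (Act s₀ N a c) (cell (modeOf b c) a b M (s₀.arr 7)) σ (s'.arr 10) := by
  obtain ⟨haN, hbN, hNW, h6, ha2, hb2, hW0, hMN, hL⟩ := h.bounds
  have hcls : ∀ z, Act s₀ N a c z → InClass a b t c z := fun z hz => by
    obtain ⟨h₁, h₂, h₃⟩ := hF z ⟨hz.1, hz.2.1⟩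
    exact ⟨h₁, h₂, h₃, hz.2.2⟩
  set P := cell (modeOf b c) a b M (s₀.arr 7) with hPdef
  refine (Run.forLt_const (n := N) (fun z s' =>
    (∀ z' < z, Act s₀ N a c z' → ∀ x, s'.arr 10 (P z' x) = P z' (σ x)) ∧
    ∀ v < N, (∀ z' < z, Act s₀ N a c z' → ∀ x, P z' x ≠ v) → s'.arr 10 v = v)
    (by omega) h.reg2 (by omega) (by decide) (by rw [markBody_regs]; decide)
    (by rw [markBody_regs]; decide) ⟨by simp, fun v hv _ => h10 v hv⟩ ?_).mono le_rfl ?_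
  · intro z hz s hag hs10 ⟨hI₁, hI₂⟩
    rw [markBody_regs, markBody_arrs] at hag
    have r5 : s.reg 5 = a := by rw [hag.reg 5 (by decide), h.reg5]
    have r4 : s.reg 4 = M := by rw [hag.reg 4 (by decide), h.reg4]
    have r6 : s.reg 6 = b := by rw [hag.reg 6 (by decide), h.reg6]
    have r19 : s.reg 19 = c := by rw [hag.reg 19 (by decide), h19]
    have a9 : s.arr 9 = s₀.arr 9 := hag.arr 9 (by decide)
    have a7 : s.arr 7 = s₀.arr 7 := hag.arr 7 (by decide)
    have hza : z / a ≤ z := Nat.div_le_self _ _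
    have hzm : z % a ≤ z := Nat.mod_le _ _
    have hz5 : z / a % 5 ≤ z := (Nat.mod_le _ _).trans hza
    have hFz := hF' z hz
    have hval : (load 9 (reg 10) * (reg 10 / reg 5 % const 5).eq (reg 19)).val s =
        s₀.arr 9 z * if z / a % 5 = c then 1 else 0 := by
      simp [hs10, r5, r19, a9]
    have hle : (s₀.arr 9 z * if z / a % 5 = c then 1 else 0) ≤ 1 := by split <;> omega
    refine (Run.cond (T := 380) (Q := fun s'' =>
      (∀ z' < z + 1, Act s₀ N a c z' → ∀ x, s''.arr 10 (P z' x) = P z' (σ x)) ∧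
      ∀ v < N, (∀ z' < z + 1, Act s₀ N a c z' → ∀ x, P z' x ≠ v) → s''.arr 10 v = v)
      ?_ (fun hne => ?_) fun he => ?_).mono (by simp) fun s' h => h
    · simp only [fits_mul, fits_load, fits_reg, fits_eq, fits_mod, fits_div, fits_const, val_load,
        val_reg, val_mod, val_div, val_const, val_eq, hs10, r5, r19, a9]
      refine ⟨⟨by omega, by omega⟩, ⟨⟨⟨by omega, by omega, by omega⟩, by omega, by omega⟩,
        by omega, by split <;> omega⟩, by omega⟩
    · rw [hval] at hne
      have hact : Act s₀ N a c z := by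
        by_cases hc' : z / a % 5 = c
        · rw [if_pos hc'] at hne; exact ⟨hz, by omega, hc'⟩
        · rw [if_neg hc'] at hne; omega
      refine (Run.seq (T := 10) (T' := 367) (Q := fun s' =>
        s'.reg 11 = z / a ∧ s'.reg 12 = z % a) ?_ fun s' hs' ⟨r11, r12⟩ => ?_).mono
          (by norm_num) fun s' h => h
      · refine (Run.of_wp ?_).mono (by simp [Program.cost]) fun _ h => h
        simp [Program.wp, State.setReg_reg, hs10, r5]
        omega
      · have r5' : s'.reg 5 = a := by rw [hs'.reg 5 (by decide), r5]
        have r4' : s'.reg 4 = M := by rw [hs'.reg 4 (by decide), r4]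
        have r6' : s'.reg 6 = b := by rw [hs'.reg 6 (by decide), r6]
        have a7' : s'.arr 7 = s₀.arr 7 := by rw [hs'.arr 7 (by decide), a7]
        have a10' : s'.arr 10 = s.arr 10 := hs'.arr 10 (by decide)
        refine (run_writeBlock (W := W) (P := P z) (m := modeOf b c) (σ := σ)
          (fun x y hxy => (h.rect.cell_inj (hcls z hact) (hcls z hact) x y hxy).2)
          (List.finRange 6) (List.nodup_finRange 6) fun s'' hs'' x => ?_).mono
          (writeBlock_cost _ _) fun s'' ⟨h₁, h₂⟩ => ⟨fun z' hz' hact' x => ?_, fun v hv hf => ?_⟩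
        · have e7 : s''.arr 7 = s₀.arr 7 := by rw [hs''.arr 7 (by decide), a7']
          have e4 : s''.reg 4 = M := by rw [hs''.reg 4 (by decide), r4']
          have e5 : s''.reg 5 = a := by rw [hs''.reg 5 (by decide), r5']
          have e6 : s''.reg 6 = b := by rw [hs''.reg 6 (by decide), r6']
          have e11 : s''.reg 11 = z / a := by rw [hs''.reg 11 (by decide), r11]
          have e12 : s''.reg 12 = z % a := by rw [hs''.reg 12 (by decide), r12]
          refine ⟨?_, fits_cellExpr (e7 ▸ h.rect) h.word (hcls z hact) (by rwa [e7]) hMN e4 e5 e6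
            e11 e12 x⟩
          rw [val_cellExpr e4 e5 e6 e11 e12, e7]
        · rcases Nat.lt_succ_iff_lt_or_eq.1 hz' with hz' | rfl
          · rw [h₂ _ fun y _ hy => by
              have := (h.rect.cell_inj (hcls z hact) (hcls z' hact') y x hy).1
              omega, a10']
            exact hI₁ z' hz' hact' x
          · exact h₁ x (List.mem_finRange x)
        · rw [h₂ v fun x _ => hf z (by omega) hact x, a10']
          exact hI₂ v hv fun z' hz' => hf z' (by omega)
    · have hact : ¬ Act s₀ N a c z := fun hact => by
        rw [hval, hact.2.1, if_pos hact.2.2] at he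
        omega
      refine ⟨s, 1, .skip s, by norm_num, fun z' hz' hact' x => ?_, fun v hv hf => ?_⟩
      · rcases Nat.lt_succ_iff_lt_or_eq.1 hz' with hz' | rfl
        · exact hI₁ z' hz' hact' x
        · exact absurd hact' hact
      · exact hI₂ v hv fun z' hz' => hf z' (by omega)
  · rintro s' ⟨h₁, h₂⟩
    exact ⟨fun z hz x => h₁ z hz.1 hz x, fun v hv hf => h₂ v hv fun z' _ hact x => hf z' hact x⟩

end

end GridRobots

/-! ### Time steps, classes of columns, and the 25 time steps that swap all flagged edges -/

namespace GridRobots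
open GridRobots.Expr GridRobots.Program

section

variable {adj : ℕ → ℕ → Prop} {W N n a b M c t : ℕ} {X : ℕ → ℕ} {s : State}

/-- The largest numbers that occur are addresses in the output array, at most about `250 * N * N`;
this dictates the word bound `300 * N * N`. -/
theorem Ready.time_fits (h : Ready W N n a b M adj X s) {τ i : ℕ} (hτ : τ ≤ 250 * N)
    (hi : i < n) : τ < W ∧ τ * n + i < W ∧ τ * n < W := by
  have h₁ := h.word
  have h₂ := h.rect.six_le
  have h₃ : τ * n ≤ 250 * N * N := Nat.mul_le_mul hτ h.robots
  have h₄ := h.robots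
  have h₅ : 300 * N ≤ 300 * N * N := Nat.le_mul_of_pos_right _ (by omega)
  have h₆ : 6 * N ≤ N * N := Nat.mul_le_mul_right _ h₂
  rw [mul_assoc] at h₁ h₃ h₅
  omega

theorem run_step {σ : Fin 6 → Fin 6} (hσ : IsRotation σ) (h : Ready W N n a b M adj X s)
    (hF : FlagsOK a b t fun z => z < N ∧ s.arr 9 z = 1) (hF' : ∀ z < N, s.arr 9 z ≤ 1)
    (h19 : s.reg 19 = c) (hc : c < 5) (ht : s.reg 3 < 250 * N) :
    Run W (stepProg (modeOf b c) σ) s (500 * N) fun s' =>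
      Ready W N n a b M adj X s' ∧ s'.reg 3 = s.reg 3 + 1 ∧
      ∃ π, BlockMap N (Act s N a c) (cell (modeOf b c) a b M (s.arr 7)) σ π ∧
        ∀ i < n, cur n s' i = π (cur n s i) := by
  obtain ⟨haN, hbN, hNW, h6, ha2, hb2, hW0, hMN, hL⟩ := h.bounds
  have hnN := h.robots
  have hcls : ∀ z, Act s N a c z → InClass a b t c z := fun z hz => by
    obtain ⟨h₁, h₂, h₃⟩ := hF z ⟨hz.1, hz.2.1⟩
    exact ⟨h₁, h₂, h₃, hz.2.2⟩
  refine (Run.seq (T := N * 19 + 6) (T' := N * 408 + 6 + (n * 40 + 6 + 5)) (Q := fun s' =>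
    ∀ v < N, s'.arr 10 v = v) ?_ fun s₁ ag₁ q₁ => ?_).mono (by omega) fun _ h => h
  · refine (Run.forLt_const (n := N) (K := 11) (fun z s' => ∀ v < z, s'.arr 10 v = v)
      (by omega) h.reg2 (by omega) (by decide) (by decide) (by decide) (by simp) ?_).mono le_rfl
      fun _ h => h
    intro z hz s' hag hz' hI
    refine (Run.of_wp ?_).mono (by simp [Program.cost]) fun _ h => h
    simp only [Program.wp, fits_reg, hz', val_reg]
    refine ⟨⟨by omega, by omega⟩, fun v hv => ?_⟩
    simp only [State.setReg_arr, State.setArr_arr, if_true]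
    rcases Nat.lt_succ_iff_lt_or_eq.1 hv with hv | rfl
    · rw [Function.update_of_ne (by omega), hI v hv]
    · rw [Function.update_self]
  have a9 : s₁.arr 9 = s.arr 9 := ag₁.arr 9 (by decide)
  have a7 : s₁.arr 7 = s.arr 7 := ag₁.arr 7 (by decide)
  have hact : Act s₁ N a c = Act s N a c := by funext z; simp [Act, a9]
  have h₁ : Ready W N n a b M adj X s₁ :=
    h.congr (h.hist.congr (ag₁.reg 3 (by decide)) (ag₁.arr 4 (by decide)))
      (fun x hx => ag₁.reg x (by revert hx; revert x; decide)) a7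
  refine Run.seq (run_mark (t := t) (σ := σ) h₁ (by rwa [a9]) (by rwa [a9])
    ((ag₁.reg 19 (by decide)).trans h19) hc q₁) fun s₂ ag₂ q₂ => ?_
  replace ag₂ : Agree [10, 11, 12] [10] s₁ s₂ := ag₂.mono
    (show (Program.forLt 10 2 (markBody .side id)).regs ⊆ _ by decide)
    (show (Program.forLt 10 2 (markBody .side id)).arrs ⊆ _ by decide)
  rw [hact, a7] at q₂
  have hV := q₂.valid (h.rect.cell_lt <| hcls · ·)
    (fun z z' hz hz' x x' he => h.rect.cell_inj (hcls z hz) (hcls z' hz') x x' he)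
    (fun z hz x y he => h.rect.cell_adj (hcls z hz) x y he) hσ
  have ag : Agree [10, 11, 12] [10] s s₂ := (ag₁.mono (by decide) (by decide)).trans ag₂
  have h₂ : Ready W N n a b M adj X s₂ :=
    h.congr (h.hist.congr (ag.reg 3 (by decide)) (ag.arr 4 (by decide)))
      (fun x hx => ag.reg x (by revert hx; revert x; decide)) (ag.arr 7 (by decide))
  have r3 : s₂.reg 3 = s.reg 3 := ag.reg 3 (by decide)
  have a4 : s₂.arr 4 = s.arr 4 := ag.arr 4 (by decide)
  refine Run.seq (Q := fun s' => (∀ i < n, s'.arr 4 ((s.reg 3 + 1) * n + i) =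
      s₂.arr 10 (cur n s i)) ∧ ∀ v < (s.reg 3 + 1) * n, s'.arr 4 v = s.arr 4 v)
    ?_ fun s₃ ag₃ q₃ => ?_
  · refine (Run.forLt_const (n := n) (K := 32) (fun z s' =>
      (∀ i < z, s'.arr 4 ((s.reg 3 + 1) * n + i) = s₂.arr 10 (cur n s i)) ∧
      ∀ v < (s.reg 3 + 1) * n, s'.arr 4 v = s.arr 4 v)
      (by omega) h₂.reg1 (by omega) (by decide) (by decide) (by decide)
      ⟨by simp, fun v _ => by rw [State.setReg_arr, a4]⟩ ?_).mono le_rfl fun _ h => h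
    intro i hi s' ag' hi' ⟨hI₁, hI₂⟩
    refine (Run.of_wp ?_).mono (by simp [moveBody, Program.cost]) fun _ h => h
    have r1' : s'.reg 1 = n := (ag'.reg 1 (by decide)).trans h₂.reg1
    have r3' : s'.reg 3 = s.reg 3 := (ag'.reg 3 (by decide)).trans r3
    have a10' : s'.arr 10 = s₂.arr 10 := ag'.arr 10 (by decide)
    have hlt : s.reg 3 * n + i < (s.reg 3 + 1) * n := by rw [add_mul, one_mul]; omega
    obtain ⟨w₁, w₂, w₃⟩ := h.time_fits (τ := s.reg 3) ht.le hi
    obtain ⟨w₄, w₅, w₆⟩ := h.time_fits (τ := s.reg 3 + 1) ht hi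
    have hcur : s'.arr 4 (s.reg 3 * n + i) = cur n s i := by rw [hI₂ _ hlt, cur]
    have hcl := h.hist.cur_lt hi
    have hπ := hV.lt _ hcl
    simp only [moveBody, Program.wp, fits_add, fits_mul, fits_reg, fits_const, fits_load, val_add,
      val_mul, val_reg, val_const, val_load, r1', r3', hi', a10', hcur]
    refine ⟨⟨by omega, by omega, by omega⟩, fun j hj => ?_, fun v hv => ?_⟩
    · simp only [State.setReg_arr, State.setArr_arr, if_true]
      rcases Nat.lt_succ_iff_lt_or_eq.1 hj with hj | rfl
      · rw [Function.update_of_ne (by omega), hI₁ j hj]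
      · rw [Function.update_self]
    · simp only [State.setReg_arr, State.setArr_arr, if_true]
      rw [Function.update_of_ne (by omega), hI₂ v hv]
  · have r3' : s₃.reg 3 = s.reg 3 := (ag₃.reg 3 (by decide)).trans r3
    refine (Run.of_wp ?_).mono (by simp [Program.cost]) fun _ h => h
    simp only [Program.wp, fits_add, fits_reg, fits_const, val_add, val_reg, val_const, r3']
    refine ⟨by omega, ?_⟩
    have hist : Hist adj N n X (s₃.setReg 3 (s.reg 3 + 1)) :=
      h.hist.snoc hV (by simp [State.setReg_reg]) q₃.2 q₃.1
    refine ⟨h₂.congr hist (fun x hx => ?_) (ag₃.arr 7 (by decide)), by simp [State.setReg_reg],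
      s₂.arr 10, q₂, fun i hi => ?_⟩
    · have : x ≠ 3 := by revert hx; revert x; decide
      rw [State.setReg_reg, if_neg this]
      exact ag₃.reg x (by clear this; revert hx; revert x; decide)
    · rw [← q₃.1 i hi]
      simp [cur, State.setReg_reg]

theorem classProg_cons (m : Mode) (σ : Fin 6 → Fin 6) (l : List (Fin 6 → Fin 6)) :
    classProg m (σ :: l) = .seq (stepProg m σ) (classProg m l) := rfl

/-- The flags and the snake stay as in `s₀`, so all rotations act on the same blocks and their
effects compose; `σ₀` accumulates the product for the induction. -/
theorem run_class (s₀ : State) (l : List (Fin 6 → Fin 6)) (hl : ∀ σ ∈ l, IsRotation σ)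
    (hF : FlagsOK a b t fun z => z < N ∧ s₀.arr 9 z = 1) (hF' : ∀ z < N, s₀.arr 9 z ≤ 1)
    (hc : c < 5) (σ₀ : Fin 6 → Fin 6) (s : State) (h : Ready W N n a b M adj X s)
    (h9 : s.arr 9 = s₀.arr 9) (h7 : s.arr 7 = s₀.arr 7)
    (h19 : s.reg 19 = c) (ht : s.reg 3 + l.length ≤ 250 * N)
    (hπ : ∃ π, BlockMap N (Act s₀ N a c) (cell (modeOf b c) a b M (s₀.arr 7)) σ₀ π ∧
        ∀ i < n, cur n s i = π (cur n s₀ i)) :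
    Run W (classProg (modeOf b c) l) s (l.length * (500 * N) + 1) fun s' =>
      Ready W N n a b M adj X s' ∧ s'.reg 3 = s.reg 3 + l.length ∧
      ∃ π, BlockMap N (Act s₀ N a c) (cell (modeOf b c) a b M (s₀.arr 7))
          (l.foldl (fun f σ => σ ∘ f) σ₀) π ∧
        ∀ i < n, cur n s' i = π (cur n s₀ i) := by
  induction l generalizing s σ₀ with
  | nil => exact ⟨s, 1, .skip s, by simp, h, rfl, hπ⟩
  | cons σ l ih =>
    have hact : Act s N a c = Act s₀ N a c := by funext z; simp [Act, h9]
    rw [classProg_cons]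
    simp only [List.length_cons] at ht ⊢
    rw [show (l.length + 1) * (500 * N) + 1 = 500 * N + (l.length * (500 * N) + 1) by ring]
    refine Run.seq (run_step (hl σ List.mem_cons_self) h (t := t) (by rwa [h9]) (by rwa [h9])
      h19 hc (by omega)) fun s₁ ag₁ ⟨h₁, r₁, π₁, b₁, c₁⟩ =>
      (ih (fun σ hσ => hl σ (List.mem_cons_of_mem _ hσ)) (σ ∘ σ₀) s₁ h₁ ?_ ?_ ?_ ?_ ?_).mono
      le_rfl fun s' ⟨h', r', hπ'⟩ => ⟨h', by omega, hπ'⟩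
    · rw [ag₁.arr 9 (by rw [stepProg_arrs]; decide), h9]
    · rw [ag₁.arr 7 (by rw [stepProg_arrs]; decide), h7]
    · rw [ag₁.reg 19 (by rw [stepProg_regs]; decide), h19]
    · omega
    · obtain ⟨π, hπ, hc'⟩ := hπ
      rw [hact, h7] at b₁
      exact ⟨π₁ ∘ π, hπ.comp b₁, fun i hi => by rw [c₁ i hi, hc' i hi]; rfl⟩

/-- After the classes below `c`, exactly the flagged edges in columns of these classes have been
swapped. Each of the five classes takes five time steps. -/
theorem run_swap (h : Ready W N n a b M adj X s)
    (hF : FlagsOK a b t fun z => z < N ∧ s.arr 9 z = 1) (hF' : ∀ z < N, s.arr 9 z ≤ 1)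
    (h20 : s.reg 20 = 5) (ht : s.reg 3 + 25 ≤ 250 * N) :
    Run W swapProg s (13000 * N) fun s' =>
      Ready W N n a b M adj X s' ∧ s'.reg 3 = s.reg 3 + 25 ∧
      ∃ π, SwapMap N a M (s.arr 7) (fun z => z < N ∧ s.arr 9 z = 1) π ∧
        ∀ i < n, cur n s' i = π (cur n s i) := by
  obtain ⟨haN, hbN, hNW, h6, ha2, hb2, hW0, hMN, hL⟩ := h.bounds
  refine (Run.forLt_const (n := 5) (K := 5 * (500 * N) + 40) (fun c s' =>
      Ready W N n a b M adj X s' ∧ s'.reg 3 = s.reg 3 + 5 * c ∧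
      ∃ π, SwapMap N a M (s.arr 7) (fun z => (z < N ∧ s.arr 9 z = 1) ∧ z / a % 5 < c) π ∧
        ∀ i < n, cur n s' i = π (cur n s i))
    (by omega) h20 (by omega) (by decide) (by decide) (by decide) ?_ ?_).mono (by omega)
    fun s' ⟨h', r', π, hπ, hc⟩ => ⟨h', r', π, ?_, hc⟩
  · refine ⟨h.congr (h.hist.congr ?_ rfl) (fun x hx => ?_) rfl, by simp [State.setReg_reg], id, ?_,
      fun i hi => by simp [cur, State.setReg_reg]⟩
    · simp [State.setReg_reg]
    · rw [State.setReg_reg, if_neg (by revert hx; revert x; decide)]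
    · simpa using Rect.swapMap_zero
  · intro c hc s₁ ag₁ r19 ⟨h₁, r₁, π, hπ, hcur⟩
    have a9 : s₁.arr 9 = s.arr 9 := ag₁.arr 9 (by decide)
    have a7 : s₁.arr 7 = s.arr 7 := ag₁.arr 7 (by decide)
    have hact : Act s₁ N a c = Act s N a c := by funext z; simp [Act, a9]
    have key : Run W (classProg (modeOf b c) (modeOf b c).rotations) s₁ (5 * (500 * N) + 1)
        fun s' => Ready W N n a b M adj X s' ∧ s'.reg 3 = s.reg 3 + 5 * (c + 1) ∧
          ∃ π, SwapMap N a M (s.arr 7) (fun z => (z < N ∧ s.arr 9 z = 1) ∧ z / a % 5 < c + 1) π ∧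
            ∀ i < n, cur n s' i = π (cur n s i) := by
      have hlen : (modeOf b c).rotations.length = 5 := by cases modeOf b c <;> rfl
      refine (run_class (t := t) s₁ _ (Mode.isRotation (modeOf b c)) (by rwa [a9]) (by rwa [a9]) hc
        id s₁ h₁ rfl rfl r19 (by omega)
        ⟨id, ⟨fun _ _ _ => rfl, fun _ _ _ => rfl⟩, fun _ _ => rfl⟩).mono (by rw [hlen])
        fun s' ⟨h', r', π', b', c'⟩ => ⟨h', by omega, π' ∘ π, ?_, fun i hi => ?_⟩
      · rw [hact, a7] at b'
        refine SwapMap.comp h.rect (t := t) ?_ hπ (b'.swapMap h.rect (t := t) (fun z hz => ?_)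
          (Mode.rotations_foldl _)) ?_ ?_
        · exact fun z hz => hF z hz.1
        · obtain ⟨e₁, e₂, e₃⟩ := hF z ⟨hz.1, hz.2.1⟩
          exact ⟨e₁, e₂, e₃, hz.2.2⟩
        · rintro z ⟨hz, hz'⟩
          have := hz'.2.2
          omega
        · intro z
          simp only [Act]
          constructor
          · rintro ⟨hz, hz'⟩
            rcases Nat.lt_succ_iff_lt_or_eq.1 hz' with hz' | hz'
            · exact .inl ⟨hz, hz'⟩
            · exact .inr ⟨hz.1, hz.2, hz'⟩
          · rintro (⟨hz, hz'⟩ | ⟨hz, hz', hz''⟩)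
            · exact ⟨hz, by omega⟩
            · exact ⟨⟨hz, hz'⟩, by omega⟩
      · rw [c' i hi, hcur i hi]; rfl
    replace key := key.mono le_rfl (Q' := fun s'' => Ready W N n a b M adj X (s''.setReg 19 (c + 1))
      ∧ (s''.setReg 19 (c + 1)).reg 3 = s.reg 3 + 5 * (c + 1) ∧
      ∃ π, SwapMap N a M (s.arr 7) (fun z => (z < N ∧ s.arr 9 z = 1) ∧ z / a % 5 < c + 1) π ∧
        ∀ i < n, cur n (s''.setReg 19 (c + 1)) i = π (cur n s i)) (fun s' ⟨h', r', hπ'⟩ => by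
      refine ⟨h'.congr (h'.hist.congr ?_ rfl) (fun x hx => ?_) rfl, ?_, ?_⟩
      · simp [State.setReg_reg]
      · rw [State.setReg_reg, if_neg (by revert hx; revert x; decide)]
      · simpa [State.setReg_reg] using r'
      · simpa [cur, State.setReg_reg] using hπ')
    refine (Run.cond (T := 5 * (500 * N) + 30) ?_ (fun hv => ?_) fun hv => ?_).mono
      (by simp; omega) fun _ h => h
    · simp only [fits_eq, fits_reg, fits_const, h₁.reg6, val_reg, val_const]
      exact ⟨by omega, by omega, by split <;> omega⟩
    · simp [h₁.reg6] at hv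
      rw [modeOf, if_pos hv] at key
      exact key.mono (by omega) fun _ h => h
    · have hb : b ≠ 2 := by simpa [h₁.reg6] using hv
      rw [modeOf, if_neg hb] at key
      refine (Run.cond (T := 5 * (500 * N) + 1) ?_ (fun hv => ?_) fun hv => ?_).mono
        (by simp; omega) fun _ h => h
      · simp only [fits_eq, fits_mul, fits_reg, fits_const, h₁.reg6, r19, val_eq, val_reg,
          val_const]
        refine ⟨⟨by omega, by omega, ?_⟩, ⟨by omega, by omega, ?_⟩, ?_⟩ <;> split <;>
          (try split) <;> omega
      · rw [if_pos (by simpa [h₁.reg6, r19, and_comm, imp_not_comm] using hv)] at key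
        exact key
      · rw [if_neg (by simpa [h₁.reg6, r19, and_comm, imp_not_comm] using hv)] at key
        exact key
  · refine ⟨fun z hz => hπ.fst z ⟨hz, ?_⟩, fun z hz => hπ.snd z ⟨hz, ?_⟩,
      fun v hv hf => hπ.fixed v hv fun z hz => hf z hz.1⟩ <;> exact Nat.mod_lt _ (by norm_num)

end

end GridRobots

namespace GridRobots
open GridRobots.Expr GridRobots.Program

section

variable {adj : ℕ → ℕ → Prop} {W N n a b M c t : ℕ} {X : ℕ → ℕ} {s : State}

/-! ### Correctness of a round -/

theorem run_clear (i : ℕ) (hW : 10 < W) (hN : N < W) (h2 : s.reg 2 = N) :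
    Run W (.forLt 10 2 (.store i (reg 10) (const 0))) s (N * 11 + 6) fun s' =>
      ∀ v < N, s'.arr i v = 0 := by
  refine Run.forLt_const (n := N) (K := 3) (fun z s' => ∀ v < z, s'.arr i v = 0)
    (by omega) h2 hN (by decide) (by simp [Program.regs]) (by simp [Program.regs]) (by simp) ?_
  intro z hz s' hag hz' hI
  refine (Run.of_wp ?_).mono (by simp [Program.cost]) fun _ h => h
  simp only [Program.wp, fits_reg, hz', val_reg, fits_const, val_const]
  refine ⟨⟨by omega, by omega⟩, fun v hv => ?_⟩
  simp only [State.setReg_arr, State.setArr_arr, if_true]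
  rcases Nat.lt_succ_iff_lt_or_eq.1 hv with hv | rfl
  · rw [Function.update_of_ne (by omega), hI v hv]
  · rw [Function.update_self]

/-- The present vertices of the group. -/
def Col (n : ℕ) (s : State) (v : ℕ) : Prop := ∃ i < n, s.arr 2 i ≠ 0 ∧ cur n s i = v

theorem Hist.col_lt (h : Hist adj N n X s) {v : ℕ} (hv : Col n s v) : v < N := by
  obtain ⟨i, hi, -, rfl⟩ := hv
  exact h.cur_lt hi

theorem run_colour (h : Ready W N n a b M adj X s) (hA : ∀ i < n, s.arr 2 i ≤ 1)
    (ht : s.reg 3 ≤ 250 * N) :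
    Run W colourProg s (60 * N) fun s' => ∀ v < N, s'.arr 8 v = bit (Col n s) v := by
  obtain ⟨haN, hbN, hNW, h6, ha2, hb2, hW0, hMN, hL⟩ := h.bounds
  have hnN := h.robots
  refine (Run.seq (run_clear 8 (by omega) (by omega) h.reg2) (T' := n * 30 + 6)
    fun s₁ ag₁ q₁ => ?_).mono (by omega) fun _ h => h
  refine (Run.forLt_const (n := n) (K := 22) (fun j s' => ∀ v < N,
    s'.arr 8 v = bit (fun v => ∃ i < j, s.arr 2 i ≠ 0 ∧ cur n s i = v) v)
    (by omega) ((ag₁.reg 1 (by decide)).trans h.reg1) (by omega) (by decide) (by decide)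
    (by decide) (fun v hv => ?_) ?_).mono le_rfl fun _ h => h
  · rw [State.setReg_arr, q₁ v hv, eq_comm, bit_eq_zero]
    rintro ⟨i, hi, -⟩
    omega
  intro j hj s' ag' hj' hI
  refine (Run.of_wp ?_).mono (by simp [Program.cost]) fun _ h => h
  have a2 : s'.arr 2 = s.arr 2 := (ag'.arr 2 (by decide)).trans (ag₁.arr 2 (by decide))
  have a4 : s'.arr 4 = s.arr 4 := (ag'.arr 4 (by decide)).trans (ag₁.arr 4 (by decide))
  have r1 : s'.reg 1 = n := ((ag'.reg 1 (by decide)).trans (ag₁.reg 1 (by decide))).trans h.reg1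
  have r3 : s'.reg 3 = s.reg 3 := (ag'.reg 3 (by decide)).trans (ag₁.reg 3 (by decide))
  have hcl := h.hist.cur_lt hj
  have hAj := hA j hj
  obtain ⟨w₁, w₂, w₃⟩ := h.time_fits ht hj
  simp only [Program.wp, fits_load, fits_reg, fits_add, fits_mul, fits_const, val_load, val_reg,
    val_add, val_mul, val_const, hj', a2, a4, r1, r3]
  have e4 : s.arr 4 (s.reg 3 * n + j) = cur n s j := rfl
  rw [e4]
  refine ⟨⟨by omega, by omega⟩, fun hne => ⟨⟨⟨⟨by omega, by omega, by omega⟩, by omega⟩,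
    by omega⟩, fun v hv => ?_⟩, fun he v hv => ?_⟩
  · simp only [State.setReg_arr, State.setArr_arr, if_true]
    by_cases hvj : v = cur n s j
    · rw [hvj, Function.update_self, eq_comm, bit_eq_one]
      exact ⟨j, by omega, hne, rfl⟩
    · rw [Function.update_of_ne hvj, hI v hv]
      apply bit_congr
      constructor
      · rintro ⟨i, hi, h'⟩
        exact ⟨i, by omega, h'⟩
      · rintro ⟨i, hi, h₁, h₂⟩
        rcases Nat.lt_succ_iff_lt_or_eq.1 hi with hi | rfl
        · exact ⟨i, hi, h₁, h₂⟩
        · exact absurd h₂.symm hvj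
  · rw [State.setReg_arr, hI v hv]
    apply bit_congr
    constructor
    · rintro ⟨i, hi, h'⟩
      exact ⟨i, by omega, h'⟩
    · rintro ⟨i, hi, h₁, h₂⟩
      rcases Nat.lt_succ_iff_lt_or_eq.1 hi with hi | rfl
      · exact ⟨i, hi, h₁, h₂⟩
      · exact absurd he h₁

/-- Registers 13 and 14 hold running prefix counts down the present column, which makes the cost per
edge constant. The invariant says nothing about them at row 0, where they are reset. -/
theorem run_flags {C Q : ℕ → Prop} (h : Ready W N n a b M adj X s)
    (h8 : ∀ v < N, s.arr 8 v = bit C v) (h6' : ∀ v < N, s.arr 6 v = bit Q v)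
    (h17 : s.reg 17 = t) (ht : t ≤ 5 * a) :
    Run W (.forLt 10 2 flagBody) s (130 * N) fun s' =>
      ∀ z < N, s'.arr 9 z = bit (Flags a b M (s.arr 7) C Q t) z := by
  obtain ⟨haN, hbN, hNW, h6, ha2, hb2, hW0, hMN, hL⟩ := h.bounds
  have ha0 : 0 < a := by omega
  set L := s.arr 7 with hLdef
  refine (Run.forLt_const (n := N) (K := 112) (fun z s' =>
    (∀ z' < z, s'.arr 9 z' = bit (Flags a b M L C Q t) z') ∧ (z % a ≠ 0 →
      s'.reg 13 = height (colBits M L C (z / a)) (z % a) ∧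
      s'.reg 14 = height (colBits M L Q (z / a)) (z % a)))
    (by omega) h.reg2 (by omega) (by decide) (by decide) (by decide) (by simp) ?_).mono
    (by omega) fun _ h => h.1
  intro z hz s' ag hz' ⟨hI₁, hI₂⟩
  have r5 : s'.reg 5 = a := (ag.reg 5 (by decide)).trans h.reg5
  have r4 : s'.reg 4 = M := (ag.reg 4 (by decide)).trans h.reg4
  have r17 : s'.reg 17 = t := (ag.reg 17 (by decide)).trans h17
  have a7 : s'.arr 7 = L := ag.arr 7 (by decide)
  have a8 : ∀ v < N, s'.arr 8 v = bit C v := by rw [ag.arr 8 (by decide)]; exact h8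
  have a6 : ∀ v < N, s'.arr 6 v = bit Q v := by rw [ag.arr 6 (by decide)]; exact h6'
  have hzr := Nat.mod_lt z ha0
  have hzg : z / a < b := Nat.div_lt_of_lt_mul (by rwa [h.rect.mul_eq])
  have hv : L (z / a) + z % a * M < N := h.rect.lt _ hzr _ hzg
  have hg0 : L (z / a) < N := hL _ hzg
  have hp := height_le (colBits_le_one M L C (z / a)) (z % a)
  have hq := height_le (colBits_le_one M L Q (z / a)) (z % a)
  have hp1 := colBits_le_one M L C (z / a) (z % a)
  have hq1 := colBits_le_one M L Q (z / a) (z % a)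
  refine (Run.seq (T := 20) (T' := 92) (Q := fun s' => s'.reg 12 = z % a ∧
    s'.reg 15 = L (z / a) + z % a * M) ?_ fun s₁ ag₁ ⟨r12, r15⟩ => ?_).mono (by norm_num)
    fun _ h => h
  · refine (Run.of_wp ?_).mono (by simp [Program.cost]) fun _ h => h
    simp only [Program.wp, fits_div, fits_mod, fits_reg, fits_load, fits_add, fits_mul, val_div,
      val_mod, val_reg, val_load, val_add, val_mul, State.setReg_reg, State.setReg_arr]
    simp [hz', r5, r4, a7]
    have := Nat.div_le_self z a
    omega
  refine (Run.seq (T := 10) (T' := 82) (Q := fun s' =>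
      s'.reg 13 = height (colBits M L C (z / a)) (z % a) ∧
      s'.reg 14 = height (colBits M L Q (z / a)) (z % a)) ?_ fun s₂ ag₂ ⟨r13, r14⟩ => ?_).mono
      (by norm_num) fun _ h => h
  · refine (Run.of_wp ?_).mono (by simp [Program.cost]) fun _ h => h
    simp only [Program.wp, fits_reg, fits_const, val_reg, val_const, r12]
    refine ⟨by omega, fun hne => ?_, fun he => ⟨by omega, by omega, ?_⟩⟩
    · rw [ag₁.reg 13 (by decide), ag₁.reg 14 (by decide)]
      exact hI₂ hne
    · simp [State.setReg_reg, he]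
  have r15' : s₂.reg 15 = L (z / a) + z % a * M := (ag₂.reg 15 (by decide)).trans r15
  have a8₂ : ∀ v < N, s₂.arr 8 v = bit C v := by
    rw [ag₂.arr 8 (by decide), ag₁.arr 8 (by decide)]; exact a8
  have a6₂ : ∀ v < N, s₂.arr 6 v = bit Q v := by
    rw [ag₂.arr 6 (by decide), ag₁.arr 6 (by decide)]; exact a6
  refine (Run.seq (T := 12) (T' := 70) (Q := fun s' =>
      s'.reg 13 = height (colBits M L C (z / a)) (z % a + 1) ∧
      s'.reg 14 = height (colBits M L Q (z / a)) (z % a + 1)) ?_ fun s₃ ag₃ ⟨r13, r14⟩ => ?_).mono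
      (by norm_num) fun _ h => h
  · refine (Run.of_wp ?_).mono (by simp [Program.cost]) fun _ h => h
    have e₁ : s₂.arr 8 (L (z / a) + z % a * M) = colBits M L C (z / a) (z % a) := a8₂ _ hv
    have e₂ : s₂.arr 6 (L (z / a) + z % a * M) = colBits M L Q (z / a) (z % a) := a6₂ _ hv
    simp [Program.wp, State.setReg_reg, r13, r14, r15', e₁, e₂, height_succ]
    omega
  have hp' := height_le (colBits_le_one M L C (z / a)) (z % a + 1)
  have hq' := height_le (colBits_le_one M L Q (z / a)) (z % a + 1)
  have r12' : s₃.reg 12 = z % a := by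
    rw [ag₃.reg 12 (by decide), ag₂.reg 12 (by decide), r12]
  have r15₃ : s₃.reg 15 = L (z / a) + z % a * M := (ag₃.reg 15 (by decide)).trans r15'
  have r17' : s₃.reg 17 = t := by
    rw [ag₃.reg 17 (by decide), ag₂.reg 17 (by decide), ag₁.reg 17 (by decide), r17]
  have r10' : s₃.reg 10 = z := by
    rw [ag₃.reg 10 (by decide), ag₂.reg 10 (by decide), ag₁.reg 10 (by decide), hz']
  have r5' : s₃.reg 5 = a := by
    rw [ag₃.reg 5 (by decide), ag₂.reg 5 (by decide), ag₁.reg 5 (by decide), r5]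
  have r4' : s₃.reg 4 = M := by
    rw [ag₃.reg 4 (by decide), ag₂.reg 4 (by decide), ag₁.reg 4 (by decide), r4]
  have a9' : s₃.arr 9 = s'.arr 9 := by
    rw [ag₃.arr 9 (by decide), ag₂.arr 9 (by decide), ag₁.arr 9 (by decide)]
  have a8₃ : ∀ v < N, s₃.arr 8 v = bit C v := by
    rw [ag₃.arr 8 (by decide)]; exact a8₂
  suffices hmain : Run W (.cond ((reg 12 % const 4).eq (reg 17 % const 4) *
        (reg 12 + const 1).lt (reg 5))
      (.store 9 (reg 10)
        ((reg 14).lt (reg 13) * (load 8 (reg 15) * (const 1 - load 8 (reg 15 + reg 4))) +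
          (reg 13).lt (reg 14) * ((const 1 - load 8 (reg 15)) * load 8 (reg 15 + reg 4))))
      (.store 9 (reg 10) (const 0))) s₃ 70 fun s' =>
        s'.arr 9 = Function.update (s₃.arr 9) z (bit (Flags a b M L C Q t) z) by
    refine hmain.frame.mono le_rfl fun s₄ ⟨ag₄, h₄⟩ => ⟨fun z' hz' => ?_, fun hne => ?_⟩
    · rw [State.setReg_arr, h₄]
      rcases Nat.lt_succ_iff_lt_or_eq.1 hz' with hz' | rfl
      · rw [Function.update_of_ne (by omega), a9', hI₁ z' hz']
      · rw [Function.update_self]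
    · rw [State.setReg_reg, State.setReg_reg, if_neg (by decide), if_neg (by decide),
        ag₄.reg 13 (by decide), ag₄.reg 14 (by decide), r13, r14]
      have e₀ := Nat.div_add_mod z a
      -- The next edge is not in row 0, so it belongs to the same column and the counts carry over.
      have hlt : z % a + 1 < a := by
        by_contra hc
        apply hne
        have : z + 1 = a * (z / a + 1) := by rw [mul_add]; omega
        rw [this, Nat.mul_mod_right]
      have e₁ : (z + 1) / a = z / a := by
        conv_lhs => rw [← e₀, add_assoc, Nat.mul_add_div ha0, Nat.div_eq_of_lt hlt, add_zero]
      have e₂ : (z + 1) % a = z % a + 1 := by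
        conv_lhs => rw [← e₀, add_assoc, Nat.mul_add_mod, Nat.mod_eq_of_lt hlt]
      rw [e₁, e₂]
      exact ⟨rfl, rfl⟩
  refine (Run.of_wp ?_).mono (by simp [Program.cost]) fun _ h => h
  have ht4 : t % 4 < 4 := Nat.mod_lt _ (by norm_num)
  have hr4 : z % a % 4 < 4 := Nat.mod_lt _ (by norm_num)
  refine ⟨?_, fun hne => ?_, fun he => ?_⟩
  · simp only [fits_mul, fits_eq, fits_mod, fits_reg, fits_const, fits_lt, fits_add, val_eq,
      val_mod, val_reg, val_const, val_lt, val_add, r12', r17', r5']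
    refine ⟨⟨⟨by omega, by omega, by omega⟩, ⟨by omega, by omega, by omega⟩, by split <;> omega⟩,
      ⟨⟨by omega, by omega, by omega⟩, by omega, by split <;> omega⟩, ?_⟩
    split <;> split <;> omega
  · have hc : z % a % 4 = t % 4 ∧ z % a + 1 < a := by
      simpa [r12', r17', r5', and_comm, imp_not_comm] using hne
    have hv' : L (z / a) + (z % a + 1) * M < N := h.rect.lt _ hc.2 _ hzg
    have e₁ : s₃.arr 8 (L (z / a) + z % a * M) = colBits M L C (z / a) (z % a) := a8₃ _ hv
    have e₂ : s₃.arr 8 (L (z / a) + z % a * M + M) = colBits M L C (z / a) (z % a + 1) := by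
      rw [show L (z / a) + z % a * M + M = L (z / a) + (z % a + 1) * M by ring]
      exact a8₃ _ hv'
    have hp2 := colBits_le_one M L C (z / a) (z % a + 1)
    rw [add_mul, one_mul] at hv'
    -- The two alternatives of `Swaps` exclude each other, so a sum of products of 0/1 values
    -- computes their disjunction.
    have hbit : bit (Flags a b M L C Q t) z =
        (if s₃.reg 14 < s₃.reg 13 then 1 else 0) * (colBits M L C (z / a) (z % a) *
          (1 - colBits M L C (z / a) (z % a + 1))) +
        (if s₃.reg 13 < s₃.reg 14 then 1 else 0) * ((1 - colBits M L C (z / a) (z % a)) *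
          colBits M L C (z / a) (z % a + 1)) := by
      have hF : Flags a b M L C Q t z ↔
          ((s₃.reg 14 < s₃.reg 13 ∧ colBits M L C (z / a) (z % a) = 1 ∧
            colBits M L C (z / a) (z % a + 1) = 0) ∨ (s₃.reg 13 < s₃.reg 14 ∧
            colBits M L C (z / a) (z % a) = 0 ∧ colBits M L C (z / a) (z % a + 1) = 1)) := by
        rw [r13, r14, Flags, Swaps, h.rect.mul_eq]
        exact ⟨fun h => h.2.2.2, fun h => ⟨hz, hc.1, hc.2, h⟩⟩
      unfold bit
      simp only [hF]
      generalize colBits M L C (z / a) (z % a) = x at *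
      generalize colBits M L C (z / a) (z % a + 1) = y at *
      interval_cases x <;> interval_cases y <;> simp
    have hble := bit_le_one (Flags a b M L C Q t) z
    rw [hbit]
    simp only [Program.wp, fits_mul, fits_reg, fits_const, fits_lt, fits_add, fits_load, fits_sub,
      val_mul, val_reg, val_const, val_lt, val_add, val_load, val_sub, r10', r15₃, r4', e₁, e₂,
      State.setArr_arr, if_true]
    have hr13 : s₃.reg 13 < W := by omega
    have hr14 : s₃.reg 14 < W := by omega
    have hw : 1 < W := by omega
    have hv'' : L (z / a) + z % a * M < W := by omega
    have hv₃ : L (z / a) + z % a * M + M < W := by omega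
    clear hbit hble e₁ e₂ r13 r14
    generalize colBits M L C (z / a) (z % a) = x at *
    generalize colBits M L C (z / a) (z % a + 1) = y at *
    have hMW : M < W := by omega
    refine ⟨⟨by omega, ?_⟩, ?_⟩
    · by_cases h₁ : s₃.reg 14 < s₃.reg 13 <;> by_cases h₂ : s₃.reg 13 < s₃.reg 14 <;>
        simp only [h₁, h₂, if_true, if_false, hr13, hr14, hw, hv'', hv₃, hMW, true_and, one_mul,
          zero_mul] <;>
        interval_cases x <;> interval_cases y <;> omega
    · by_cases h₁ : s₃.reg 14 < s₃.reg 13 <;> by_cases h₂ : s₃.reg 13 < s₃.reg 14 <;>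
        simp only [h₁, h₂, if_true, if_false]
  · have hc : ¬ (z % a % 4 = t % 4 ∧ z % a + 1 < a) := by
      simpa [r12', r17', r5', and_comm, imp_not_comm] using he
    have hb : bit (Flags a b M L C Q t) z = 0 := by
      rw [bit_eq_zero]
      exact fun hF => hc ⟨hF.2.1, hF.2.2.1⟩
    simp only [Program.wp, fits_reg, fits_const, val_reg, val_const, r10', hb, State.setArr_arr,
      if_true, and_true]
    omega

end

end GridRobots

namespace GridRobots
open GridRobots.Expr GridRobots.Program

section

variable {adj : ℕ → ℕ → Prop} {W N n a b M c t : ℕ} {X : ℕ → ℕ} {s : State}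

theorem run_round {Q : ℕ → Prop} (h : Ready W N n a b M adj X s) (hA : ∀ i < n, s.arr 2 i ≤ 1)
    (h6' : ∀ v < N, s.arr 6 v = bit Q v) (h17 : s.reg 17 = t) (ht5 : t < 5 * a)
    (h20 : s.reg 20 = 5) (ht : s.reg 3 + 25 ≤ 250 * N)
    (hT : AllOnTrack a b M t (s.arr 7) (Col n s) Q) :
    Run W roundProg s (13200 * N) fun s' => Ready W N n a b M adj X s' ∧
      s'.reg 3 = s.reg 3 + 25 ∧ AllOnTrack a b M (t + 1) (s.arr 7) (Col n s') Q := by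
  refine (Run.seq (run_colour h hA (by omega)) (T' := 130 * N + 13000 * N)
    fun s₁ ag₁ q₁ => ?_).mono (by omega) fun _ h => h
  have h₁ : Ready W N n a b M adj X s₁ :=
    h.congr (h.hist.congr (ag₁.reg 3 (by decide)) (ag₁.arr 4 (by decide)))
      (fun x hx => ag₁.reg x (by revert hx; revert x; decide)) (ag₁.arr 7 (by decide))
  have a6 : s₁.arr 6 = s.arr 6 := ag₁.arr 6 (by decide)
  have a7 : s₁.arr 7 = s.arr 7 := ag₁.arr 7 (by decide)
  refine Run.seq (run_flags (C := Col n s) (Q := Q) h₁ q₁ (by rwa [a6])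
    ((ag₁.reg 17 (by decide)).trans h17) ht5.le) fun s₂ ag₂ q₂ => ?_
  have h₂ : Ready W N n a b M adj X s₂ :=
    h₁.congr (h₁.hist.congr (ag₂.reg 3 (by decide)) (ag₂.arr 4 (by decide)))
      (fun x hx => ag₂.reg x (by revert hx; revert x; decide)) (ag₂.arr 7 (by decide))
  have a7' : s₂.arr 7 = s.arr 7 := (ag₂.arr 7 (by decide)).trans a7
  rw [a7] at q₂
  have hact : (fun z => z < N ∧ s₂.arr 9 z = 1) = Flags a b M (s.arr 7) (Col n s) Q t := by
    funext z
    refine propext ⟨fun hz => ?_, fun hz => ?_⟩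
    · rw [← bit_eq_one (P := Flags a b M (s.arr 7) (Col n s) Q t), ← q₂ z hz.1, hz.2]
    · have hzN : z < N := by rw [← h.rect.mul_eq]; exact hz.1
      exact ⟨hzN, by rw [q₂ z hzN, bit_eq_one]; exact hz⟩
  have r3 : s₂.reg 3 = s.reg 3 := (ag₂.reg 3 (by decide)).trans (ag₁.reg 3 (by decide))
  have a4 : s₂.arr 4 = s.arr 4 := (ag₂.arr 4 (by decide)).trans (ag₁.arr 4 (by decide))
  have hcur : ∀ i, cur n s₂ i = cur n s i := fun i => by rw [cur, r3, a4, cur]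
  refine (Run.frame (run_swap (t := t) h₂ (by rw [hact]; exact flagsOK _ _)
    (fun z hz => by rw [q₂ z hz]; exact bit_le_one _ _)
    (by rw [ag₂.reg 20 (by decide), ag₁.reg 20 (by decide), h20]) (by omega))).mono le_rfl
    fun s₃ ⟨ag₃, h₃, r₃, π, hπ, hc⟩ => ⟨h₃, by omega, ?_⟩
  rw [hact, a7'] at hπ
  refine hT.round h.rect hπ (fun v hv => h.hist.col_lt hv) fun v => ?_
  have a2 : s₃.arr 2 = s.arr 2 := by
    rw [ag₃.arr 2 (by decide), ag₂.arr 2 (by decide), ag₁.arr 2 (by decide)]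
  simp only [Col, a2]
  constructor
  · rintro ⟨i, hi, h1, h2⟩
    exact ⟨cur n s i, ⟨i, hi, h1, rfl⟩, by rw [← h2, hc i hi, hcur]⟩
  · rintro ⟨w, ⟨i, hi, h1, rfl⟩, h2⟩
    exact ⟨i, hi, h1, by rw [← h2, hc i hi, hcur]⟩

/-! ### Correctness of the target pattern -/

/-- Elements are scanned in increasing order, so a counter in register 16 supplies their ranks. -/
theorem run_pattern {S : ℕ} {B : ℕ → Prop} [DecidablePred B] (hW : 10 * N ≤ W) (hN : 6 ≤ N)
    (hc : c ∉ [6]) (h2 : s.reg 2 = N) (h7 : s.reg 7 = S) (hS : 0 < S) (hSN : S ≤ N)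
    (hB : ∀ v < N, s.arr c v = bit B v) (hB' : ∀ v, B v → v < N) :
    Run W (patternProg c) s (60 * N) fun s' => ∀ v < N, s'.arr 6 v = bit (pattern B S) v := by
  refine (Run.seq (run_clear 6 (by omega) (by omega) h2) (T' := 2 + (N * 38 + 6))
    fun s₁ ag₁ q₁ => ?_).mono (by omega) fun _ h => h
  refine Run.seq (Q := fun s' => s'.reg 16 = 0) ?_ fun s₂ ag₂ q₂ => ?_
  · refine Run.of_wp ?_
    simp [Program.wp, State.setReg_reg]
    omega
  have a6 : s₂.arr 6 = s₁.arr 6 := ag₂.arr 6 (by decide)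
  have ac : s₂.arr c = s.arr c := by
    rw [ag₂.arr c (by simp [Program.arrs]),
      ag₁.arr c (by simpa [Program.forLt, Program.arrs] using hc)]
  refine (Run.forLt_const (n := N) (K := 30) (fun z s' => s'.reg 16 = Nat.count B z ∧
    ∀ v < N, s'.arr 6 v = bit (fun v => ∃ x < z, B x ∧ place B S x = v) v)
    (by omega) (by rw [ag₂.reg 2 (by decide), ag₁.reg 2 (by decide), h2]) (by omega) (by decide)
    (by simp [Program.regs]) (by simp [Program.regs]) ?_ ?_).mono le_rfl fun s' ⟨_, h'⟩ v hv => ?_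
  · refine ⟨by simp [State.setReg_reg, q₂], fun v hv => ?_⟩
    rw [State.setReg_arr, a6, q₁ v hv, eq_comm, bit_eq_zero]
    rintro ⟨x, hx, -⟩
    omega
  · intro z hz s' ag hz' ⟨hI₁, hI₂⟩
    have ac' : s'.arr c z = bit B z := by
      rw [ag.arr c (by simpa [Program.arrs] using hc), ac, hB z hz]
    have r7 : s'.reg 7 = S := by
      rw [ag.reg 7 (by simp [Program.regs]), ag₂.reg 7 (by decide), ag₁.reg 7 (by decide), h7]
    refine (Run.of_wp ?_).mono (by simp [Program.cost]) fun _ h => h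
    have hb := bit_le_one B z
    have hcz := Nat.count_le B (n := z)
    have h₁ := Nat.div_mul_le_self z S
    have h₂ := Nat.mod_lt (Nat.count B z) hS
    have h₃ := Nat.div_le_self z S
    simp only [Program.wp, fits_load, fits_reg, fits_const, fits_add, fits_mul, fits_div, fits_mod,
      val_load, val_reg, val_const, val_add, val_mul, val_div, val_mod, hz', r7, hI₁, ac',
      State.setReg_reg, State.setReg_arr, State.setArr_reg, State.setArr_arr, if_true]
    refine ⟨⟨by omega, by omega⟩, fun hne => ⟨⟨by omega, by omega⟩, by omega, ?_⟩, fun he => ?_⟩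
    · have hBz : B z := bit_eq_one.1 (by omega)
      refine ⟨by simp [Nat.count_succ, hBz], fun v hv => ?_⟩
      by_cases hvz : v = z / S * S + Nat.count B z % S
      · rw [hvz, Function.update_self, eq_comm, bit_eq_one]
        exact ⟨z, by omega, hBz, rfl⟩
      · rw [Function.update_of_ne hvz, hI₂ v hv]
        apply bit_congr
        constructor
        · rintro ⟨i, hi, h'⟩
          exact ⟨i, by omega, h'⟩
        · rintro ⟨i, hi, hBi, hpl⟩
          rcases Nat.lt_succ_iff_lt_or_eq.1 hi with hi | rfl
          · exact ⟨i, hi, hBi, hpl⟩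
          · exact absurd hpl.symm hvz
    · have hBz : ¬ B z := bit_eq_zero.1 he
      refine ⟨by simp [Nat.count_succ, hBz], fun v hv => ?_⟩
      rw [hI₂ v hv]
      apply bit_congr
      constructor
      · rintro ⟨i, hi, h'⟩
        exact ⟨i, by omega, h'⟩
      · rintro ⟨i, hi, hBi, hpl⟩
        rcases Nat.lt_succ_iff_lt_or_eq.1 hi with hi | rfl
        · exact ⟨i, hi, hBi, hpl⟩
        · exact absurd hBi hBz
  · rw [h' v hv]
    apply bit_congr
    exact ⟨fun ⟨x, _, h'⟩ => ⟨x, h'⟩, fun ⟨x, h₁, h₂⟩ => ⟨x, hB' x h₁, h₁, h₂⟩⟩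

/-! ### Correctness of the snake -/

/-- The strides at least double, so a geometric sum bounds the cost of building a snake by `O(N)`,
without a factor `k`. -/
theorem sum_stride_le {m : ℕ → ℕ} {k : ℕ} (hm : ∀ j < k, 2 ≤ m j) :
    ∑ d ∈ Finset.range k, stride m (d + 1) ≤ 2 * stride m k := by
  induction k with
  | zero => simp
  | succ k ih =>
    have h₁ := ih fun j hj => hm j (by omega)
    have h₂ := hm k (by omega)
    have h₃ : stride m k * 2 ≤ stride m (k + 1) := by
      rw [stride_succ]; exact Nat.mul_le_mul_left _ h₂
    rw [Finset.sum_range_succ]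
    omega

theorem lt_stride {m : ℕ → ℕ} {k : ℕ} (hm : ∀ j < k, 2 ≤ m j) : k < stride m k := by
  induction k with
  | zero => simp
  | succ k ih =>
    have h₁ := ih fun j hj => hm j (by omega)
    have h₂ := hm k (by omega)
    have h₃ : stride m k * 2 ≤ stride m (k + 1) := by
      rw [stride_succ]; exact Nat.mul_le_mul_left _ h₂
    omega

theorem run_snakeStep {m : ℕ → ℕ} {k i d size : ℕ} {f : ℕ → ℕ → ℕ} (hm : ∀ j < k, 2 ≤ m j)
    (hi : i < k) (hd : d < k) (hW : 10 * N ≤ W) (hN : 6 ≤ N) (hNk : stride m k = N)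
    (h0 : s.arr 0 = m) (h8 : s.reg 8 = i) (h22 : s.reg 22 = d) (h23 : s.reg 23 = size)
    (h24 : s.reg 24 = stride m d) (hS : Snake m k i d size (s.arr 7) f) :
    Run W snakeStep s (stride m (d + 1) * 60 + 60) fun s' => ∃ f' size', s'.reg 23 = size' ∧
      s'.reg 24 = stride m (d + 1) ∧ Snake m k i (d + 1) size' (s'.arr 7) f' := by
  have hsd : stride m (d + 1) ≤ N := by
    rw [← hNk]; exact Nat.le_of_dvd (stride_pos hm le_rfl) (stride_dvd m hd)
  have hsd0 := stride_pos hm hd.le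
  have hmd := hm d hd
  have hse := stride_succ m d
  have hsN : stride m d ≤ stride m (d + 1) := by rw [hse]; exact Nat.le_mul_of_pos_right _ (by omega)
  have hmN : m d ≤ stride m (d + 1) := by rw [hse]; exact Nat.le_mul_of_pos_left _ hsd0
  have hkN : k < N := hNk ▸ lt_stride hm
  have hsize : size ≤ stride m d := by
    rw [← hS.size_eq]
    apply Nat.le_mul_of_pos_right
    split
    · have := hm i hi; omega
    · omega
  have hsize0 : 0 < size := by
    rcases Nat.eq_zero_or_pos size with rfl | h'
    · have := hS.size_eq; omega
    · exact h'
  refine (Run.seq (T := stride m (d + 1) * 58 + 40) (T' := 10) (Q := fun s' => ∃ f' size',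
      s'.reg 23 = size' ∧ Snake m k i (d + 1) size' (s'.arr 7) f') ?_
      fun s₁ ag₁ ⟨f', size', q₁, q₂⟩ => ?_).mono (by omega) fun _ h => h
  · refine (Run.cond (T := stride m (d + 1) * 58 + 30) ?_ (fun hv => ?_) fun hv => ?_).mono
      (by simp; omega) fun _ h => h
    · simp only [fits_eq, fits_reg, val_reg, h8, h22]
      exact ⟨by omega, by omega, by split <;> omega⟩
    · have hdi : d = i := by simpa [h8, h22] using hv
      subst hdi
      exact ⟨s, 1, .skip s, by omega, f, size, h23, hS.skip hm hi⟩
    · have hdi : d ≠ i := by simpa [h8, h22] using hv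
      have hZ : size * m d ≤ stride m (d + 1) := by
        rw [hse]; exact Nat.mul_le_mul_right _ hsize
      have hZs : size ≤ size * m d := Nat.le_mul_of_pos_right _ (by omega)
      refine (Run.seq (T := 10) (T' := size * m d * 58 + 6 + 2) (Q := fun s' =>
        s'.reg 26 = size * m d) ?_ fun s₁ ag₁ q₁ => ?_).mono (by omega) fun _ h => h
      · refine (Run.of_wp ?_).mono (by simp [Program.cost]) fun _ h => h
        simp [Program.wp, State.setReg_reg, h22, h23, h0]
        omega
      have r23 : s₁.reg 23 = size := (ag₁.reg 23 (by decide)).trans h23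
      have r24 : s₁.reg 24 = stride m d := (ag₁.reg 24 (by decide)).trans h24
      have a7 : s₁.arr 7 = s.arr 7 := ag₁.arr 7 (by decide)
      refine Run.seq (Q := fun s' => ∀ z < size * m d,
        s'.arr 7 z = s.arr 7 (fold size z) + z / size * stride m d) ?_ fun s₂ ag₂ q₂ => ?_
      · refine (Run.forLt_const (n := size * m d) (K := 50) (fun z s' =>
          (∀ y < size, s'.arr 7 y = s.arr 7 y) ∧
          ∀ y < z, s'.arr 7 y = s.arr 7 (fold size y) + y / size * stride m d) (by omega) q₁
          (by omega) (by decide) (by decide) (by decide) ?_ ?_).mono le_rfl fun _ h => h.2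
        · refine ⟨fun y _ => by rw [State.setReg_arr, a7], by simp⟩
        · intro z hz s' ag hz' ⟨hI₁, hI₂⟩
          have r23' : s'.reg 23 = size := (ag.reg 23 (by decide)).trans r23
          have r24' : s'.reg 24 = stride m d := (ag.reg 24 (by decide)).trans r24
          have hfl := fold_lt hsize0 z
          have hlt := hS.lt _ hfl
          have hzs : z / size < m d := Nat.div_lt_of_lt_mul hz
          have hmod := Nat.mod_lt z hsize0
          have hp : z / size % 2 < 2 := Nat.mod_lt _ (by norm_num)
          have hfold : (1 - z / size % 2) * (z % size) + z / size % 2 * (size - 1 - z % size) =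
              fold size z := by
            unfold fold
            rcases Nat.mod_two_eq_zero_or_one (z / size) with h' | h' <;> simp [h']
          have hmul : (z / size + 1) * stride m d ≤ stride m (d + 1) := by
            rw [hse, mul_comm]; exact Nat.mul_le_mul_left _ hzs
          rw [add_mul, one_mul] at hmul
          refine (Run.of_wp ?_).mono (by simp [snakeBody, Program.cost]) fun _ h => h
          simp only [snakeBody, Program.wp, fits_load, fits_reg, fits_const, fits_add, fits_mul,
            fits_div, fits_mod, fits_sub, val_load, val_reg, val_const, val_add, val_mul, val_div,
            val_mod, val_sub, hz', r23', r24', hfold, hI₁ _ hfl, State.setReg_arr,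
            State.setArr_arr, if_true]
          refine ⟨⟨by omega, ?_⟩, fun y hy => ?_, fun y hy => ?_⟩
          · have hle₁ : (1 - z / size % 2) * (z % size) ≤ fold size z := by omega
            have hle₂ : z / size % 2 * (size - 1 - z % size) ≤ fold size z := by omega
            generalize z / size = q at *
            generalize z % size = r at *
            generalize (1 - q % 2) * r = x₁ at *
            generalize q % 2 * (size - 1 - r) = x₂ at *
            refine ⟨⟨⟨⟨⟨by omega, ⟨⟨by omega, by omega, by omega⟩, by omega, by omega⟩, by omega⟩,
              ⟨by omega, by omega, by omega⟩, by omega⟩, ?_, by omega⟩, by omega⟩,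
              ⟨⟨by omega, by omega, by omega⟩, by omega, by omega⟩, by omega⟩
            exact ⟨⟨⟨by omega, by omega, by omega⟩, by omega, by omega⟩,
              ⟨⟨by omega, by omega, by omega⟩, ⟨by omega, by omega, by omega⟩, by omega⟩, by omega⟩
          -- The snake is extended in place: the first pass rewrites the old entries with their own
          -- values, so later passes can still read them.
          · by_cases hyz : y = z
            · subst hyz
              rw [Function.update_self, Nat.div_eq_of_lt hy]
              simp [fold, Nat.div_eq_of_lt hy, Nat.mod_eq_of_lt hy]
            · rw [Function.update_of_ne hyz, hI₁ y hy]
          · by_cases hyz : y = z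
            · subst hyz; rw [Function.update_self]
            · rw [Function.update_of_ne hyz, hI₂ y (by omega)]
      · refine (Run.of_wp ?_).mono (by simp [Program.cost]) fun _ h => h
        have r26 : s₂.reg 26 = size * m d := (ag₂.reg 26 (by decide)).trans q₁
        simp only [Program.wp, fits_reg, val_reg, r26, State.setReg_reg, if_true, State.setReg_arr]
        exact ⟨by omega, _, _, rfl, hS.step hm hi hd hdi q₂⟩
  · refine (Run.of_wp ?_).mono (by simp [Program.cost]) fun _ h => h
    have r24 : s₁.reg 24 = stride m d := (ag₁.reg 24 (by decide)).trans h24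
    have r22 : s₁.reg 22 = d := (ag₁.reg 22 (by decide)).trans h22
    have a0 : s₁.arr 0 = m := (ag₁.arr 0 (by decide)).trans h0
    simp only [Program.wp, fits_mul, fits_load, fits_reg, val_mul, val_load, val_reg, r24, r22, a0,
      ← hse, State.setReg_reg, State.setReg_arr]
    exact ⟨⟨by omega, ⟨by omega, by omega⟩, by omega⟩, f', size', by simpa using q₁, by simp, q₂⟩

theorem run_snake {m : ℕ → ℕ} {k i : ℕ} (hm : ∀ j < k, 2 ≤ m j)
    (hi : i < k) (hW : 10 * N ≤ W) (hN : 6 ≤ N) (hNk : stride m k = N)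
    (h0 : s.arr 0 = m) (hr0 : s.reg 0 = k) (h8 : s.reg 8 = i) :
    Run W snakeProg s (250 * N) fun s' => ∃ f size, Snake m k i k size (s'.arr 7) f := by
  have hkN : k < N := hNk ▸ lt_stride hm
  have hsum := sum_stride_le hm
  rw [hNk] at hsum
  refine (Run.seq (T := 20) (T' := ∑ d ∈ Finset.range k, (stride m (d + 1) * 60 + 60 + 8) + 6)
    (Q := fun s' => s'.reg 23 = 1 ∧ s'.reg 24 = 1 ∧ s'.arr 7 0 = 0) ?_
    fun s₁ ag₁ ⟨q₁, q₂, q₃⟩ => ?_).mono ?_ fun _ h => h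
  · refine (Run.of_wp ?_).mono (by simp [Program.cost]) fun _ h => h
    simp [Program.wp, State.setReg_reg, State.setArr_arr]
    omega
  · refine (Run.forLt (n := k) (fun d s' => ∃ f size, s'.reg 23 = size ∧
      s'.reg 24 = stride m d ∧ Snake m k i d size (s'.arr 7) f) (by omega)
      ((ag₁.reg 0 (by decide)).trans hr0) (by omega) (by decide) (by decide) (by decide) ?_
      fun d hd s' ag hd' ⟨f, size, h₁, h₂, h₃⟩ => ?_).mono le_rfl
      fun s' ⟨f, size, _, _, h⟩ => ⟨f, size, h⟩
    · exact ⟨_, 1, by simp [State.setReg_reg, q₁], by simp [State.setReg_reg, q₂],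
        snake_zero hm hi q₃⟩
    · refine (run_snakeStep hm hi hd hW hN hNk ?_ ?_ hd' h₁ h₂ h₃).mono le_rfl
        fun s'' ⟨f', size', e₁, e₂, e₃⟩ => ⟨f', size', by simpa [State.setReg_reg] using e₁,
          by simpa [State.setReg_reg] using e₂, e₃⟩
      · rw [ag.arr 0 (by decide), ag₁.arr 0 (by decide), h0]
      · rw [ag.reg 8 (by decide), ag₁.reg 8 (by decide), h8]
  · rw [Finset.sum_add_distrib, Finset.sum_add_distrib, ← Finset.sum_mul]
    simp only [Finset.sum_const, Finset.card_range, smul_eq_mul]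
    omega

end

end GridRobots

namespace GridRobots
open GridRobots.Expr GridRobots.Program

/-! ### Correctness of a phase -/

theorem col_congr {n : ℕ} {s s' : State} (h₂ : s'.arr 2 = s.arr 2) (h₃ : s'.reg 3 = s.reg 3)
    (h₄ : s'.arr 4 = s.arr 4) : Col n s' = Col n s := by
  funext v
  simp only [Col, cur, h₂, h₃, h₄]

theorem col_setReg {n : ℕ} {s : State} {x v : ℕ} (hx : 3 ≠ x) : Col n (s.setReg x v) = Col n s :=
  col_congr rfl (by rw [State.setReg_reg, if_neg hx]) rfl

/-- What a phase expects to find in the registers and arrays. -/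
structure Base {k : ℕ} (m : Fin k → ℕ) (n : ℕ) (X : ℕ → ℕ) (s : State) : Prop where
  hist : Hist (numAdj m) (∏ i, m i) n X s
  robots : n ≤ ∏ i, m i
  reg0 : s.reg 0 = k
  reg1 : s.reg 1 = n
  reg2 : s.reg 2 = ∏ i, m i
  arr0 : s.arr 0 = side m
  arr2 : ∀ i < n, s.arr 2 i ≤ 1

theorem Hist.setReg {adj : ℕ → ℕ → Prop} {N n : ℕ} {X : ℕ → ℕ} {s : State}
    (h : Hist adj N n X s) {x v : ℕ} (hx : 3 ≠ x) : Hist adj N n X (s.setReg x v) :=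
  h.congr (by rw [State.setReg_reg, if_neg hx]) rfl

theorem Base.congr {k : ℕ} {m : Fin k → ℕ} {n : ℕ} {X : ℕ → ℕ} {s s' : State} (h : Base m n X s)
    (hh : Hist (numAdj m) (∏ i, m i) n X s') (hr : ∀ x ∈ [0, 1, 2], s'.reg x = s.reg x)
    (ha : ∀ x ∈ [0, 2], s'.arr x = s.arr x) : Base m n X s' := by
  simp only [List.forall_mem_cons] at hr ha
  obtain ⟨r0, r1, r2, -⟩ := hr
  obtain ⟨a0, a2, -⟩ := ha
  exact ⟨hh, h.robots, r0.trans h.reg0, r1.trans h.reg1, r2.trans h.reg2, a0.trans h.arr0,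
    a2 ▸ h.arr2⟩

section

variable {k : ℕ} {m : Fin k → ℕ} {W n c i S : ℕ} {X : ℕ → ℕ} {s : State}

/-- The snake is only found during the run, so the equality of column counts `hh` is required for
every rectangle of the given shape. The makespan is `5 * a` rounds of 25 time steps. -/
theorem run_phase {B : ℕ → Prop} [DecidablePred B] (hk : 2 ≤ k) (hm : ∀ j, 2 ≤ m j)
    (h6 : 6 ≤ ∏ j, m j) (hW : 300 * (∏ j, m j) * (∏ j, m j) ≤ W) (h : Base m n X s) (hi : i < k)
    (h8 : s.reg 8 = i) (h5 : s.reg 5 = side m i) (h4 : s.reg 4 = stride (side m) i)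
    (h7 : s.reg 7 = S) (hS : 0 < S) (hSN : S ≤ ∏ j, m j) (hc : c ∉ [6])
    (hB : ∀ v < ∏ j, m j, s.arr c v = bit B v) (hB' : ∀ v, B v → v < ∏ j, m j)
    (ht : s.reg 3 + 125 * side m i ≤ 250 * ∏ j, m j)
    (hh : ∀ b L, Rect (numAdj m) (∏ j, m j) (side m i) b (stride (side m) i) L → ∀ g < b,
      height (colBits (stride (side m) i) L (Col n s) g) (side m i) =
        height (colBits (stride (side m) i) L (pattern B S) g) (side m i)) :
    Run W (phaseProg c) s (80000 * (∏ j, m j) * side m i) fun s' =>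
      Hist (numAdj m) (∏ j, m j) n X s' ∧ s'.reg 3 = s.reg 3 + 125 * side m i ∧
        ∀ v < ∏ j, m j, (Col n s' v ↔ pattern B S v) := by
  have hm' : ∀ j < k, 2 ≤ side m j := fun j hj => by simpa [side, hj] using hm ⟨j, hj⟩
  have hNk := stride_side m
  have hreg2 := h.reg2
  have hhist := h.hist
  have hrob := h.robots
  have ha2 := hm' i hi
  have haN : side m i ≤ ∏ j, m j := by
    rw [← hNk]
    refine le_trans ?_ (Nat.le_of_dvd (stride_pos hm' le_rfl) (stride_dvd (side m) hi))
    rw [stride_succ]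
    exact Nat.le_mul_of_pos_left _ (stride_pos hm' hi.le)
  generalize hN : ∏ j, m j = N at *
  have hNW : 300 * N ≤ W := by nlinarith
  set a := side m i with hadef
  have hNa : N * 2 ≤ N * a := Nat.mul_le_mul_left _ ha2
  refine (Run.seq (T := 20) (T' := 60 * N + (250 * N + (5 * a * (13200 * N + 8) + 6)))
    (Q := fun s' => s'.reg 6 = N / a ∧ s'.reg 18 = 5 * a ∧ s'.reg 20 = 5) ?_
    fun s₁ ag₁ ⟨q₁, q₂, q₃⟩ => ?_).mono (by nlinarith) fun _ h => h
  · refine (Run.of_wp ?_).mono (by simp [Program.cost]) fun _ h => h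
    have := Nat.div_le_self N a
    simp [Program.wp, State.setReg_reg, hreg2, h5]
    omega
  have r1₁ : ∀ x ∉ [6, 18, 20], s₁.reg x = s.reg x := fun x hx => ag₁.reg x hx
  have a1₁ : ∀ x, s₁.arr x = s.arr x := fun x => ag₁.arr x (by simp [Program.arrs])
  refine Run.seq (run_pattern (N := N) (S := S) (B := B) (by omega) h6 hc
    ((r1₁ 2 (by decide)).trans hreg2) ((r1₁ 7 (by decide)).trans h7) hS hSN
    (by rwa [a1₁]) hB') fun s₂ ag₂ q₆ => ?_
  have r1₂ : ∀ x ∉ [6, 18, 20, 10, 16], s₂.reg x = s.reg x := fun x hx => by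
    rw [ag₂.reg x (by revert hx; simp +contextual [patternProg, Program.regs, Program.forLt]),
      r1₁ x (by revert hx; simp +contextual)]
  have a1₂ : ∀ x ∉ [6], s₂.arr x = s.arr x := fun x hx => by
    rw [ag₂.arr x (by revert hx; simp +contextual [patternProg, Program.arrs, Program.forLt]),
      a1₁ x]
  refine Run.seq (run_snake (N := N) (m := side m) hm' hi (by omega) h6 hNk
    ((a1₂ 0 (by decide)).trans h.arr0) ((r1₂ 0 (by decide)).trans h.reg0)
    ((r1₂ 8 (by decide)).trans h8)) fun s₃ ag₃ ⟨f, b, hsnake⟩ => ?_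
  have rect := hsnake.rect hk hm (hN ▸ h6) hi
  rw [hN] at rect
  have hb : N / a = b := by
    rw [← rect.mul_eq]; exact Nat.mul_div_cancel_left _ (by omega)
  have e3 : s₃.reg 3 = s.reg 3 := (ag₃.reg 3 (by decide)).trans (r1₂ 3 (by decide))
  have e4 : s₃.arr 4 = s.arr 4 := (ag₃.arr 4 (by decide)).trans (a1₂ 4 (by decide))
  have e2 : s₃.arr 2 = s.arr 2 := (ag₃.arr 2 (by decide)).trans (a1₂ 2 (by decide))
  have e6 : s₃.arr 6 = s₂.arr 6 := ag₃.arr 6 (by decide)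
  have r3 : ∀ x ∈ [1, 2, 4, 5], s₃.reg x = s.reg x := fun x hx => by
    rw [ag₃.reg x (by revert hx; revert x; decide), r1₂ x (by revert hx; revert x; decide)]
  have r6 : s₃.reg 6 = b := by
    rw [ag₃.reg 6 (by decide),
      ag₂.reg 6 (by simp [patternProg, Program.regs, Program.forLt]), q₁, hb]
  have r18 : s₃.reg 18 = 5 * a := by
    rw [ag₃.reg 18 (by decide),
      ag₂.reg 18 (by simp [patternProg, Program.regs, Program.forLt]), q₂]
  have r20 : s₃.reg 20 = 5 := by
    rw [ag₃.reg 20 (by decide),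
      ag₂.reg 20 (by simp [patternProg, Program.regs, Program.forLt]), q₃]
  have hready : Ready W N n a b (stride (side m) i) (numAdj m) X s₃ :=
    ⟨rect, hhist.congr e3 e4, hW, hrob, (r3 1 (by decide)).trans h.reg1,
      (r3 2 (by decide)).trans hreg2, (r3 4 (by decide)).trans h4, (r3 5 (by decide)).trans h5, r6⟩
  have hcol : Col n s₃ = Col n s := col_congr e2 e3 e4
  have hframe : ∀ s' v, Ready W N n a b (stride (side m) i) (numAdj m) X s' →
      Ready W N n a b (stride (side m) i) (numAdj m) X (s'.setReg 17 v) := fun s' v h' =>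
    h'.congr (h'.hist.setReg (by decide))
      (fun x hx => by rw [State.setReg_reg, if_neg]; revert hx; revert x; decide) rfl
  refine (Run.forLt_const (n := 5 * a) (fun t s' =>
    Ready W N n a b (stride (side m) i) (numAdj m) X s' ∧ s'.reg 3 = s.reg 3 + 25 * t ∧
    AllOnTrack a b (stride (side m) i) t (s₃.arr 7) (Col n s') (pattern B S))
    (by omega) r18 (by omega) (by decide) (by decide) (by decide) ?_
    fun t ht' s' ag r17 ⟨i₁, i₂, i₃⟩ => ?_).mono le_rfl fun s' ⟨i₁, i₂, i₃⟩ =>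
      ⟨i₁.hist, by rw [i₂]; ring, fun v hv => i₃.iff rect hv⟩
  · refine ⟨hframe _ _ hready, by simp [State.setReg_reg, e3], fun g hg => ?_⟩
    rw [col_setReg (by decide), hcol]
    exact OnTrack.zero (by omega) (colBits_le_one _ _ _ _) (hh b _ rect g hg)
  · have a7 : s'.arr 7 = s₃.arr 7 := ag.arr 7 (by decide)
    refine (run_round (t := t) (Q := pattern B S) i₁ ?_ ?_ r17 ht'
      ((ag.reg 20 (by decide)).trans r20) ?_
      (by rwa [a7])).mono le_rfl fun s'' ⟨j₁, j₂, j₃⟩ => ⟨hframe _ _ j₁, ?_, ?_⟩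
    · rw [ag.arr 2 (by decide), e2]; exact h.arr2
    · rw [ag.arr 6 (by decide), e6]; exact q₆
    · omega
    · simp only [State.setReg_reg]; simp; omega
    · rw [col_setReg (by decide), ← a7]
      exact j₃

end

end GridRobots

namespace GridRobots
open GridRobots.Expr GridRobots.Program

/-! ### Correctness of the sequences of phases -/

theorem Rect.height_congr {adj : ℕ → ℕ → Prop} {N a b M : ℕ} {L : ℕ → ℕ} (h : Rect adj N a b M L)
    {C C' : ℕ → Prop} (hC : ∀ v < N, C v ↔ C' v) {g : ℕ} (hg : g < b) :
    height (colBits M L C g) a = height (colBits M L C' g) a :=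
  Finset.sum_congr rfl fun r hr =>
    bit_congr (hC _ (h.lt r (Finset.mem_range.1 hr) g hg))

/-- Bounds the total makespan by `250 * N`, as the address bounds require. -/
theorem sum_le_stride {m : ℕ → ℕ} {d : ℕ} (hm : ∀ j < d, 2 ≤ m j) :
    ∑ j ∈ Finset.range d, m j ≤ stride m d := by
  induction d with
  | zero => simp
  | succ d ih =>
    have ih := ih fun j hj => hm j (by omega)
    rw [Finset.sum_range_succ, stride_succ]
    have h₁ := hm d (by omega)
    rcases Nat.eq_zero_or_pos d with rfl | hd
    · simp
    · have h₂ := hm 0 (by omega)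
      have h₃ : m 0 ≤ ∑ j ∈ Finset.range d, m j :=
        Finset.single_le_sum (fun _ _ => Nat.zero_le _) (Finset.mem_range.2 hd)
      nlinarith

section

variable {k : ℕ} {m : Fin k → ℕ} {W n : ℕ} {X : ℕ → ℕ} {s : State}

/-- Before phase `i` the group occupies the pattern of stride `i`; the phase raises this to stride
`i + 1`, which `Rect.height_pattern` permits. -/
theorem run_forward {B : ℕ → Prop} [DecidablePred B] (hk : 2 ≤ k) (hm : ∀ j, 2 ≤ m j)
    (h6 : 6 ≤ ∏ j, m j) (hW : 300 * (∏ j, m j) * (∏ j, m j) ≤ W) (h : Base m n X s)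
    (h4 : s.reg 4 = 1) (h3 : s.reg 3 = 0)
    (hB : ∀ v < ∏ j, m j, s.arr 5 v = bit B v) (hB' : ∀ v, B v → v < ∏ j, m j)
    (hC : ∀ v < ∏ j, m j, (Col n s v ↔ B v)) :
    Run W forwardProg s (80000 * (∏ j, m j) * (∑ j, m j) + 30 * k + 6) fun s' =>
      Base m n X s' ∧ s'.reg 4 = ∏ j, m j ∧ s'.reg 3 = 125 * ∑ j, m j ∧
        ∀ v < ∏ j, m j, (Col n s' v ↔ pattern B (∏ j, m j) v) := by
  have hm' : ∀ j < k, 2 ≤ side m j := fun j hj => by simpa [side, hj] using hm ⟨j, hj⟩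
  have hNk := stride_side m
  have hsum : ∑ j ∈ Finset.range k, side m j = ∑ j, m j := by
    rw [Finset.sum_range]; exact Finset.sum_congr rfl fun j _ => side_coe m j
  have hsN := sum_le_stride hm'
  have hkN := lt_stride hm'
  rw [hNk] at hsN hkN
  rw [← hsum]
  have hNW : 300 * ∏ j, m j ≤ W := by nlinarith
  refine (Run.forLt (n := k) (T := fun i => 80000 * (∏ j, m j) * side m i + 20) (fun i s' =>
    Base m n X s' ∧ s'.reg 4 = stride (side m) i ∧
      s'.reg 3 = 125 * ∑ j ∈ Finset.range i, side m j ∧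
      ∀ v < ∏ j, m j, (Col n s' v ↔ pattern B (stride (side m) i) v))
    (by omega) h.reg0 (by omega) (by decide) (by decide) (by decide) ?_
    fun i hi s' ag r8 ⟨i₁, i₂, i₃, i₄⟩ => ?_).mono ?_ fun s' h' => by rwa [hNk] at h'
  · refine ⟨h.congr (h.hist.setReg (by decide)) ?_ ?_, ?_, ?_, fun v hv => ?_⟩
    · simp [State.setReg_reg]
    · simp
    · simp [State.setReg_reg, h4]
    · simp [State.setReg_reg, h3]
    · rw [col_setReg (by decide), hC v hv, stride_zero, pattern_one]
  · have ha2 := hm' i hi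
    have hS0 : 0 < stride (side m) (i + 1) := stride_pos hm' hi
    have hSN : stride (side m) (i + 1) ≤ _ :=
      Nat.le_of_dvd (stride_pos hm' le_rfl) (stride_dvd (side m) hi)
    have hse := stride_succ (side m) i
    have hMS : stride (side m) i ≤ stride (side m) (i + 1) := by
      rw [hse]; exact Nat.le_mul_of_pos_right _ (by omega)
    have haS : side m i ≤ stride (side m) (i + 1) := by
      rw [hse]; exact Nat.le_mul_of_pos_left _ (stride_pos hm' hi.le)
    have hpart : ∑ j ∈ Finset.range (i + 1), side m j ≤ ∑ j ∈ Finset.range k, side m j :=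
      Finset.sum_le_sum_of_subset (by simpa using hi)
    rw [hNk] at hSN
    refine (Run.seq (T := 10) (T' := 80000 * (∏ j, m j) * side m i + 2) (Q := fun s'' =>
      s''.reg 5 = side m i ∧ s''.reg 7 = stride (side m) (i + 1)) ?_
      fun s₁ ag₁ ⟨q₁, q₂⟩ => ?_).mono (by omega) fun _ h => h
    · refine (Run.of_wp ?_).mono (by simp [Program.cost]) fun _ h => h
      simp [Program.wp, State.setReg_reg, r8, i₁.arr0, i₂, ← hse]
      omega
    have hr : ∀ x ∉ [5, 7], s₁.reg x = s'.reg x := fun x hx => ag₁.reg x hx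
    have ha : ∀ x, s₁.arr x = s'.arr x := fun x => ag₁.arr x (by simp [Program.arrs])
    have hcol : Col n s₁ = Col n s' := col_congr (ha 2) (hr 3 (by decide)) (ha 4)
    have a5 : s'.arr 5 = s.arr 5 := ag.arr 5 (by decide)
    have hb₁ : Base m n X s₁ := i₁.congr (i₁.hist.congr (hr 3 (by decide)) (ha 4))
      (fun x hx => hr x (by revert hx; revert x; decide)) (fun x _ => ha x)
    have e3 := hr 3 (by decide)
    have hs1 := Finset.sum_range_succ (side m) i
    refine Run.seq (run_phase (B := B) (S := stride (side m) (i + 1)) hk hm h6 hW hb₁ hi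
      ((hr 8 (by decide)).trans r8) q₁ ((hr 4 (by decide)).trans i₂) q₂ hS0 hSN (by decide)
      (by rwa [ha, a5]) hB' (by omega) fun b L hR g hg => ?_) fun s₂ ag₂ ⟨q₃, q₄, q₅⟩ => ?_
    · rw [hcol, hR.height_congr i₄ hg, hse]
      exact hR.height_pattern hB' hg
    · rw [phaseProg_regs, phaseProg_arrs] at ag₂
      refine (Run.of_wp ?_).mono (by simp [Program.cost]) fun _ h => h
      have r7 : s₂.reg 7 = stride (side m) (i + 1) := (ag₂.reg 7 (by decide)).trans q₂
      refine ⟨by simp [r7]; omega, ?_, ?_, ?_, fun v hv => ?_⟩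
      · refine hb₁.congr ((q₃.setReg (by decide)).setReg (by decide)) (fun x hx => ?_)
          fun x hx => ?_
        · rw [State.setReg_reg, if_neg (by revert hx; revert x; decide), State.setReg_reg,
            if_neg (by revert hx; revert x; decide), ag₂.reg x (by revert hx; revert x; decide)]
        · exact ag₂.arr x (by revert hx; revert x; decide)
      · simp [State.setReg_reg, r7]
      · simp [State.setReg_reg]; omega
      · rw [col_setReg (by decide), col_setReg (by decide), q₅ v hv]
  · simp only [Finset.sum_add_distrib, Finset.mul_sum, Finset.sum_const, Finset.card_range,
      smul_eq_mul]
    omega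

/-- The same equality of counts is read in the other direction: the patterns of the goal set are
refined from the last coordinate down to the first, ending with the goal set itself. -/
theorem run_backward {B : ℕ → Prop} [DecidablePred B] (hk : 2 ≤ k) (hm : ∀ j, 2 ≤ m j)
    (h6 : 6 ≤ ∏ j, m j) (hW : 300 * (∏ j, m j) * (∏ j, m j) ≤ W) (h : Base m n X s)
    (h4 : s.reg 4 = ∏ j, m j) (h3 : s.reg 3 = 125 * ∑ j, m j)
    (hB : ∀ v < ∏ j, m j, s.arr 3 v = bit B v) (hB' : ∀ v, B v → v < ∏ j, m j)
    (hC : ∀ v < ∏ j, m j, (Col n s v ↔ pattern B (∏ j, m j) v)) :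
    Run W backwardProg s (80000 * (∏ j, m j) * (∑ j, m j) + 30 * k + 6) fun s' =>
      Base m n X s' ∧ s'.reg 3 = 250 * ∑ j, m j ∧ ∀ v < ∏ j, m j, (Col n s' v ↔ B v) := by
  have hm' : ∀ j < k, 2 ≤ side m j := fun j hj => by simpa [side, hj] using hm ⟨j, hj⟩
  have hNk := stride_side m
  have hsum : ∑ j ∈ Finset.range k, side m j = ∑ j, m j := by
    rw [Finset.sum_range]; exact Finset.sum_congr rfl fun j _ => side_coe m j
  have hrefl := Finset.sum_range_reflect (side m) k
  have hsN := sum_le_stride hm'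
  have hkN := lt_stride hm'
  rw [hNk] at hsN hkN
  rw [← hsum] at h3 ⊢
  have hNW : 300 * ∏ j, m j ≤ W := by nlinarith
  refine (Run.forLt (n := k) (T := fun j => 80000 * (∏ j, m j) * side m (k - 1 - j) + 20)
    (fun j s' => Base m n X s' ∧ s'.reg 4 = stride (side m) (k - j) ∧
      s'.reg 3 = 125 * ∑ j ∈ Finset.range k, side m j +
        125 * ∑ l ∈ Finset.range j, side m (k - 1 - l) ∧
      ∀ v < ∏ j, m j, (Col n s' v ↔ pattern B (stride (side m) (k - j)) v))
    (by omega) h.reg0 (by omega) (by decide) (by decide) (by decide) ?_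
    fun j hj s' ag r9 ⟨i₁, i₂, i₃, i₄⟩ => ?_).mono ?_ fun s' ⟨h₁, _, h₃, h₄⟩ =>
      ⟨h₁, by rw [hrefl] at h₃; omega, fun v hv => by simpa [pattern_one] using h₄ v hv⟩
  · refine ⟨h.congr (h.hist.setReg (by decide)) ?_ ?_, ?_, ?_, fun v hv => ?_⟩
    · simp [State.setReg_reg]
    · simp
    · simp [State.setReg_reg, h4, hNk]
    · simp [State.setReg_reg, h3]
    · rw [col_setReg (by decide), hC v hv, Nat.sub_zero, hNk]
  · obtain ⟨i, hij⟩ : ∃ i, i = k - 1 - j := ⟨_, rfl⟩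
    have hi : i < k := by omega
    have hkj : k - j = i + 1 := by omega
    have hkj' : k - (j + 1) = i := by omega
    rw [hkj] at i₂ i₄
    rw [hkj', ← hij]
    have ha2 := hm' i hi
    have hM0 := stride_pos hm' hi.le
    have hSN : stride (side m) (i + 1) ≤ _ :=
      Nat.le_of_dvd (stride_pos hm' le_rfl) (stride_dvd (side m) hi)
    have hse := stride_succ (side m) i
    have hMS : stride (side m) i ≤ stride (side m) (i + 1) := by
      rw [hse]; exact Nat.le_mul_of_pos_right _ (by omega)
    have haS : side m i ≤ stride (side m) (i + 1) := by
      rw [hse]; exact Nat.le_mul_of_pos_left _ (stride_pos hm' hi.le)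
    have hpart : ∑ l ∈ Finset.range (j + 1), side m (k - 1 - l) ≤
        ∑ l ∈ Finset.range k, side m (k - 1 - l) :=
      Finset.sum_le_sum_of_subset (by simpa using hj)
    have hdiv : stride (side m) (i + 1) / side m i = stride (side m) i := by
      rw [hse]; exact Nat.mul_div_cancel _ (by omega)
    rw [hNk] at hSN
    have hs1 := Finset.sum_range_succ (fun l => side m (k - 1 - l)) j
    rw [← hij] at hs1
    refine (Run.seq (T := 20) (T' := 80000 * (∏ j, m j) * side m i) (Q := fun s'' =>
      s''.reg 8 = i ∧ s''.reg 5 = side m i ∧ s''.reg 4 = stride (side m) i ∧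
        s''.reg 7 = stride (side m) i) ?_
      fun s₁ ag₁ ⟨q₁, q₂, q₃, q₄⟩ => ?_).mono (by omega) fun _ h => h
    · refine (Run.of_wp ?_).mono (by simp [Program.cost]) fun _ h => h
      simp [Program.wp, State.setReg_reg, r9, i₁.reg0, i₁.arr0, i₂, ← hij, hdiv]
      omega
    have hr : ∀ x ∉ [8, 5, 4, 7], s₁.reg x = s'.reg x := fun x hx => ag₁.reg x hx
    have ha : ∀ x, s₁.arr x = s'.arr x := fun x => ag₁.arr x (by simp [Program.arrs])
    have hcol : Col n s₁ = Col n s' := col_congr (ha 2) (hr 3 (by decide)) (ha 4)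
    have a3 : s'.arr 3 = s.arr 3 := ag.arr 3 (by decide)
    have hb₁ : Base m n X s₁ := i₁.congr (i₁.hist.congr (hr 3 (by decide)) (ha 4))
      (fun x hx => hr x (by revert hx; revert x; decide)) (fun x _ => ha x)
    have e3 := hr 3 (by decide)
    refine (Run.frame (run_phase (B := B) (S := stride (side m) i) hk hm h6 hW hb₁ hi
      q₁ q₂ q₃ q₄ hM0 (by omega) (by decide)
      (by rwa [ha, a3]) hB' (by omega) fun b L hR g hg => ?_)).mono le_rfl
      fun s₂ ⟨ag₂, q₅, q₆, q₇⟩ => ?_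
    · rw [hcol, hR.height_congr i₄ hg, hse]
      exact (hR.height_pattern hB' hg).symm
    · rw [phaseProg_regs, phaseProg_arrs] at ag₂
      refine ⟨?_, ?_, ?_, fun v hv => ?_⟩
      · refine hb₁.congr (q₅.setReg (by decide)) (fun x hx => ?_) fun x hx => ?_
        · rw [State.setReg_reg, if_neg (by revert hx; revert x; decide),
            ag₂.reg x (by revert hx; revert x; decide)]
        · exact ag₂.arr x (by revert hx; revert x; decide)
      · rw [State.setReg_reg, if_neg (by decide), ag₂.reg 4 (by decide), q₃]
      · rw [State.setReg_reg, if_neg (by decide)]; omega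
      · rw [col_setReg (by decide), q₇ v hv]
  · rw [← hrefl]
    simp only [Finset.sum_add_distrib, Finset.mul_sum, Finset.sum_const, Finset.card_range,
      smul_eq_mul]
    omega

end

end GridRobots

namespace GridRobots
open GridRobots.Expr GridRobots.Program

/-! ### Correctness of the program -/

section

variable {k : ℕ} {m : Fin k → ℕ} {W n : ℕ} {X : ℕ → ℕ} {s : State}

theorem run_size (hm : ∀ j < k, 2 ≤ side m j) (hW : 300 * ∏ j, m j ≤ W) (h0 : s.reg 0 = k)
    (ha : s.arr 0 = side m) :
    Run W sizeProg s (20 * k + 10) fun s' => s'.reg 2 = ∏ j, m j := by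
  have hNk := stride_side m
  have hkN := lt_stride hm
  rw [hNk] at hkN
  refine (Run.seq (T := 2) (T' := k * (10 + 8) + 6) (Q := fun s' => s'.reg 2 = 1) ?_
    fun s₁ ag₁ q₁ => ?_).mono (by omega) fun _ h => h
  · refine (Run.of_wp ?_).mono (by simp [Program.cost]) fun _ h => h
    simp [Program.wp, State.setReg_reg]
    omega
  refine (Run.forLt_const (n := k) (fun d s' => s'.reg 2 = stride (side m) d) (by omega)
    ((ag₁.reg 0 (by decide)).trans h0) (by omega) (by decide) (by decide) (by decide) ?_
    fun d hd s' ag r22 hI => ?_).mono le_rfl fun s' h' => h'.trans hNk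
  · simp [State.setReg_reg, q₁]
  · have a0 : s'.arr 0 = side m := by rw [ag.arr 0 (by decide), ag₁.arr 0 (by decide), ha]
    have hse := stride_succ (side m) d
    have hS : stride (side m) (d + 1) ≤ _ :=
      Nat.le_of_dvd (stride_pos hm le_rfl) (stride_dvd (side m) hd)
    have hmd := hm d hd
    have hMS : stride (side m) d ≤ stride (side m) (d + 1) := by
      rw [hse]; exact Nat.le_mul_of_pos_right _ (by omega)
    have haS : side m d ≤ stride (side m) (d + 1) := by
      rw [hse]; exact Nat.le_mul_of_pos_left _ (stride_pos hm hd.le)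
    refine (Run.of_wp ?_).mono (by simp [Program.cost]) fun _ h => h
    simp [Program.wp, State.setReg_reg, r22, a0, hI, ← hse]
    omega

theorem run_init {N : ℕ} (hW : 300 * N ≤ W) (hN : 6 ≤ N) (hn : n ≤ N) (h1 : s.reg 1 = n)
    (ha1 : ∀ i < n, s.arr 1 i < N) (ha2 : ∀ i < n, s.arr 2 i ≤ 1) (ha5 : ∀ v, s.arr 5 v = 0) :
    Run W initProg s (28 * N + 6) fun s' => (∀ i < n, s'.arr 4 i = s.arr 1 i) ∧
      ∀ v < N, s'.arr 5 v = bit (fun v => ∃ i < n, s.arr 2 i ≠ 0 ∧ s.arr 1 i = v) v := by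
  refine (Run.forLt_const (n := n) (K := 20) (fun j s' => (∀ i < j, s'.arr 4 i = s.arr 1 i) ∧
      ∀ v < N, s'.arr 5 v = bit (fun v => ∃ i < j, s.arr 2 i ≠ 0 ∧ s.arr 1 i = v) v)
    (by omega) h1 (by omega) (by decide) (by decide) (by decide) ?_
    fun j hj s' ag r10 ⟨i₁, i₂⟩ => ?_).mono (by omega) fun _ h => h
  · refine ⟨by simp, fun v hv => ?_⟩
    rw [State.setReg_arr, ha5, eq_comm, bit_eq_zero]
    simp
  · have a1 : s'.arr 1 = s.arr 1 := ag.arr 1 (by decide)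
    have a2 : s'.arr 2 = s.arr 2 := ag.arr 2 (by decide)
    have b1 := ha1 j hj
    have b2 := ha2 j hj
    refine (Run.of_wp ?_).mono (by simp [Program.cost]) fun _ h => h
    have h4 : ∀ i ≤ j, Function.update (s'.arr 4) j (s.arr 1 j) i = s.arr 1 i := fun i hi => by
      by_cases hij : i = j
      · rw [hij, Function.update_self]
      · rw [Function.update_of_ne hij, i₁ i (by omega)]
    simp only [Program.wp, fits_load, fits_reg, fits_const, val_load, val_reg, val_const, r10, a1,
      a2, State.setReg_arr, State.setArr_reg, State.setArr_arr, if_true]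
    norm_num
    refine ⟨by omega, by omega, fun hne => ⟨by omega, h4, fun v hv => ?_⟩,
      fun he => ⟨h4, fun v hv => ?_⟩⟩
    · by_cases hvj : v = s.arr 1 j
      · rw [hvj, Function.update_self, eq_comm, bit_eq_one]
        exact ⟨j, by omega, hne, rfl⟩
      · rw [Function.update_of_ne hvj, i₂ v hv]
        apply bit_congr
        constructor
        · rintro ⟨i, hi, h'⟩
          exact ⟨i, by omega, h'⟩
        · rintro ⟨i, hi, hA, hx⟩
          rcases Nat.lt_or_eq_of_le hi with hi | rfl
          · exact ⟨i, hi, hA, hx⟩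
          · exact absurd hx.symm hvj
    · rw [i₂ v hv]
      apply bit_congr
      constructor
      · rintro ⟨i, hi, h'⟩
        exact ⟨i, by omega, h'⟩
      · rintro ⟨i, hi, hA, hx⟩
        rcases Nat.lt_or_eq_of_le hi with hi | rfl
        · exact ⟨i, hi, hA, hx⟩
        · exact absurd he hA

/-! ### Sets of grid vertices as predicates on numbers, and the whole run -/

/-- The numbers of the vertices in a set. -/
def marks (T : Finset (GridVertex m)) (v : ℕ) : Prop := ∃ u ∈ T, vertexIndex u = v

theorem marks_lt {T : Finset (GridVertex m)} {v : ℕ} (h : marks T v) : v < ∏ j, m j := by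
  obtain ⟨u, -, rfl⟩ := h
  exact vertexIndex_lt u

theorem count_marks (T : Finset (GridVertex m)) [DecidablePred (marks T)] :
    Nat.count (marks T) (∏ j, m j) = T.card := by
  rw [Nat.count_eq_card_filter_range, ← Finset.card_image_of_injective T vertexIndex_injective]
  congr 1
  ext v
  simp only [Finset.mem_filter, Finset.mem_range, Finset.mem_image]
  exact ⟨fun h => h.2, fun h => ⟨marks_lt h, h⟩⟩

variable {XI : Fin n → GridVertex m} {A : Finset (Fin n)} {T : Finset (GridVertex m)}

theorem inputState_marks_goal {v : ℕ} (hv : v < ∏ j, m j) :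
    (inputState m XI A T).arr 3 v = bit (marks T) v := by
  have key : marks T v ↔ finPiFinEquiv.symm ⟨v, hv⟩ ∈ T := by
    constructor
    · rintro ⟨u, hu, rfl⟩
      have : (⟨vertexIndex u, hv⟩ : Fin (∏ j, m j)) = finPiFinEquiv u := rfl
      rwa [this, Equiv.symm_apply_apply]
    · intro h
      exact ⟨_, h, by simp [vertexIndex]⟩
  simp only [inputState, hv, dif_pos]
  split
  · next h => exact (bit_eq_one.2 (key.2 h)).symm
  · next h => exact (bit_eq_zero.2 fun h' => h (key.1 h')).symm

theorem inputState_group {i : ℕ} (hi : i < n) :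
    (inputState m XI A T).arr 2 i ≠ 0 ↔ (⟨i, hi⟩ : Fin n) ∈ A := by
  simp [inputState, hi]

theorem inputState_start {i : ℕ} (hi : i < n) :
    (inputState m XI A T).arr 1 i = vertexIndex (XI ⟨i, hi⟩) := by
  simp [inputState, hi]

theorem marks_image {Y : Fin n → GridVertex m} {v : ℕ} (f : ℕ → ℕ)
    (hf : ∀ i : Fin n, f i = vertexIndex (Y i)) :
    (∃ i < n, (inputState m XI A T).arr 2 i ≠ 0 ∧ f i = v) ↔ marks (A.image Y) v := by
  constructor
  · rintro ⟨i, hi, hA, rfl⟩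
    exact ⟨Y ⟨i, hi⟩, Finset.mem_image_of_mem _ ((inputState_group hi).1 hA), (hf ⟨i, hi⟩).symm⟩
  · rintro ⟨u, hu, rfl⟩
    obtain ⟨i, hi, rfl⟩ := Finset.mem_image.1 hu
    exact ⟨i, i.2, (inputState_group i.2).2 hi, hf i⟩

theorem run_main (hk : 2 ≤ k) (hm : ∀ j, 2 ≤ m j) (h6 : 6 ≤ ∏ j, m j)
    (hW : 300 * (∏ j, m j) * (∏ j, m j) ≤ W) (hX : Function.Injective XI) (hAT : A.card = T.card) :
    Run W mainProg (inputState m XI A T) (200000 * ((∏ j, m j) * ∑ j, m j)) fun s =>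
      Hist (numAdj m) (∏ j, m j) n ((inputState m XI A T).arr 1) s ∧
      s.reg 0 = 250 * ∑ j, m j ∧ s.reg 3 = 250 * ∑ j, m j ∧
      s.arr 2 = (inputState m XI A T).arr 2 ∧ ∀ v < ∏ j, m j, (Col n s v ↔ marks T v) := by
  classical
  have hm' : ∀ j < k, 2 ≤ side m j := fun j hj => by simpa [side, hj] using hm ⟨j, hj⟩
  have hkN := lt_stride hm'
  rw [stride_side] at hkN
  have hNW : 300 * ∏ j, m j ≤ W := by nlinarith
  have hn : n ≤ ∏ j, m j := by
    have := Fintype.card_le_of_injective XI hX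
    simpa using this
  have hs2 : 2 ≤ ∑ j, m j :=
    (hm ⟨0, by omega⟩).trans (Finset.single_le_sum (fun _ _ => Nat.zero_le _) (Finset.mem_univ _))
  have hNs : (∏ j, m j) * 2 ≤ (∏ j, m j) * ∑ j, m j := Nat.mul_le_mul_left _ hs2
  have hsN : ∑ j, m j ≤ ∏ j, m j := by
    rw [← Finset.sum_congr rfl fun j _ => side_coe m j, ← Finset.sum_range, ← stride_side]
    exact sum_le_stride hm'
  set s₀ := inputState m XI A T with hs₀
  have ha2 : ∀ i < n, s₀.arr 2 i ≤ 1 := fun i hi => by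
    simp only [hs₀, inputState, hi, dif_pos]; split <;> omega
  have ha1 : ∀ i < n, s₀.arr 1 i < ∏ j, m j := fun i hi => by
    rw [hs₀, inputState_start hi]; exact vertexIndex_lt _
  refine (Run.frame (Run.seq (T := 20 * k + 10 + (28 * (∏ j, m j) + 6 + 2))
    (T' := 80000 * (∏ j, m j) * (∑ j, m j) + 30 * k + 6 +
      (80000 * (∏ j, m j) * (∑ j, m j) + 30 * k + 6 + 2)) (Q := fun s => Base m n (s₀.arr 1) s ∧
      s.reg 4 = 1 ∧ s.reg 3 = 0 ∧ (∀ v < ∏ j, m j, s.arr 5 v = bit (marks (A.image XI)) v) ∧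
      ∀ v < ∏ j, m j, (Col n s v ↔ marks (A.image XI) v)) ?_
    fun s₁ ag₁ ⟨q₁, q₂, q₃, q₄, q₅⟩ => ?_)).mono (Q := fun s => Agree _ _ s₀ s ∧
      Hist (numAdj m) (∏ j, m j) n (s₀.arr 1) s ∧ s.reg 0 = 250 * ∑ j, m j ∧
      s.reg 3 = 250 * ∑ j, m j ∧ ∀ v < ∏ j, m j, (Col n s v ↔ marks T v))
    (by rw [mul_assoc]; omega) fun s ⟨ag, h₁, h₂, h₃, h₄⟩ =>
      ⟨h₁, h₂, h₃, ag.arr 2 (by decide), h₄⟩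
  · refine Run.seq (run_size hm' hNW rfl rfl) fun s₁ ag₁ q₁ => ?_
    have a1 : ∀ x, s₁.arr x = s₀.arr x := fun x => ag₁.arr x (by
      simp [sizeProg, Program.forLt, Program.arrs])
    have r1 : ∀ x ∉ [2, 22], s₁.reg x = s₀.reg x := fun x hx => ag₁.reg x (by
      revert hx; simp +contextual [sizeProg, Program.forLt, Program.regs])
    refine Run.seq (run_init hNW h6 hn ((r1 1 (by decide)).trans rfl) (by rwa [a1]) (by rwa [a1])
      (fun v => by rw [a1]; rfl)) fun s₂ ag₂ ⟨q₂, q₃⟩ => ?_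
    simp only [a1] at q₂ q₃
    have r2 : ∀ x ∉ [2, 22, 10], s₂.reg x = s₀.reg x := fun x hx => by
      rw [ag₂.reg x (by revert hx; simp +contextual [initProg, Program.forLt, Program.regs]),
        r1 x (by revert hx; simp +contextual)]
    have a2 : ∀ x ∉ [4, 5], s₂.arr x = s₀.arr x := fun x hx => by
      rw [ag₂.arr x (by revert hx; simp +contextual [initProg, Program.forLt, Program.arrs]), a1]
    have r3 : s₂.reg 3 = 0 := (r2 3 (by decide)).trans rfl
    have hhist : Hist (numAdj m) (∏ j, m j) n (s₀.arr 1) s₂ :=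
      ⟨ha1, q₂, by rw [r3]; simp⟩
    have hbase : Base m n (s₀.arr 1) s₂ := ⟨hhist, hn, (r2 0 (by decide)).trans rfl,
      (r2 1 (by decide)).trans rfl, (ag₂.reg 2 (by decide)).trans q₁,
      (a2 0 (by decide)).trans rfl, by rw [a2 2 (by decide)]; exact ha2⟩
    refine (Run.of_wp ?_).mono (by simp [Program.cost]) fun _ h => h
    refine ⟨by simp; omega, hbase.congr (hhist.setReg (by decide))
      (by simp [State.setReg_reg]) (by simp), by simp [State.setReg_reg],
      by simp [State.setReg_reg, r3], fun v hv => ?_, fun v hv => ?_⟩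
    · rw [State.setReg_arr, q₃ v hv]
      exact bit_congr (marks_image _ fun i => inputState_start i.2)
    · rw [col_setReg (by decide), ← marks_image (XI := XI) (T := T) (s₀.arr 1)
        fun i => inputState_start i.2]
      simp only [Col, cur, r3, a2 2 (by decide), zero_mul, zero_add]
      exact ⟨fun ⟨i, hi, h⟩ => ⟨i, hi, h.1, by rw [← q₂ i hi, h.2]⟩,
        fun ⟨i, hi, h⟩ => ⟨i, hi, h.1, by rw [q₂ i hi, h.2]⟩⟩
  · refine Run.seq (run_forward hk hm h6 hW q₁ q₂ q₃ q₄ (fun _ => marks_lt) q₅)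
      fun s₂ ag₂ ⟨p₁, p₂, p₃, p₄⟩ => ?_
    -- Here the two sweeps meet: equal cardinalities give the same initial segment.
    have hcount : Nat.count (marks (A.image XI)) (∏ j, m j) = Nat.count (marks T) (∏ j, m j) := by
      rw [count_marks, count_marks, Finset.card_image_of_injective _ hX, hAT]
    refine Run.seq (run_backward (B := marks T) hk hm h6 hW p₁ p₂ p₃ (fun v hv => ?_)
      (fun _ => marks_lt) fun v hv => ?_) fun s₃ ag₃ ⟨t₁, t₂, t₃⟩ => ?_
    · rw [ag₂.arr 3 (by decide), ag₁.arr 3 (by decide), hs₀, inputState_marks_goal hv]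
    · rw [p₄ v hv, pattern_full fun _ => marks_lt, pattern_full fun _ => marks_lt, hcount]
    · refine (Run.of_wp ?_).mono (by simp [Program.cost]) fun _ h => h
      refine ⟨by simp [t₂]; omega, t₁.hist.setReg (by decide), by simp [State.setReg_reg, t₂],
        by simp [State.setReg_reg, t₂], fun v hv => ?_⟩
      rw [col_setReg (by decide), t₃ v hv]

/-- The permutations recorded in `Hist` act on all vertices, occupied or not; restricted to the
robots they give valid moves, with injectivity passed on from one time to the next. -/
theorem Hist.isReconfiguration (hX : Function.Injective XI)
    (h : Hist (numAdj m) (∏ j, m j) n ((inputState m XI A T).arr 1) s)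
    (h2 : s.arr 2 = (inputState m XI A T).arr 2)
    (hC : ∀ v < ∏ j, m j, (Col n s v ↔ marks T v)) {Y : ℕ → Fin n → GridVertex m}
    (hY : ∀ t ≤ s.reg 3, ∀ i : Fin n, s.arr 4 (t * n + i) = vertexIndex (Y t i)) :
    IsReconfiguration (gridGraph m) XI A T (s.reg 3) Y := by
  have h0 : Y 0 = XI := funext fun i => vertexIndex_injective (by
    rw [← hY 0 (by omega) i, zero_mul, zero_add, h.start i i.2, inputState_start i.2])
  have hstep : ∀ t < s.reg 3, ∃ π, Valid (numAdj m) (∏ j, m j) π ∧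
      ∀ i, vertexIndex (Y (t + 1) i) = π (vertexIndex (Y t i)) := fun t ht => by
    obtain ⟨π, hπ, hs⟩ := h.move t ht
    exact ⟨π, hπ, fun i => by rw [← hY (t + 1) ht i, ← hY t ht.le i, hs i i.2]⟩
  have hinj : ∀ t ≤ s.reg 3, Function.Injective (Y t) := by
    intro t
    induction t with
    | zero => intro _; rwa [h0]
    | succ t ih =>
      intro ht i j hij
      obtain ⟨π, hπ, hs⟩ := hstep t ht
      refine ih (by omega) (vertexIndex_injective ?_)
      exact hπ.inj _ (vertexIndex_lt _) _ (vertexIndex_lt _) (by rw [← hs, ← hs, hij])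
  refine ⟨h0, fun t ht => ⟨hinj t ht.le, hinj (t + 1) ht, fun i => ?_, fun i j hij h₁ h₂ => ?_⟩, ?_⟩
  · obtain ⟨π, hπ, hs⟩ := hstep t ht
    rcases hπ.stay_or_adj _ (vertexIndex_lt (Y t i)) with h' | ⟨u, v, hu, hv, huv⟩
    · exact .inl (vertexIndex_injective ((hs i).trans h'))
    · rw [← hs] at hv
      rw [vertexIndex_injective hu, vertexIndex_injective hv] at huv
      exact .inr huv
  · obtain ⟨π, hπ, hs⟩ := hstep t ht
    have e₁ := hs i
    have e₂ := hs j
    rw [← h₂] at e₁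
    rw [← h₁] at e₂
    -- Two robots that exchange places give a vertex with `π (π v) = v`; then `π v = v`, and both
    -- robots were at the same vertex already.
    have := hπ.no_swap _ (vertexIndex_lt (Y t i)) (by rw [← e₁, ← e₂])
    rw [← e₁] at this
    exact hij (hinj t ht.le (vertexIndex_injective this)).symm
  · have key : ∀ v, marks (A.image (Y (s.reg 3))) v ↔ marks T v := fun v => by
      rw [← marks_image (XI := XI) (T := T) (cur n s) (hY _ le_rfl), ← h2]
      by_cases hv : v < ∏ j, m j
      · exact hC v hv
      · exact ⟨fun h' => absurd (h.col_lt h') hv, fun h' => absurd (marks_lt h') hv⟩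
    ext u
    constructor
    · intro hu
      obtain ⟨u', hu', h'⟩ := (key _).1 ⟨u, hu, rfl⟩
      rwa [← vertexIndex_injective h']
    · intro hu
      obtain ⟨u', hu', h'⟩ := (key _).2 ⟨u, hu, rfl⟩
      rwa [← vertexIndex_injective h']

end

end GridRobots

/-- There are one program and one pair of constants for all grids, of all dimensions: on every
grid, for all robots on it, every group of them, and every set of goal vertices for the group, the
program, run with words of at most `c * log₂ |V|` bits, computes a reconfiguration that has
makespan at most `C * ∑ i, m i`, within `C * (∏ i, m i) * ∑ i, m i` steps. -/
theorem mainTheorem5 :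
    ∃ (P : GridRobots.Program) (c C : ℕ),
      ∀ (k : ℕ) (m : Fin k → ℕ), 2 ≤ k → (∀ i, 2 ≤ m i) → 6 ≤ ∏ i, m i →
      ∀ (n : ℕ) (XI : Fin n → GridRobots.GridVertex m), Function.Injective XI →
      ∀ (A : Finset (Fin n)) (T : Finset (GridRobots.GridVertex m)), A.card = T.card →
        ∃ (s : GridRobots.State) (time τ : ℕ) (X : ℕ → Fin n → GridRobots.GridVertex m),
          GridRobots.Exec ((∏ i, m i) ^ c) P (GridRobots.inputState m XI A T) s time ∧
          time ≤ C * ((∏ i, m i) * ∑ i, m i) ∧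
          GridRobots.IsOutput s τ X ∧
          GridRobots.IsReconfiguration (GridRobots.gridGraph m) XI A T τ X ∧
          τ ≤ C * ∑ i, m i := by
  refine ⟨GridRobots.mainProg, 6, 200000, fun k m hk hm h6 n XI hX A T hAT => ?_⟩
  -- The exponent 6 suffices because `N ≥ 6` gives `N ^ 4 ≥ 1296 ≥ 300`.
  have hW : 300 * (∏ i, m i) * (∏ i, m i) ≤ (∏ i, m i) ^ 6 := by
    have := Nat.pow_le_pow_left h6 4
    rw [show (∏ i, m i) ^ 6 = (∏ i, m i) ^ 4 * (∏ i, m i) * (∏ i, m i) by ring]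
    exact Nat.mul_le_mul_right _ (Nat.mul_le_mul_right _ (by omega))
  obtain ⟨s, time, hE, ht, hist, h0, h3, h2, hC⟩ :=
    GridRobots.run_main (XI := XI) (A := A) (T := T) hk hm h6 hW hX hAT
  -- The default `XI i` only matters after the final time; up to then all entries are vertex numbers
  -- by `Hist.lt`.
  let X : ℕ → Fin n → GridRobots.GridVertex m := fun t i =>
    if h : s.arr 4 (t * n + i) < ∏ i, m i then finPiFinEquiv.symm ⟨_, h⟩ else XI i
  have hXs : ∀ t ≤ s.reg 3, ∀ i : Fin n,
      s.arr 4 (t * n + i) = GridRobots.vertexIndex (X t i) := fun t ht i => by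
    simp only [X, dif_pos (hist.lt ht i.2), GridRobots.vertexIndex, Equiv.apply_symm_apply]
  exact ⟨s, time, s.reg 3, X, hE, ht, ⟨h0.trans h3.symm, hXs⟩,
    hist.isReconfiguration hX h2 hC hXs, by omega⟩
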